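/- Let $n\ge 2$ and $\frac{2n}{n+2}<g_0\le g_1<\infty$. Let $g$ be a positive $C^1$ function on $(0,\infty)$ with $g_0-1\le \frac{s\,g'(s)}{g(s)}\le g_1-1$ for all $s>0$, and put $G(s)=\int_0^s g(r)\,dr$ for $s\ge 0$. Let $\mathcal A:\mathbb R^n\to\mathbb R^n$ be continuous, $C^1$ on $\mathbb R^n\setminus\{0\}$, and suppose that for some constants $0<\nu\le 1\le L$ $$\langle D\mathcal A(\xi)\zeta,\zeta\rangle\ge \nu\,\frac{g(|\xi|)}{|\xi|}\,|\zeta|^2,\qquad |D\mathcal A(\xi)|\le L\,\frac{g(|\xi|)}{|\xi|}\qquad\text{for all }\xi\in\mathbb R^n\setminus\{0\},\ \zeta\in\mathbb R^n .$$ Let $\Omega\subset\mathbb R^n$ be a bounded domain, $T>0$, $\Omega_T=\Omega\times(0,T)$, and let $Q\subset\Omega_T$ be open. For a cylinder $\mathcal K=\mathcal D\times(s,t)$ with $\mathcal D$ open and $s<t$ we write $\mathcal K\Subset Q$ if there is a cylinder $\mathcal D'\times(s',t)\subset Q$ with $\mathcal D'$ open, $\mathcal D\Subset\mathcal D'$ and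 $s'<s$ (for a cylinder $Q=\mathcal D_0\times(t_1,t_2)$ and nonempty $\mathcal D$ this means $\mathcal D\Subset\mathcal D_0$ and $t_1<s<t\le t_2$). The class $V^{2,G}_{\rm loc}(Q)$ consists of the functions $u$ on $Q$ with a weak spatial gradient $Du$ in $Q$ such that, for every cylinder $\mathcal K=\mathcal D\times(s,t)\Subset Q$, one has $u,Du\in L^1(\mathcal K)$, $\int_{\mathcal K}\big(G(|u|)+G(|Du|)\big)\,dx\,dt<\infty$ and $\operatorname*{ess\,sup}_{s<\tau<t}\int_{\mathcal D}|u(x,\tau)|^2\,dx<\infty$. A weak supersolution in $Q$ (of $\partial_t u-\operatorname{div}\mathcal A(Du)=0$) is a function $u\in V^{2,G}_{\rm loc}(Q)$ with $$-\int_Q u\,\partial_t\eta\,dx\,dt+\int_Q \mathcal A(Du)\cdot D\eta\,dx\,dt\ge 0\qquad\text{for every nonnegative }\eta\in C_c^\infty(Q).$$ Theorem. Let $M\ge 1$ and let $(u_i)_{i=1}^\infty$ be a sequence of weak supersolutions in $Q$ such that $|u_i|\le M$ almost everywhere in $Q$ for every $i$ and $u_i\to u$ almost everywhere in $Q$. Then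 $u$ is a weak supersolution in $Q$. -/

import Mathlib

open MeasureTheory Set Filter Topology
open scoped ContDiff NNReal

noncomputable section

/-- Euclidean space `ℝⁿ`. -/
abbrev Space (n : ℕ) : Type := EuclideanSpace ℝ (Fin n)

/-- Space-time `ℝⁿ × ℝ`; `volume` is the product Lebesgue measure. -/
abbrev SpaceTime (n : ℕ) : Type := Space n × ℝ

/-- `g` is positive and `C¹` on `(0, ∞)` with `g₀ - 1 ≤ s g'(s) / g(s) ≤ g₁ - 1` for `s > 0`. -/
structure HasOrliczGrowth (g : ℝ → ℝ) (g₀ g₁ : ℝ) : Prop where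
  contDiffOn : ContDiffOn ℝ 1 g (Ioi 0)
  pos : ∀ s, 0 < s → 0 < g s
  lower : ∀ s, 0 < s → g₀ - 1 ≤ s * deriv g s / g s
  upper : ∀ s, 0 < s → s * deriv g s / g s ≤ g₁ - 1

/-- Ellipticity and growth of the vector field: `A` is continuous, `C¹` away from the origin, and
`⟨DA(ξ)ζ, ζ⟩ ≥ ν g(|ξ|)/|ξ| |ζ|²`, `|DA(ξ)| ≤ L g(|ξ|)/|ξ|` for `ξ ≠ 0`. -/
structure HasOrliczStructure {n : ℕ} (A : Space n → Space n) (g : ℝ → ℝ) (ν L : ℝ) : Prop where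
  continuous : Continuous A
  contDiffOn : ContDiffOn ℝ 1 A {0}ᶜ
  elliptic : ∀ ξ ζ : Space n, ξ ≠ 0 →
    ν * (g ‖ξ‖ / ‖ξ‖) * ‖ζ‖ ^ 2 ≤ inner ℝ (fderiv ℝ A ξ ζ) ζ
  bounded : ∀ ξ : Space n, ξ ≠ 0 → ‖fderiv ℝ A ξ‖ ≤ L * (g ‖ξ‖ / ‖ξ‖)

/-- The Young function `G(s) = ∫₀ˢ g`. -/
def youngPrimitive (g : ℝ → ℝ) (s : ℝ) : ℝ := ∫ r in (0 : ℝ)..s, g r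

/-- `f ∈ L^G(K)`: `f` is measurable on `K` and `∫_K G(|f|) < ∞`. -/
def MemOrlicz {n : ℕ} {F : Type*} [NormedAddCommGroup F] (G : ℝ → ℝ) (f : SpaceTime n → F)
    (K : Set (SpaceTime n)) : Prop :=
  AEStronglyMeasurable f (volume.restrict K) ∧ ∫⁻ z in K, ENNReal.ofReal (G ‖f z‖) < ⊤

/-- `η ∈ C_c^∞(Q)`. -/
structure IsTestFunction {n : ℕ} (Q : Set (SpaceTime n)) (η : SpaceTime n → ℝ) : Prop where
  smooth : ContDiff ℝ ∞ η
  compact : HasCompactSupport η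
  support : tsupport η ⊆ Q

/-- The time derivative `∂ₜη`. -/
def timeDeriv {n : ℕ} (η : SpaceTime n → ℝ) (z : SpaceTime n) : ℝ :=
  deriv (fun s : ℝ => η (z.1, s)) z.2

/-- The spatial gradient `Dη`. -/
def spaceGrad {n : ℕ} (η : SpaceTime n → ℝ) (z : SpaceTime n) : Space n :=
  gradient (fun x : Space n => η (x, z.2)) z.1

/-- `Du` is the weak spatial gradient of `u` in `Q`. -/
structure IsWeakSpaceGrad {n : ℕ} (Q : Set (SpaceTime n)) (u : SpaceTime n → ℝ)
    (Du : SpaceTime n → Space n) : Prop where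
  locInt : LocallyIntegrableOn u Q
  locInt_grad : LocallyIntegrableOn Du Q
  byParts : ∀ φ : SpaceTime n → ℝ, IsTestFunction Q φ →
    ∫ z in Q, u z • spaceGrad φ z = - ∫ z in Q, φ z • Du z

/-- The cylinder `D × (s, t)`. -/
def timeCylinder {n : ℕ} (D : Set (Space n)) (s t : ℝ) : Set (SpaceTime n) := D ×ˢ Ioo s t

/-- `u ∈ V^{2,G}(D × (s, t)) = L^∞(s, t; L²(D)) ∩ V^G(D × (s, t))` with weak spatial gradient `Du`.
Here `u ∈ V^G` means `u, Du ∈ L^G` and `u ∈ L¹(s, t; W^{1,1}(D))`, that is, `u, Du ∈ L¹`. -/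
structure MemV2G {n : ℕ} (G : ℝ → ℝ) (D : Set (Space n)) (s t : ℝ) (u : SpaceTime n → ℝ)
    (Du : SpaceTime n → Space n) : Prop where
  weakGrad : IsWeakSpaceGrad (timeCylinder D s t) u Du
  memOrlicz : MemOrlicz G u (timeCylinder D s t)
  memOrlicz_grad : MemOrlicz G Du (timeCylinder D s t)
  integrable : IntegrableOn u (timeCylinder D s t)
  integrable_grad : IntegrableOn Du (timeCylinder D s t)
  sup_L2 : ∃ C : ℝ≥0, ∀ᵐ τ ∂(volume.restrict (Ioo s t)), ∫⁻ x in D, ‖u (x, τ)‖ₑ ^ 2 ≤ C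

/-- `D × (s, t) ⋐ Q` in the parabolic sense, where the top of the cylinder may touch the top of `Q`:
`D` is open, and some cylinder `D' × (s', t) ⊆ Q` has `D'` open, `D ⋐ D'` and `s' < s < t`.
If `Q = D₀ × (t₁, t₂)` and `D` is nonempty, this says `D ⋐ D₀` and `t₁ < s < t ≤ t₂`. -/
def ParabolicallyInside {n : ℕ} (D : Set (Space n)) (s t : ℝ) (Q : Set (SpaceTime n)) : Prop :=
  IsOpen D ∧ IsCompact (closure D) ∧ s < t ∧
    ∃ (D' : Set (Space n)) (s' : ℝ), IsOpen D' ∧ closure D ⊆ D' ∧ s' < s ∧ timeCylinder D' s' t ⊆ Q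

/-- `u ∈ V^{2,G}_loc(Q)` with weak spatial gradient `Du`. -/
def MemV2GLoc {n : ℕ} (G : ℝ → ℝ) (Q : Set (SpaceTime n)) (u : SpaceTime n → ℝ)
    (Du : SpaceTime n → Space n) : Prop :=
  IsWeakSpaceGrad Q u Du ∧ ∀ D s t, ParabolicallyInside D s t Q → MemV2G G D s t u Du

/-- `u` is a weak supersolution of `∂ₜu - div A(Du) = 0` in `Q`. -/
def IsWeakSupersolution {n : ℕ} (A : Space n → Space n) (g : ℝ → ℝ) (Q : Set (SpaceTime n))
    (u : SpaceTime n → ℝ) : Prop :=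
  ∃ Du : SpaceTime n → Space n, MemV2GLoc (youngPrimitive g) Q u Du ∧
    ∀ η : SpaceTime n → ℝ, IsTestFunction Q η → (∀ z, 0 ≤ η z) →
      0 ≤ - (∫ z in Q, u z * timeDeriv η z) + ∫ z in Q, inner ℝ (A (Du z)) (spaceGrad η z)

end

/-! Since `A` is nonlinear, weak convergence of the gradients does not identify the limit of `A (D
i)`. The core of the proof is strong convergence: the gradients of uniformly bounded supersolutions
that converge almost everywhere are Cauchy in `L¹` on compact sets.

The structure conditions enter through two packages. `IsGrowthFunction` says that `γ`, the extension
of `g`, is monotone, unbounded and doubling; then `s γ(s)` is comparable to `G(s)` and superlinear,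
and it serves as energy density throughout. `IsMonotoneField` says that `A` is strictly monotone,
with growth and coercivity measured by `γ`.

Two supersolutions `a`, `b` with `|a|, |b| ≤ M` are compared as follows. Only nonnegative test
functions are admissible, so `S(a - b)` is shifted by a constant: if `|S| ≤ δ` on `[-2M, 2M]`, the
inequality for `a` is tested with `(δ - S(a - b)) θ` and that for `b` with `(δ + S(a - b)) θ`. In
the sum, the time terms become `W(a - b) - δ(a + b)` against `∂ₜθ`, where `W' = S`, so no time
derivative of a supersolution survives. The gradient terms contain `-S'(a - b) θ ⟨A(Da) - A(Db), Da
- Db⟩`. Mollification in space-time justifies the computation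
(`integral_comparisonIntegrand_nonneg`). It is used twice.

With `b = 0`, `S(x) = x` and `δ = 2M` it gives the Caccioppoli estimate `integral_energy_le`: the
energies are bounded on compact sets by a constant that depends on `M` but not on the supersolution.
With `S` a smooth truncation at height `δ` all terms but the monotone one are `O(δ)`, so `∫ S'(a -
b) ⟨A(Da) - A(Db), Da - Db⟩ ≤ B δ` (`exists_integral_truncDeriv_mul_le`). This holds for every pair
of supersolutions, however far apart.

Strict monotonicity bounds `|Da - Db|` by a small multiple of the energies plus a multiple of the
monotone expression. This is used where `|a - b| ≤ δ`; the remaining set contributes little, because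
`a - b` is small in `L¹` and the energy is superlinear. Hence the gradients are Cauchy in `L¹`, the
energies pass to the limit by Fatou, the fluxes converge in `L¹`, and both weak identities pass to
the limit.

The class `V^{2,G}_loc` also demands finite energy on cylinders that touch the top of `Q`. The
Caccioppoli estimate uses only an upper bound for `∂ₜφ`, so the cutoff may fall to zero arbitrarily
fast near the final time, at no cost in the constant. -/

/-- The function `g` on `(0, ∞)`, extended by zero to the half-line `(-∞, 0]`. -/
noncomputable def extendZero (g : ℝ → ℝ) (s : ℝ) : ℝ := if 0 < s then g s else 0

/-- A nonnegative nondecreasing function on the line that tends to infinity and satisfies a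
doubling condition of power type. -/
structure IsGrowthFunction (γ : ℝ → ℝ) (P : ℕ) : Prop where
  monotone : Monotone γ
  nonneg : ∀ s, 0 ≤ γ s
  tendsto_atTop : Tendsto γ atTop atTop
  doubling : ∀ c s : ℝ, 1 ≤ c → 0 ≤ s → γ (c * s) ≤ c ^ P * γ s
  continuous_mul : Continuous fun s => s * γ s

/-- A continuous strictly monotone vector field whose growth and coercivity are measured by `γ`. -/
structure IsMonotoneField {n : ℕ} (A : Space n → Space n) (γ : ℝ → ℝ) (C c : ℝ) : Prop where
  continuous : Continuous A
  strictMono : ∀ ξ ζ, ξ ≠ ζ → 0 < inner ℝ (A ξ - A ζ) (ξ - ζ)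
  growth : ∀ ξ, ‖A ξ - A 0‖ ≤ C * γ ‖ξ‖
  coercive : ∀ ξ, c * (‖ξ‖ * γ ‖ξ‖) ≤ inner ℝ (A ξ - A 0) ξ

/-! ### Growth of `g` and comparability of `G(s)` with `s g(s)`. -/

namespace HasOrliczGrowth

variable {g : ℝ → ℝ} {g₀ g₁ : ℝ}

theorem hasDerivAt (hg : HasOrliczGrowth g g₀ g₁) {s : ℝ} (hs : 0 < s) :
    HasDerivAt g (deriv g s) s :=
  ((hg.contDiffOn.differentiableOn (by norm_num)).differentiableAt
    (Ioi_mem_nhds hs)).hasDerivAt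

theorem lower_mul (hg : HasOrliczGrowth g g₀ g₁) {s : ℝ} (hs : 0 < s) :
    (g₀ - 1) * g s ≤ s * deriv g s :=
  (le_div_iff₀ (hg.pos s hs)).1 (hg.lower s hs)

theorem upper_mul (hg : HasOrliczGrowth g g₀ g₁) {s : ℝ} (hs : 0 < s) :
    s * deriv g s ≤ (g₁ - 1) * g s :=
  (div_le_iff₀ (hg.pos s hs)).1 (hg.upper s hs)

theorem continuousOn (hg : HasOrliczGrowth g g₀ g₁) : ContinuousOn g (Ioi 0) :=
  hg.contDiffOn.continuousOn

theorem monotoneOn (hg : HasOrliczGrowth g g₀ g₁) (h₀ : 1 < g₀) : MonotoneOn g (Ioi 0) := by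
  apply monotoneOn_of_deriv_nonneg (convex_Ioi 0) hg.continuousOn
  · rw [interior_Ioi]; exact hg.contDiffOn.differentiableOn (by norm_num)
  · intro s hs
    rw [interior_Ioi] at hs
    have h1 := hg.lower_mul hs
    have h2 := hg.pos s hs
    have h3 : 0 ≤ s * deriv g s := le_trans (by nlinarith) h1
    exact nonneg_of_mul_nonneg_right h3 hs

/-- The derivative of the quotient has the sign of `s g' - P g`. This monotonicity is the source of
the doubling condition. -/
theorem antitoneOn_div_pow (hg : HasOrliczGrowth g g₀ g₁) {P : ℕ} (hP : g₁ - 1 ≤ P) :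
    AntitoneOn (fun s => g s / s ^ P) (Ioi 0) := by
  have hd : ∀ s : ℝ, 0 < s → HasDerivAt (fun s => g s / s ^ P)
      ((deriv g s * s ^ P - g s * (P * s ^ (P - 1))) / (s ^ P) ^ 2) s := by
    intro s hs
    exact (hg.hasDerivAt hs).div (hasDerivAt_pow P s) (by positivity)
  apply antitoneOn_of_deriv_nonpos (convex_Ioi 0)
  · intro s hs; exact (hd s hs).continuousAt.continuousWithinAt
  · rw [interior_Ioi]
    intro s hs; exact (hd s hs).differentiableAt.differentiableWithinAt
  · intro s hs
    rw [interior_Ioi] at hs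
    have hs' : 0 < s := hs
    rw [(hd s hs).deriv]
    apply div_nonpos_of_nonpos_of_nonneg _ (by positivity)
    have h1 := hg.upper_mul hs
    have h2 := hg.pos s hs
    have h3 : s * deriv g s ≤ P * g s := h1.trans (by gcongr)
    -- The exponent `P - 1` is truncated at `P = 0`, so that case is separate.
    rcases P with _ | k
    · simp at h3 ⊢
      by_contra hcon; push Not at hcon; nlinarith [mul_pos hs' hcon]
    · have : deriv g s * s ^ (k + 1) - g s * (((k + 1 : ℕ) : ℝ) * s ^ (k + 1 - 1))
        = s ^ k * (s * deriv g s - ((k + 1 : ℕ) : ℝ) * g s) := by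
        simp only [Nat.add_sub_cancel]; ring
      rw [this]
      exact mul_nonpos_of_nonneg_of_nonpos (by positivity) (by linarith)

/-- For `s ≥ 1` one has `s g'(s) ≥ (g₀ - 1) g(1) > 0`, so `g` grows at least like a logarithm. Mere
divergence is enough later, since it makes `s g(s)` superlinear. -/
theorem tendsto_atTop (hg : HasOrliczGrowth g g₀ g₁) (h₀ : 1 < g₀) : Tendsto g atTop atTop := by
  have hmono := hg.monotoneOn h₀
  have hg1 := hg.pos 1 one_pos
  have hd : ∀ s : ℝ, 0 < s → HasDerivAt (fun s => g s - (g₀ - 1) * g 1 * Real.log s)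
      (deriv g s - (g₀ - 1) * g 1 * s⁻¹) s := fun s hs =>
    (hg.hasDerivAt hs).sub ((Real.hasDerivAt_log hs.ne').const_mul _)
  have hm : MonotoneOn (fun s => g s - (g₀ - 1) * g 1 * Real.log s) (Ici 1) := by
    apply monotoneOn_of_deriv_nonneg (convex_Ici 1)
    · intro s hs; exact (hd s (one_pos.trans_le hs)).continuousAt.continuousWithinAt
    · rw [interior_Ici]
      intro s hs; exact (hd s (one_pos.trans hs)).differentiableAt.differentiableWithinAt
    · intro s hs
      rw [interior_Ici] at hs
      have hs0 : 0 < s := one_pos.trans hs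
      rw [(hd s hs0).deriv]
      have h1 := hg.lower_mul hs0
      have h2 : g 1 ≤ g s := hmono (mem_Ioi.2 one_pos) hs0 (le_of_lt hs)
      have h3 : (g₀ - 1) * g 1 ≤ s * deriv g s :=
        (mul_le_mul_of_nonneg_left h2 (by linarith)).trans h1
      rw [sub_nonneg, ← div_eq_mul_inv, div_le_iff₀ hs0]
      linarith
  have hlog : Tendsto (fun s => g 1 + (g₀ - 1) * g 1 * Real.log s) atTop atTop :=
    tendsto_atTop_add_const_left _ _
      (Real.tendsto_log_atTop.const_mul_atTop (mul_pos (by linarith) hg1))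
  refine tendsto_atTop_mono' _ ?_ hlog
  filter_upwards [eventually_ge_atTop 1] with s hs
  have := hm (mem_Ici.2 le_rfl) hs hs
  simp at this
  linarith

theorem isGrowthFunction (hg : HasOrliczGrowth g g₀ g₁) (h₀ : 1 < g₀) {P : ℕ}
    (hP : g₁ - 1 ≤ P) : IsGrowthFunction (extendZero g) P := by
  have hmono := hg.monotoneOn h₀
  have hnn : ∀ s, 0 ≤ extendZero g s := by
    intro s; unfold extendZero; split_ifs with h
    · exact (hg.pos s h).le
    · exact le_rfl
  have hm : Monotone (extendZero g) := by
    intro s t hst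
    unfold extendZero
    split_ifs with h1 h2 h2
    · exact hmono h1 h2 hst
    · exact absurd (h1.trans_le hst) h2
    · exact (hg.pos t h2).le
    · exact le_rfl
  refine ⟨hm, hnn, ?_, ?_, ?_⟩
  · refine (hg.tendsto_atTop h₀).congr' ?_
    filter_upwards [eventually_gt_atTop 0] with s hs
    simp [extendZero, hs]
  · intro c s hc hs
    rcases hs.eq_or_lt with rfl | hs
    · simp [extendZero]
    have hc0 : 0 < c := one_pos.trans_le hc
    have hcs : 0 < c * s := mul_pos hc0 hs
    have h := hg.antitoneOn_div_pow hP hs hcs (by nlinarith)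
    simp only [extendZero, hs, hcs, if_true]
    simp only [] at h
    rw [div_le_div_iff₀ (by positivity) (by positivity), mul_pow] at h
    have hsP : 0 < s ^ P := by positivity
    nlinarith
  · rw [continuous_iff_continuousAt]
    intro s
    rcases lt_trichotomy s 0 with hs | rfl | hs
    · have : (fun s => s * extendZero g s) =ᶠ[𝓝 s] fun _ => 0 := by
        filter_upwards [Iio_mem_nhds hs] with t ht
        simp [extendZero, not_lt.2 (le_of_lt (mem_Iio.1 ht))]
      exact (continuousAt_const).congr this.symm
    -- At the origin `γ` is only used as a bounded function; the factor `s` gives continuity.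
    · have h1 : Tendsto (fun s : ℝ => |s| * extendZero g 1) (𝓝 0) (𝓝 0) := by
        have : Continuous fun s : ℝ => |s| * extendZero g 1 := by fun_prop
        simpa using this.tendsto 0
      unfold ContinuousAt
      simp only [zero_mul]
      refine squeeze_zero_norm' ?_ h1
      filter_upwards [Iio_mem_nhds (one_pos : (0 : ℝ) < 1)] with t ht
      rw [norm_mul, Real.norm_eq_abs, Real.norm_eq_abs, abs_of_nonneg (hnn t)]
      gcongr
      exact hm (le_of_lt ht)
    · have : (fun s => s * extendZero g s) =ᶠ[𝓝 s] fun s => s * g s := by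
        filter_upwards [Ioi_mem_nhds hs] with t ht
        simp [extendZero, mem_Ioi.1 ht]
      exact (continuousAt_id.mul (hg.hasDerivAt hs).continuousAt).congr this.symm

theorem youngPrimitive_eq (g : ℝ → ℝ) {s : ℝ} (hs : 0 ≤ s) :
    youngPrimitive g s = ∫ r in (0 : ℝ)..s, extendZero g r := by
  unfold youngPrimitive
  apply intervalIntegral.integral_congr_ae
  refine Eventually.of_forall fun r hr => ?_
  rw [uIoc_of_le hs] at hr
  simp [extendZero, hr.1]

end HasOrliczGrowth

namespace IsGrowthFunction

variable {γ : ℝ → ℝ} {P : ℕ}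

theorem intervalIntegrable (hγ : IsGrowthFunction γ P) (a b : ℝ) :
    IntervalIntegrable γ volume a b :=
  (hγ.monotone.monotoneOn _).intervalIntegrable

theorem primitive_le (hγ : IsGrowthFunction γ P) {s : ℝ} (hs : 0 ≤ s) :
    ∫ r in (0 : ℝ)..s, γ r ≤ s * γ s := by
  have := intervalIntegral.integral_mono_on hs (hγ.intervalIntegrable 0 s)
    (intervalIntegrable_const (c := γ s)) fun r hr => hγ.monotone hr.2
  simpa using this

/-- The integral over `[s/2, s]` is at least `(s/2) γ(s/2)`, and doubling returns to `γ(s)`: this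
accounts for `2 · 2 ^ P`. -/
theorem le_primitive (hγ : IsGrowthFunction γ P) {s : ℝ} (hs : 0 ≤ s) :
    s * γ s ≤ 2 ^ (P + 1) * ∫ r in (0 : ℝ)..s, γ r := by
  have h1 := intervalIntegral.integral_mono_on (by linarith : s / 2 ≤ s)
    (intervalIntegrable_const (c := γ (s / 2))) (hγ.intervalIntegrable (s / 2) s)
    fun r hr => hγ.monotone hr.1
  have h2 := intervalIntegral.integral_add_adjacent_intervals (hγ.intervalIntegrable 0 (s / 2))
    (hγ.intervalIntegrable (s / 2) s)
  have h3 : 0 ≤ ∫ r in (0 : ℝ)..(s / 2), γ r :=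
    intervalIntegral.integral_nonneg (by linarith) fun r _ => hγ.nonneg r
  have h4 := hγ.doubling 2 (s / 2) one_le_two (by linarith)
  rw [mul_div_cancel₀ s two_ne_zero] at h4
  simp only [intervalIntegral.integral_const, smul_eq_mul] at h1
  calc s * γ s ≤ s * (2 ^ P * γ (s / 2)) := by gcongr
    _ = 2 ^ (P + 1) * ((s - s / 2) * γ (s / 2)) := by ring
    _ ≤ _ := by gcongr; linarith

end IsGrowthFunction

/-! ### Monotonicity, growth and coercivity of the vector field. -/

namespace HasOrliczStructure

variable {n : ℕ} {A : Space n → Space n} {g : ℝ → ℝ} {g₀ g₁ ν L : ℝ}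

theorem hasFDerivAt (hA : HasOrliczStructure A g ν L) {ξ : Space n} (hξ : ξ ≠ 0) :
    HasFDerivAt A (fderiv ℝ A ξ) ξ :=
  ((hA.contDiffOn.differentiableOn (by norm_num)).differentiableAt
    (isOpen_compl_singleton.mem_nhds hξ)).hasFDerivAt

theorem hasDerivAt_segment (hA : HasOrliczStructure A g ν L) (p d : Space n) {t : ℝ}
    (ht : p + t • d ≠ 0) :
    HasDerivAt (fun t : ℝ => A (p + t • d)) (fderiv ℝ A (p + t • d) d) t := by
  have h1 : HasDerivAt (fun t : ℝ => p + t • d) d t := by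
    simpa using ((hasDerivAt_id t).smul_const d).const_add p
  exact (hA.hasFDerivAt ht).comp_hasDerivAt t h1

theorem hasDerivAt_inner_segment (hA : HasOrliczStructure A g ν L) (p d e : Space n) {t : ℝ}
    (ht : p + t • d ≠ 0) :
    HasDerivAt (fun t : ℝ => inner ℝ (A (p + t • d)) e)
      (inner ℝ (fderiv ℝ A (p + t • d) d) e) t := by
  simpa using (hA.hasDerivAt_segment p d ht).inner ℝ (hasDerivAt_const t e)

/-- Ellipticity makes `t ↦ ⟨A(p + t(q - p)), q - p⟩` strictly increasing as long as the open segment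
avoids the origin, where `A` need not be differentiable. -/
theorem strictMono_of_ne (hA : HasOrliczStructure A g ν L) (hν : 0 < ν)
    (hpos : ∀ s, 0 < s → 0 < g s) {p q : Space n} (hpq : q ≠ p)
    (h : ∀ t ∈ Ioo (0 : ℝ) 1, p + t • (q - p) ≠ 0) :
    0 < inner ℝ (A q - A p) (q - p) := by
  have hc : Continuous fun t : ℝ => inner ℝ (A (p + t • (q - p))) (q - p) := by
    have := hA.continuous
    fun_prop
  have hs : StrictMonoOn (fun t : ℝ => inner ℝ (A (p + t • (q - p))) (q - p)) (Icc 0 1) := by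
    apply strictMonoOn_of_deriv_pos (convex_Icc 0 1) hc.continuousOn
    intro t ht
    rw [interior_Icc] at ht
    rw [(hA.hasDerivAt_inner_segment p (q - p) (q - p) (h t ht)).deriv]
    refine lt_of_lt_of_le ?_ (hA.elliptic _ _ (h t ht))
    have h1 : 0 < ‖p + t • (q - p)‖ := norm_pos_iff.2 (h t ht)
    have h2 : 0 < ‖q - p‖ := norm_pos_iff.2 (sub_ne_zero.2 hpq)
    have h3 := hpos _ h1
    positivity
  have := hs (left_mem_Icc.2 zero_le_one) (right_mem_Icc.2 zero_le_one) one_pos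
  simp at this
  rw [inner_sub_left]
  linarith

theorem inner_sub_zero_pos (hA : HasOrliczStructure A g ν L) (hν : 0 < ν)
    (hpos : ∀ s, 0 < s → 0 < g s) {q : Space n} (hq : q ≠ 0) :
    0 < inner ℝ (A q - A 0) q := by
  have := hA.strictMono_of_ne hν hpos (p := 0) hq (fun t ht => by
    simp [hq, ht.1.ne'])
  simpa using this

theorem strictMono (hA : HasOrliczStructure A g ν L) (hν : 0 < ν)
    (hpos : ∀ s, 0 < s → 0 < g s) {p q : Space n} (hpq : q ≠ p) :
    0 < inner ℝ (A q - A p) (q - p) := by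
  by_cases h : ∀ t ∈ Ioo (0 : ℝ) 1, p + t • (q - p) ≠ 0
  · exact hA.strictMono_of_ne hν hpos hpq h
  -- If the segment meets the origin, `p` and `q` are multiples of `d` with opposite signs, and the
  -- two halves are compared with `A 0` separately.
  push Not at h
  obtain ⟨t, ht, h0⟩ := h
  have ht0 := ht.1
  have ht1 : 0 < 1 - t := by linarith [ht.2]
  set d := q - p with hd
  have hd0 : d ≠ 0 := sub_ne_zero.2 hpq
  have hp : p = -(t • d) := eq_neg_of_add_eq_zero_left h0
  have hq : q = (1 - t) • d := by
    have : q = d + p := by rw [hd]; abel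
    rw [this, hp, sub_smul, one_smul]; abel
  have h1 : 0 < inner ℝ (A q - A 0) q :=
    hA.inner_sub_zero_pos hν hpos (by rw [hq]; exact smul_ne_zero ht1.ne' hd0)
  have h2 : 0 < inner ℝ (A p - A 0) p :=
    hA.inner_sub_zero_pos hν hpos (by rw [hp]; exact neg_ne_zero.2 (smul_ne_zero ht0.ne' hd0))
  rw [show inner ℝ (A q - A 0) q = (1 - t) * inner ℝ (A q - A 0) d by
    conv_lhs => rw [hq]
    rw [inner_smul_right, ← hq]] at h1
  rw [show inner ℝ (A p - A 0) p = -(t * inner ℝ (A p - A 0) d) by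
    conv_lhs => rw [hp]
    rw [inner_neg_right, inner_smul_right, ← hp]] at h2
  have h3 : 0 < inner ℝ (A q - A 0) d := pos_of_mul_pos_right h1 ht1.le
  have h4 : inner ℝ (A p - A 0) d < 0 := by
    by_contra hc; push Not at hc; nlinarith [mul_nonneg ht0.le hc]
  have : A q - A p = (A q - A 0) - (A p - A 0) := by abel
  rw [this, inner_sub_left]
  linarith

/-- Along the ray, `|d/dt A(tξ)| ≤ L g(t|ξ|)/t`, and `g(s)/s ≤ g'(s)/(g₀ - 1)` turns this into a
multiple of `d/dt g(t|ξ|)`. The mean value inequality is applied on `[a, 1]`, away from the origin,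
and then `a → 0`. -/
theorem growth (hA : HasOrliczStructure A g ν L) (hg : HasOrliczGrowth g g₀ g₁) (h₀ : 1 < g₀)
    (hL : 0 ≤ L) (ξ : Space n) : ‖A ξ - A 0‖ ≤ L / (g₀ - 1) * extendZero g ‖ξ‖ := by
  rcases eq_or_ne ξ 0 with rfl | hξ
  · simp [extendZero]
  have hn : 0 < ‖ξ‖ := norm_pos_iff.2 hξ
  have hpos : 0 < g₀ - 1 := by linarith
  have hstep : ∀ a ∈ Ioo (0 : ℝ) 1, ‖A ξ - A (a • ξ)‖ ≤ L / (g₀ - 1) * g ‖ξ‖ := by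
    intro a ha
    have key := image_norm_le_of_norm_deriv_right_le_deriv_boundary' (E := Space n)
      (f := fun t : ℝ => A (t • ξ) - A (a • ξ))
      (f' := fun t : ℝ => fderiv ℝ A (t • ξ) ξ) (a := a) (b := 1)
      (B := fun t => L / (g₀ - 1) * g (t * ‖ξ‖))
      (B' := fun t => L / (g₀ - 1) * (deriv g (t * ‖ξ‖) * ‖ξ‖)) ?_ ?_ ?_ ?_ ?_ ?_
    · have := key (right_mem_Icc.2 ha.2.le)
      simpa using this
    · have := hA.continuous
      exact Continuous.continuousOn (by fun_prop)
    · intro t ht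
      have ht0 : 0 < t := ha.1.trans_le ht.1
      have := hA.hasDerivAt_segment 0 ξ (t := t) (by simp [hξ, ht0.ne'])
      simp only [zero_add] at this
      exact (this.sub_const _).hasDerivWithinAt
    · simp only [sub_self, norm_zero]
      have := hg.pos (a * ‖ξ‖) (mul_pos ha.1 hn)
      positivity
    · intro t ht
      have ht0 : 0 < t := ha.1.trans_le ht.1
      have := (hg.hasDerivAt (mul_pos ht0 hn)).continuousAt
      exact ((this.comp (f := fun t : ℝ => t * ‖ξ‖) (by fun_prop)).const_mul _).continuousWithinAt
    · intro t ht
      have ht0 : 0 < t := ha.1.trans_le ht.1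
      have h1 : HasDerivAt (fun t : ℝ => t * ‖ξ‖) ‖ξ‖ t := by
        simpa using (hasDerivAt_id t).mul_const ‖ξ‖
      exact (((hg.hasDerivAt (mul_pos ht0 hn)).comp t h1).const_mul _).hasDerivWithinAt
    · intro t ht
      have ht0 : 0 < t := ha.1.trans_le ht.1
      have hb := hA.bounded (t • ξ) (smul_ne_zero ht0.ne' hξ)
      have hn' : ‖t • ξ‖ = t * ‖ξ‖ := by rw [norm_smul, Real.norm_of_nonneg ht0.le]
      rw [hn'] at hb
      have hs := mul_pos ht0 hn
      have h2 := hg.lower_mul hs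
      have h3 : g (t * ‖ξ‖) / (t * ‖ξ‖) ≤ deriv g (t * ‖ξ‖) / (g₀ - 1) := by
        rw [div_le_div_iff₀ hs hpos]; linarith
      calc ‖fderiv ℝ A (t • ξ) ξ‖ ≤ ‖fderiv ℝ A (t • ξ)‖ * ‖ξ‖ := ContinuousLinearMap.le_opNorm _ _
        _ ≤ L * (deriv g (t * ‖ξ‖) / (g₀ - 1)) * ‖ξ‖ := by
          gcongr; exact hb.trans (by gcongr)
        _ = _ := by ring
  have hc : Tendsto (fun a : ℝ => ‖A ξ - A (a • ξ)‖) (𝓝[>] 0) (𝓝 ‖A ξ - A 0‖) := by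
    have := hA.continuous
    have hcont : Continuous fun a : ℝ => ‖A ξ - A (a • ξ)‖ := by fun_prop
    have h := hcont.tendsto 0
    simp only [zero_smul] at h
    exact h.mono_left nhdsWithin_le_nhds
  have := le_of_tendsto hc (by
    filter_upwards [Ioo_mem_nhdsGT (one_pos : (0 : ℝ) < 1)] with a ha using hstep a ha)
  simpa [extendZero, hn, hξ] using this

/-- Only the outer half of the ray is estimated: there `⟨A(tξ), ξ⟩` has slope at least `ν g(|ξ|/2)
|ξ|`, while the inner half contributes a positive amount. Half the length and one use of doubling
give `2 ^ (P + 1)`. -/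
theorem coercive (hA : HasOrliczStructure A g ν L) (hg : HasOrliczGrowth g g₀ g₁) (h₀ : 1 < g₀)
    (hν : 0 < ν) {P : ℕ} (hP : g₁ - 1 ≤ P) (ξ : Space n) :
    ν / 2 ^ (P + 1) * (‖ξ‖ * extendZero g ‖ξ‖) ≤ inner ℝ (A ξ - A 0) ξ := by
  rcases eq_or_ne ξ 0 with rfl | hξ
  · simp
  have hn : 0 < ‖ξ‖ := norm_pos_iff.2 hξ
  have hhalf : (1 / 2 : ℝ) • ξ ≠ 0 := smul_ne_zero (by norm_num) hξ
  have h1 := hA.inner_sub_zero_pos hν hg.pos hhalf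
  rw [inner_smul_right] at h1
  have hc : ContinuousOn (fun t : ℝ => inner ℝ (A ((0 : Space n) + t • ξ)) ξ) (Icc (1 / 2) 1) := by
    have := hA.continuous
    exact Continuous.continuousOn (by fun_prop)
  have hdb := (hg.isGrowthFunction h₀ hP).doubling 2 (‖ξ‖ / 2) one_le_two (by linarith)
  rw [mul_div_cancel₀ _ two_ne_zero] at hdb
  have hh : 0 < ‖ξ‖ / 2 := by linarith
  simp only [extendZero, hn, hh, if_true] at hdb ⊢
  have h2 := (convex_Icc (1 / 2 : ℝ) 1).mul_sub_le_image_sub_of_le_deriv hc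
    (fun t ht => by
      rw [interior_Icc] at ht
      have ht0 : 0 < t := by linarith [ht.1]
      exact (hA.hasDerivAt_inner_segment 0 ξ ξ
        (by simp [hξ, ht0.ne'])).differentiableAt.differentiableWithinAt)
    (C := ν * (g (‖ξ‖ / 2) * ‖ξ‖))
    (fun t ht => by
      rw [interior_Icc] at ht
      have ht0 : 0 < t := by linarith [ht.1]
      have hne : (0 : Space n) + t • ξ ≠ 0 := by simp [hξ, ht0.ne']
      rw [(hA.hasDerivAt_inner_segment 0 ξ ξ hne).deriv]
      refine le_trans ?_ (hA.elliptic _ _ hne)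
      have hn' : ‖(0 : Space n) + t • ξ‖ = t * ‖ξ‖ := by
        rw [zero_add, norm_smul, Real.norm_of_nonneg ht0.le]
      rw [hn']
      have hmono : g (‖ξ‖ / 2) ≤ g (t * ‖ξ‖) :=
        hg.monotoneOn h₀ (by simpa using hξ) (mul_pos ht0 hn) (by nlinarith [ht.1])
      have hgp := hg.pos _ (mul_pos ht0 hn)
      have : g (t * ‖ξ‖) * ‖ξ‖ ≤ g (t * ‖ξ‖) / (t * ‖ξ‖) * ‖ξ‖ ^ 2 := by
        have e : g (t * ‖ξ‖) / (t * ‖ξ‖) * ‖ξ‖ ^ 2 = g (t * ‖ξ‖) * ‖ξ‖ / t := by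
          field_simp
        rw [e, le_div_iff₀ ht0]
        nlinarith [mul_pos hgp hn, ht.2]
      rw [mul_assoc]
      refine mul_le_mul_of_nonneg_left ?_ hν.le
      exact (by gcongr : g (‖ξ‖ / 2) * ‖ξ‖ ≤ g (t * ‖ξ‖) * ‖ξ‖).trans this)
    (1 / 2) (by norm_num) 1 (by norm_num) (by norm_num)
  simp only [zero_add, one_smul] at h2
  have h3 : ν / 2 ^ (P + 1) * (‖ξ‖ * g ‖ξ‖) ≤ ν * (g (‖ξ‖ / 2) * ‖ξ‖) * (1 - 1 / 2) := by
    have : ν / 2 ^ (P + 1) * (‖ξ‖ * g ‖ξ‖) ≤ ν / 2 ^ (P + 1) * (‖ξ‖ * (2 ^ P * g (‖ξ‖ / 2))) := by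
      gcongr
    refine this.trans (le_of_eq ?_)
    rw [pow_succ]; field_simp; norm_num
  rw [inner_sub_left] at h1 ⊢
  linarith

theorem isMonotoneField (hA : HasOrliczStructure A g ν L) (hg : HasOrliczGrowth g g₀ g₁)
    (h₀ : 1 < g₀) (hν : 0 < ν) (hL : 0 ≤ L) {P : ℕ} (hP : g₁ - 1 ≤ P) :
    IsMonotoneField A (extendZero g) (L / (g₀ - 1)) (ν / 2 ^ (P + 1)) :=
  ⟨hA.continuous, fun _ _ h => hA.strictMono hν hg.pos h, hA.growth hg h₀ hL,
    hA.coercive hg h₀ hν hP⟩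

end HasOrliczStructure

/-! ### Dominated convergence with varying majorants. -/

section Limits

variable {α : Type*} [MeasurableSpace α] {μ : Measure α}

/-- A one-sided form of the generalized dominated convergence theorem, where the dominating
functions may vary along the sequence. -/
theorem integral_nonneg_of_tendsto_of_dominated {f : ℕ → α → ℝ} {f₀ : α → ℝ} {Φ : ℕ → α → ℝ}
    {Φ₀ : α → ℝ} (hf : ∀ m, AEStronglyMeasurable (f m) μ) (hΦ : ∀ m, Integrable (Φ m) μ)
    (hΦ₀ : Integrable Φ₀ μ) (hb : ∀ m, ∀ᵐ x ∂μ, |f m x| ≤ Φ m x)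
    (hlim : ∀ᵐ x ∂μ, Tendsto (fun m => f m x) atTop (𝓝 (f₀ x)))
    (hΦlim : ∀ᵐ x ∂μ, Tendsto (fun m => Φ m x) atTop (𝓝 (Φ₀ x)))
    (hint : Tendsto (fun m => ∫ x, Φ m x ∂μ) atTop (𝓝 (∫ x, Φ₀ x ∂μ)))
    (hnn : ∀ m, 0 ≤ ∫ x, f m x ∂μ) : Integrable f₀ μ ∧ 0 ≤ ∫ x, f₀ x ∂μ := by
  have hfi : ∀ m, Integrable (f m) μ := fun m => (hΦ m).mono' (hf m) (hb m)
  have hb' : ∀ᵐ x ∂μ, ∀ m, |f m x| ≤ Φ m x := ae_all_iff.2 hb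
  have hf₀m : AEStronglyMeasurable f₀ μ := aestronglyMeasurable_of_tendsto_ae atTop hf hlim
  have hbound : ∀ᵐ x ∂μ, |f₀ x| ≤ Φ₀ x := by
    filter_upwards [hb', hlim, hΦlim] with x h1 h2 h3
    exact le_of_tendsto_of_tendsto' h2.abs h3 h1
  have hf₀ : Integrable f₀ μ := hΦ₀.mono' hf₀m hbound
  refine ⟨hf₀, ?_⟩
  have hnn₀ : 0 ≤ᵐ[μ] fun x => Φ₀ x - f₀ x := by
    filter_upwards [hbound] with x hx
    exact sub_nonneg.2 ((le_abs_self _).trans hx)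
  -- Fatou for `Φ m - f m ≥ 0`; the term `-∫ f m` is dropped because `∫ f m ≥ 0`.
  have hFatou : ∫⁻ x, ENNReal.ofReal (Φ₀ x - f₀ x) ∂μ ≤ ENNReal.ofReal (∫ x, Φ₀ x ∂μ) := by
    calc ∫⁻ x, ENNReal.ofReal (Φ₀ x - f₀ x) ∂μ
        = ∫⁻ x, liminf (fun m => ENNReal.ofReal (Φ m x - f m x)) atTop ∂μ := by
          apply lintegral_congr_ae
          filter_upwards [hlim, hΦlim] with x h2 h3
          exact ((ENNReal.continuous_ofReal.tendsto _).comp (h3.sub h2)).liminf_eq.symm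
      _ ≤ liminf (fun m => ∫⁻ x, ENNReal.ofReal (Φ m x - f m x) ∂μ) atTop :=
          lintegral_liminf_le' fun m =>
            ((hΦ m).aestronglyMeasurable.sub (hf m)).aemeasurable.ennreal_ofReal
      _ ≤ liminf (fun m => ENNReal.ofReal (∫ x, Φ m x ∂μ)) atTop := by
          refine liminf_le_liminf (Eventually.of_forall fun m => ?_)
          rw [← ofReal_integral_eq_lintegral_ofReal (f := fun x => Φ m x - f m x)
            ((hΦ m).sub (hfi m))]
          · apply ENNReal.ofReal_le_ofReal
            rw [integral_sub (hΦ m) (hfi m)]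
            linarith [hnn m]
          · filter_upwards [hb m] with x hx
            exact sub_nonneg.2 ((le_abs_self _).trans hx)
      _ = _ := ((ENNReal.continuous_ofReal.tendsto _).comp hint).liminf_eq
  rw [← ofReal_integral_eq_lintegral_ofReal (f := fun x => Φ₀ x - f₀ x) (hΦ₀.sub hf₀) hnn₀] at hFatou
  have h0 : 0 ≤ ∫ x, Φ₀ x ∂μ := integral_nonneg_of_ae (by
    filter_upwards [hbound] with x hx using (abs_nonneg _).trans hx)
  rw [ENNReal.ofReal_le_ofReal_iff h0, integral_sub hΦ₀ hf₀] at hFatou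
  linarith

end Limits

/-! ### Derivatives of test functions on space-time. -/

section Calculus

variable {n : ℕ}

instance : (volume : Measure (SpaceTime n)).IsAddHaarMeasure :=
  inferInstanceAs ((volume : Measure (Space n)).prod (volume : Measure ℝ)).IsAddHaarMeasure

/-- The vector in `ℝⁿ` that represents the spatial part of a linear form on space-time. -/
noncomputable def spatialPart (n : ℕ) : (SpaceTime n →L[ℝ] ℝ) →L[ℝ] Space n :=
  LinearMap.toContinuousLinearMap
    { toFun := fun ℓ => (InnerProductSpace.toDual ℝ (Space n)).symm
        (ℓ.comp (ContinuousLinearMap.inl ℝ (Space n) ℝ))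
      map_add' := fun ℓ ℓ' => by rw [ContinuousLinearMap.add_comp, map_add]
      map_smul' := fun c ℓ => by
        rw [ContinuousLinearMap.smul_comp, map_smulₛₗ]; simp }

theorem inner_spatialPart (ℓ : SpaceTime n →L[ℝ] ℝ) (e : Space n) :
    inner ℝ (spatialPart n ℓ) e = ℓ (e, 0) := by
  simp [spatialPart]

theorem timeDeriv_eq {η : SpaceTime n → ℝ} {z : SpaceTime n} (h : DifferentiableAt ℝ η z) :
    timeDeriv η z = fderiv ℝ η z (0, 1) := by
  have h1 : HasDerivAt (fun s : ℝ => (z.1, s)) ((0 : Space n), (1 : ℝ)) z.2 :=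
    (hasDerivAt_const _ _).prodMk (hasDerivAt_id _)
  have h2 : HasFDerivAt η (fderiv ℝ η z) ((fun s : ℝ => (z.1, s)) z.2) := h.hasFDerivAt
  exact (h2.comp_hasDerivAt z.2 h1).deriv

theorem spaceGrad_eq {η : SpaceTime n → ℝ} {z : SpaceTime n} (h : DifferentiableAt ℝ η z) :
    spaceGrad η z = spatialPart n (fderiv ℝ η z) := by
  have h1 : HasFDerivAt (fun x : Space n => (x, z.2)) (ContinuousLinearMap.inl ℝ (Space n) ℝ) z.1 :=
    (hasFDerivAt_id _).prodMk (hasFDerivAt_const _ _)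
  have h2 : HasFDerivAt η (fderiv ℝ η z) ((fun x : Space n => (x, z.2)) z.1) := h.hasFDerivAt
  have h3 := (h2.comp z.1 h1).fderiv
  unfold spaceGrad gradient
  simp only [spatialPart]
  rw [show (fun x : Space n => η (x, z.2)) = η ∘ fun x : Space n => (x, z.2) from rfl, h3]
  simp

theorem integral_fderiv_eq_zero {ψ : SpaceTime n → ℝ} (hψ : ContDiff ℝ ∞ ψ)
    (hc : HasCompactSupport ψ) (e : SpaceTime n) : ∫ z, fderiv ℝ ψ z e = 0 := by
  have hd : Differentiable ℝ ψ := hψ.differentiable (by simp)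
  have hi : Integrable (fun z => fderiv ℝ ψ z e) := by
    apply Continuous.integrable_of_hasCompactSupport
    · exact (hψ.continuous_fderiv (by simp)).clm_apply continuous_const
    · exact hc.fderiv_apply ℝ e
  have := integral_mul_fderiv_eq_neg_fderiv_mul_of_integrable (μ := (volume : Measure (SpaceTime n)))
    (f := fun _ => (1 : ℝ)) (g := ψ) (v := e) (by simp) (by simpa using hi)
    (by simpa using hψ.continuous.integrable_of_hasCompactSupport hc) (by simp)
    (fun x _ => hd x)
  simpa using this

namespace IsTestFunction

variable {Q : Set (SpaceTime n)} {η : SpaceTime n → ℝ}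

theorem differentiable (h : IsTestFunction Q η) : Differentiable ℝ η :=
  h.smooth.differentiable (by simp)

theorem timeDeriv_eq (h : IsTestFunction Q η) : timeDeriv η = fun z => fderiv ℝ η z (0, 1) :=
  funext fun z => _root_.timeDeriv_eq (h.differentiable z)

theorem spaceGrad_eq (h : IsTestFunction Q η) :
    spaceGrad η = fun z => spatialPart n (fderiv ℝ η z) :=
  funext fun z => _root_.spaceGrad_eq (h.differentiable z)

theorem continuous_timeDeriv (h : IsTestFunction Q η) : Continuous (timeDeriv η) := by
  rw [h.timeDeriv_eq]
  exact (h.smooth.continuous_fderiv (by simp)).clm_apply continuous_const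

theorem continuous_spaceGrad (h : IsTestFunction Q η) : Continuous (spaceGrad η) := by
  rw [h.spaceGrad_eq]
  exact (spatialPart n).continuous.comp (h.smooth.continuous_fderiv (by simp))

theorem fderiv_eq_zero {η : SpaceTime n → ℝ} {z : SpaceTime n} (hz : z ∉ tsupport η) :
    fderiv ℝ η z = 0 := image_eq_zero_of_notMem_tsupport
  (fun h => hz (tsupport_fderiv_subset ℝ h))

theorem timeDeriv_eq_zero (h : IsTestFunction Q η) {z : SpaceTime n} (hz : z ∉ tsupport η) :
    timeDeriv η z = 0 := by
  rw [h.timeDeriv_eq]; simp [fderiv_eq_zero hz]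

theorem spaceGrad_eq_zero (h : IsTestFunction Q η) {z : SpaceTime n} (hz : z ∉ tsupport η) :
    spaceGrad η z = 0 := by
  rw [h.spaceGrad_eq]; simp [fderiv_eq_zero hz]

theorem hasCompactSupport_timeDeriv (h : IsTestFunction Q η) : HasCompactSupport (timeDeriv η) :=
  HasCompactSupport.intro h.compact fun _ hz => h.timeDeriv_eq_zero hz

theorem hasCompactSupport_spaceGrad (h : IsTestFunction Q η) : HasCompactSupport (spaceGrad η) :=
  HasCompactSupport.intro h.compact fun _ hz => h.spaceGrad_eq_zero hz

theorem integral_timeDeriv (h : IsTestFunction Q η) : ∫ z, timeDeriv η z = 0 := by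
  rw [h.timeDeriv_eq]
  exact integral_fderiv_eq_zero h.smooth h.compact _

theorem integrable_spaceGrad (h : IsTestFunction Q η) : Integrable (spaceGrad η) :=
  h.continuous_spaceGrad.integrable_of_hasCompactSupport h.hasCompactSupport_spaceGrad

theorem integral_spaceGrad (h : IsTestFunction Q η) (e : Space n) :
    ∫ z, inner ℝ e (spaceGrad η z) = 0 := by
  rw [h.spaceGrad_eq]
  simp only [fun z => (real_inner_comm e (spatialPart n (fderiv ℝ η z))).symm, inner_spatialPart]
  exact integral_fderiv_eq_zero h.smooth h.compact _

theorem mono {Q' : Set (SpaceTime n)} (h : IsTestFunction Q η) (hQ : Q ⊆ Q') :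
    IsTestFunction Q' η := ⟨h.smooth, h.compact, h.support.trans hQ⟩

end IsTestFunction

end Calculus

/-! ### Mollification in space-time. -/

section Mollification

open ContinuousLinearMap

variable {n : ℕ} {F : Type*} [NormedAddCommGroup F] [NormedSpace ℝ F]

/-- The mollification of `f` by the normalized bump function `φ`. -/
noncomputable def mollify (φ : ContDiffBump (0 : SpaceTime n)) (f : SpaceTime n → F) :
    SpaceTime n → F :=
  convolution (φ.normed volume) f (lsmul ℝ ℝ) volume

variable (φ : ContDiffBump (0 : SpaceTime n))

theorem mollify_apply (f : SpaceTime n → F) (z : SpaceTime n) :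
    mollify φ f z = ∫ y, φ.normed volume (z - y) • f y :=
  convolution_lsmul_swap

theorem normed_bounded : ∃ C, ∀ z, ‖φ.normed (volume : Measure (SpaceTime n)) z‖ ≤ C :=
  φ.continuous_normed.bounded_above_of_compact_support φ.hasCompactSupport_normed

theorem integral_normed_sub (z : SpaceTime n) :
    ∫ y, φ.normed (volume : Measure (SpaceTime n)) (z - y) = 1 := by
  rw [integral_sub_left_eq_self (fun y => φ.normed (volume : Measure (SpaceTime n)) y) volume z]
  exact φ.integral_normed

theorem integrable_normed_sub (z : SpaceTime n) :
    Integrable fun y => φ.normed (volume : Measure (SpaceTime n)) (z - y) :=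
  φ.integrable_normed.comp_sub_left z

theorem integrable_normed_smul {f : SpaceTime n → F} (hf : Integrable f) (z : SpaceTime n) :
    Integrable fun y => φ.normed (volume : Measure (SpaceTime n)) (z - y) • f y := by
  obtain ⟨C, hC⟩ := normed_bounded φ
  refine hf.bdd_smul C ?_ ?_
  · exact (φ.continuous_normed.comp (continuous_const.sub continuous_id)).aestronglyMeasurable
  · exact Eventually.of_forall fun y => hC _

theorem integrable_mollify {f : SpaceTime n → F} (hf : Integrable f) :
    Integrable (mollify φ f) :=
  φ.integrable_normed.integrable_convolution (lsmul ℝ ℝ) hf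

theorem integral_mollify [CompleteSpace F] {f : SpaceTime n → F} (hf : Integrable f) :
    ∫ z, mollify φ f z = ∫ z, f z := by
  unfold mollify
  rw [integral_convolution _ φ.integrable_normed hf]
  simp [φ.integral_normed]

theorem contDiff_mollify {f : SpaceTime n → F} (hf : Integrable f) :
    ContDiff ℝ ∞ (mollify φ f) :=
  φ.hasCompactSupport_normed.contDiff_convolution_left _ φ.contDiff_normed hf.locallyIntegrable

theorem norm_mollify_le {f : SpaceTime n → F} {M : ℝ} (hf : Integrable f)
    (hM : ∀ᵐ z, ‖f z‖ ≤ M) (z : SpaceTime n) : ‖mollify φ f z‖ ≤ M := by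
  rw [mollify_apply]
  calc ‖∫ y, φ.normed volume (z - y) • f y‖ ≤ ∫ y, ‖φ.normed volume (z - y) • f y‖ :=
        norm_integral_le_integral_norm _
    _ ≤ ∫ y, φ.normed volume (z - y) * M := by
        apply integral_mono_ae (integrable_normed_smul φ hf z).norm
          ((integrable_normed_sub φ z).mul_const M)
        filter_upwards [hM] with y hy
        rw [norm_smul, Real.norm_of_nonneg (φ.nonneg_normed _)]
        exact mul_le_mul_of_nonneg_left hy (φ.nonneg_normed _)
    _ = M := by rw [integral_mul_const, integral_normed_sub, one_mul]

theorem norm_mollify_le_mollify_norm (f : SpaceTime n → F) (z : SpaceTime n) :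
    ‖mollify φ f z‖ ≤ mollify φ (fun y => ‖f y‖) z := by
  rw [mollify_apply, mollify_apply]
  refine (norm_integral_le_integral_norm _).trans (le_of_eq ?_)
  congr 1
  ext y
  rw [norm_smul, Real.norm_of_nonneg (φ.nonneg_normed _), smul_eq_mul]

theorem mollify_mono {f g : SpaceTime n → ℝ} (hf : Integrable f) (hg : Integrable g)
    (h : ∀ z, f z ≤ g z) (z : SpaceTime n) : mollify φ f z ≤ mollify φ g z := by
  rw [mollify_apply, mollify_apply]
  exact integral_mono (integrable_normed_smul φ hf z) (integrable_normed_smul φ hg z)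
    fun y => mul_le_mul_of_nonneg_left (h y) (φ.nonneg_normed _)

theorem mollify_nonneg {f : SpaceTime n → ℝ} (hf : ∀ z, 0 ≤ f z) (z : SpaceTime n) :
    0 ≤ mollify φ f z := by
  rw [mollify_apply]
  exact integral_nonneg fun y => mul_nonneg (φ.nonneg_normed _) (hf y)

/-- A bound for the product of two mollifications that needs no convexity. -/
theorem mollify_mul_mollify_le {a b h : SpaceTime n → ℝ} (ha : Integrable a) (hb : Integrable b)
    (hh : Integrable h) (hab : ∀ y y', a y * b y' ≤ h y + h y') (z : SpaceTime n) :
    mollify φ a z * mollify φ b z ≤ 2 * mollify φ h z := by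
  -- The hypothesis is averaged over `y'` with `y` fixed, and afterwards over `y`.
  have h1 : ∀ y, a y * mollify φ b z ≤ h y + mollify φ h z := by
    intro y
    rw [mollify_apply, mollify_apply, ← integral_const_mul]
    calc ∫ y', a y * (φ.normed volume (z - y') • b y')
        ≤ ∫ y', (φ.normed volume (z - y') * h y + φ.normed volume (z - y') • h y') := by
          apply integral_mono ((integrable_normed_smul φ hb z).const_mul _)
            (((integrable_normed_sub φ z).mul_const _).add (integrable_normed_smul φ hh z))
          intro y'
          have := mul_le_mul_of_nonneg_left (hab y y')
            (φ.nonneg_normed (μ := (volume : Measure (SpaceTime n))) (z - y'))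
          simp only [smul_eq_mul, Pi.add_apply]
          linarith
      _ = _ := by
          rw [integral_add ((integrable_normed_sub φ z).mul_const _) (integrable_normed_smul φ hh z),
            integral_mul_const, integral_normed_sub, one_mul]
  have h2 : mollify φ a z * mollify φ b z
      = ∫ y, φ.normed volume (z - y) • (a y * mollify φ b z) := by
    rw [mollify_apply φ a, ← integral_mul_const]
    congr 1; ext y; simp only [smul_eq_mul]; ring
  rw [h2]
  calc ∫ y, φ.normed volume (z - y) • (a y * mollify φ b z)
      ≤ ∫ y, (φ.normed volume (z - y) • h y + φ.normed volume (z - y) * mollify φ h z) := by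
        apply integral_mono (integrable_normed_smul φ (ha.mul_const _) z)
          ((integrable_normed_smul φ hh z).add ((integrable_normed_sub φ z).mul_const _))
        intro y
        have := mul_le_mul_of_nonneg_left (h1 y)
          (φ.nonneg_normed (μ := (volume : Measure (SpaceTime n))) (z - y))
        simp only [smul_eq_mul, Pi.add_apply]
        linarith
    _ = _ := by
        rw [integral_add (integrable_normed_smul φ hh z) ((integrable_normed_sub φ z).mul_const _),
          integral_mul_const, integral_normed_sub, ← mollify_apply]
        ring

/-- Mollification is symmetric with respect to the `L²` pairing. -/
theorem integral_inner_mollify {H : Type*} [NormedAddCommGroup H] [InnerProductSpace ℝ H]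
    [CompleteSpace H] {f ψ : SpaceTime n → H} (hf : Integrable f) (hψ : Integrable ψ) :
    ∫ y, inner ℝ (f y) (mollify φ ψ y) = ∫ z, inner ℝ (mollify φ f z) (ψ z) := by
  obtain ⟨C, hC⟩ := normed_bounded φ
  have h1 : ∀ y, inner ℝ (f y) (mollify φ ψ y)
      = ∫ z, φ.normed volume (y - z) * inner ℝ (f y) (ψ z) := by
    intro y
    rw [mollify_apply, ← integral_inner (integrable_normed_smul φ hψ y)]
    simp_rw [inner_smul_right]
  have h2 : ∀ z, inner ℝ (mollify φ f z) (ψ z)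
      = ∫ y, φ.normed volume (y - z) * inner ℝ (f y) (ψ z) := by
    intro z
    rw [mollify_apply, real_inner_comm, ← integral_inner (integrable_normed_smul φ hf z)]
    congr 1; ext y
    -- The bump function is even; this is what makes the pairing symmetric.
    rw [inner_smul_right, real_inner_comm, ← φ.normed_neg, neg_sub]
  simp_rw [h1, h2]
  apply integral_integral_swap
  have hprod : Integrable (fun p : SpaceTime n × SpaceTime n => inner ℝ (f p.1) (ψ p.2))
      ((volume : Measure (SpaceTime n)).prod volume) := by
    refine (hf.norm.mul_prod hψ.norm).mono' ?_ ?_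
    · exact (hf.aestronglyMeasurable.comp_fst).inner (hψ.aestronglyMeasurable.comp_snd)
    · exact Eventually.of_forall fun p => norm_inner_le_norm _ _
  refine hprod.bdd_mul (c := C) ?_ ?_
  · exact (φ.continuous_normed.comp (continuous_fst.sub continuous_snd)).aestronglyMeasurable
  · exact Eventually.of_forall fun p => hC _

theorem fderiv_mollify {ψ : SpaceTime n → ℝ} (hψ : ContDiff ℝ ∞ ψ) (hc : HasCompactSupport ψ)
    (z : SpaceTime n) : fderiv ℝ (mollify φ ψ) z = mollify φ (fderiv ℝ ψ) z := by
  have := hc.hasFDerivAt_convolution_right (lsmul ℝ ℝ) (f := φ.normed volume) (μ := volume)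
    φ.continuous_normed.locallyIntegrable (hψ.of_le (by norm_cast)) z
  exact this.fderiv

theorem mollify_comp_clm {F' : Type*} [NormedAddCommGroup F'] [NormedSpace ℝ F'] [CompleteSpace F]
    [CompleteSpace F'] (T : F →L[ℝ] F') {f : SpaceTime n → F} (hf : Integrable f)
    (z : SpaceTime n) : T (mollify φ f z) = mollify φ (fun y => T (f y)) z := by
  rw [mollify_apply, mollify_apply, ← T.integral_comp_comm (integrable_normed_smul φ hf z)]
  simp

theorem tsupport_mollify_subset {ψ : SpaceTime n → F} :
    tsupport (mollify φ ψ) ⊆ Metric.cthickening φ.rOut (tsupport ψ) := by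
  apply closure_minimal _ Metric.isClosed_cthickening
  intro z hz
  by_contra hcon
  apply hz
  rw [mollify_apply]
  apply integral_eq_zero_of_ae
  refine Eventually.of_forall fun y => ?_
  by_cases hy : y ∈ tsupport ψ
  · have : z - y ∉ Function.support (φ.normed (volume : Measure (SpaceTime n))) := by
      rw [φ.support_normed_eq]
      intro hb
      apply hcon
      apply Metric.mem_cthickening_of_dist_le z y _ _ hy
      rw [mem_ball_zero_iff] at hb
      rw [dist_eq_norm]; exact hb.le
    simp [Function.notMem_support.1 this]
  · simp [image_eq_zero_of_notMem_tsupport hy]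

theorem IsTestFunction.mollify {Q : Set (SpaceTime n)} {ψ : SpaceTime n → ℝ}
    (h : IsTestFunction Q ψ) {Q' : Set (SpaceTime n)}
    (hQ : Metric.cthickening φ.rOut (tsupport ψ) ⊆ Q') : IsTestFunction Q' (mollify φ ψ) where
  smooth := contDiff_mollify φ (h.smooth.continuous.integrable_of_hasCompactSupport h.compact)
  compact := φ.hasCompactSupport_normed.convolution _ h.compact
  support := (tsupport_mollify_subset φ).trans hQ

theorem IsTestFunction.timeDeriv_mollify {Q : Set (SpaceTime n)} {ψ : SpaceTime n → ℝ}
    (h : IsTestFunction Q ψ) (z : SpaceTime n) :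
    timeDeriv (_root_.mollify φ ψ) z = _root_.mollify φ (timeDeriv ψ) z := by
  have hi : Integrable (fderiv ℝ ψ) :=
    (h.smooth.continuous_fderiv (by simp)).integrable_of_hasCompactSupport (h.compact.fderiv ℝ)
  rw [_root_.timeDeriv_eq ((contDiff_mollify φ
      (h.smooth.continuous.integrable_of_hasCompactSupport h.compact)).differentiable (by simp) z),
    fderiv_mollify φ h.smooth h.compact, h.timeDeriv_eq]
  exact mollify_comp_clm φ (ContinuousLinearMap.apply ℝ ℝ ((0 : Space n), (1 : ℝ))) hi z

theorem IsTestFunction.spaceGrad_mollify {Q : Set (SpaceTime n)} {ψ : SpaceTime n → ℝ}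
    (h : IsTestFunction Q ψ) (z : SpaceTime n) :
    spaceGrad (_root_.mollify φ ψ) z = _root_.mollify φ (spaceGrad ψ) z := by
  have hi : Integrable (fderiv ℝ ψ) :=
    (h.smooth.continuous_fderiv (by simp)).integrable_of_hasCompactSupport (h.compact.fderiv ℝ)
  rw [_root_.spaceGrad_eq ((contDiff_mollify φ
      (h.smooth.continuous.integrable_of_hasCompactSupport h.compact)).differentiable (by simp) z),
    fderiv_mollify φ h.smooth h.compact, h.spaceGrad_eq]
  exact mollify_comp_clm φ (spatialPart n) hi z

theorem fderiv_mollify_left {f : SpaceTime n → ℝ} (hf : Integrable f) (z : SpaceTime n) :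
    fderiv ℝ (mollify φ f) z = ∫ y, f y • fderiv ℝ (φ.normed volume) (z - y) := by
  have := (φ.hasCompactSupport_normed (μ := volume)).hasFDerivAt_convolution_left (lsmul ℝ ℝ)
    (μ := (volume : Measure (SpaceTime n)))
    (φ.contDiff_normed (n := 1)) hf.locallyIntegrable z
  refine this.fderiv.trans ?_
  rw [convolution_eq_swap]
  congr 1
  ext1 y
  refine ContinuousLinearMap.ext fun e => ?_
  simp [mul_comm]

/-- When the ball of radius `φ.rOut` about `z` lies in `K`, the kernel `y ↦ φ(z - y)` is a test
function in `Q`, and the definition of the weak gradient applies to it. The reflection `y ↦ z - y`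
supplies a sign that cancels the one from integration by parts. -/
theorem IsWeakSpaceGrad.spatialPart_fderiv_mollify {Q K : Set (SpaceTime n)}
    {u : SpaceTime n → ℝ} {Du : SpaceTime n → Space n} (h : IsWeakSpaceGrad Q u Du)
    (hK : IsCompact K) (hKQ : K ⊆ Q) (hQ : MeasurableSet Q) {z : SpaceTime n}
    (hz : Metric.closedBall z φ.rOut ⊆ K) :
    spatialPart n (fderiv ℝ (_root_.mollify φ (K.indicator u)) z)
      = _root_.mollify φ (K.indicator Du) z := by
  have hu : Integrable (K.indicator u) :=
    (integrable_indicator_iff hK.measurableSet).2 (h.locInt.integrableOn_compact_subset hKQ hK)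
  have hk1 : ContDiff ℝ ∞ (φ.normed (volume : Measure (SpaceTime n))) := φ.contDiff_normed
  have hsub : ∀ y, y ∉ K → z - y ∉ tsupport (φ.normed (volume : Measure (SpaceTime n))) := by
    intro y hy hcon
    rw [φ.tsupport_normed_eq, mem_closedBall_zero_iff] at hcon
    exact hy (hz (by rwa [Metric.mem_closedBall, dist_comm, dist_eq_norm]))
  have htest : IsTestFunction Q fun y => φ.normed volume (z - y) := by
    refine ⟨hk1.comp (contDiff_const.sub contDiff_id), ?_, ?_⟩
    · exact φ.hasCompactSupport_normed.comp_homeomorph (Homeomorph.subLeft z)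
    · refine Subset.trans (closure_minimal ?_ hK.isClosed) hKQ
      intro y hy
      by_contra hcon
      exact hy (image_eq_zero_of_notMem_tsupport (hsub y hcon))
  have hgrad : ∀ y, spaceGrad (fun y => φ.normed (volume : Measure (SpaceTime n)) (z - y)) y
      = -spatialPart n (fderiv ℝ (φ.normed volume) (z - y)) := by
    intro y
    rw [htest.spaceGrad_eq]
    have h1 : HasFDerivAt (fun y : SpaceTime n => z - y)
        (-(ContinuousLinearMap.id ℝ (SpaceTime n))) y := (hasFDerivAt_id y).const_sub z
    have h2 : HasFDerivAt (φ.normed (volume : Measure (SpaceTime n)))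
        (fderiv ℝ (φ.normed volume) (z - y)) (z - y) :=
      (hk1.differentiable (by simp) _).hasFDerivAt
    have h3 := (h2.comp y h1).fderiv
    simp only [Function.comp_def] at h3
    simp only [h3]
    rw [← map_neg]
    congr 1
    refine ContinuousLinearMap.ext fun e => ?_
    simp
  have hint : Integrable fun y => K.indicator u y •
      fderiv ℝ (φ.normed (volume : Measure (SpaceTime n))) (z - y) := by
    obtain ⟨C, hC⟩ := (hk1.continuous_fderiv (by simp)).bounded_above_of_compact_support
      (φ.hasCompactSupport_normed.fderiv ℝ)
    refine hu.smul_bdd C ?_ ?_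
    · exact ((hk1.continuous_fderiv (by simp)).comp
        (continuous_const.sub continuous_id)).aestronglyMeasurable
    · exact Eventually.of_forall fun y => hC _
  rw [fderiv_mollify_left φ hu, ← (spatialPart n).integral_comp_comm hint, mollify_apply]
  have hby := h.byParts _ htest
  have e1 : ∫ y, spatialPart n (K.indicator u y • fderiv ℝ (φ.normed volume) (z - y))
      = -∫ y in Q, u y • spaceGrad (fun y => φ.normed (volume : Measure (SpaceTime n)) (z - y)) y := by
    rw [← integral_neg, ← integral_indicator hQ]
    congr 1
    ext1 y
    by_cases hy : y ∈ K
    · rw [indicator_of_mem hy, indicator_of_mem (hKQ hy), hgrad, map_smul, smul_neg, neg_neg]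
    · rw [indicator_of_notMem hy, zero_smul, map_zero]
      by_cases hyQ : y ∈ Q
      · rw [indicator_of_mem hyQ, hgrad, IsTestFunction.fderiv_eq_zero (hsub y hy)]; simp
      · rw [indicator_of_notMem hyQ]
  have e2 : ∫ y, φ.normed volume (z - y) • K.indicator Du y
      = ∫ y in Q, φ.normed volume (z - y) • Du y := by
    rw [← integral_indicator hQ]
    congr 1
    ext1 y
    by_cases hy : y ∈ K
    · rw [indicator_of_mem hy, indicator_of_mem (hKQ hy)]
    · rw [indicator_of_notMem hy, smul_zero]
      by_cases hyQ : y ∈ Q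
      · rw [indicator_of_mem hyQ, image_eq_zero_of_notMem_tsupport (hsub y hy), zero_smul]
      · rw [indicator_of_notMem hyQ]
  rw [e1, hby, neg_neg, e2]

end Mollification

/-! ### The comparison inequality for two supersolutions. -/

section Comparison

variable {n : ℕ}

/-- `∂ₜv - div F ≥ 0` weakly in `Q`. -/
def IsWeakSuperFlux (Q : Set (SpaceTime n)) (v : SpaceTime n → ℝ) (F : SpaceTime n → Space n) :
    Prop :=
  ∀ η : SpaceTime n → ℝ, IsTestFunction Q η → (∀ z, 0 ≤ η z) →
    0 ≤ - (∫ z in Q, v z * timeDeriv η z) + ∫ z in Q, inner ℝ (F z) (spaceGrad η z)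

theorem setIntegral_eq_integral_indicator {F : Type*} [NormedAddCommGroup F] [NormedSpace ℝ F]
    {Q K : Set (SpaceTime n)} (hQ : MeasurableSet Q) (hKQ : K ⊆ Q) {f g : SpaceTime n → F}
    (hK : ∀ z ∈ K, f z = g z) (hf : ∀ z ∉ K, f z = 0) (hg : ∀ z ∉ K, g z = 0) :
    ∫ z in Q, f z = ∫ z, g z := by
  rw [← integral_indicator hQ]
  congr 1
  ext1 z
  by_cases hz : z ∈ K
  · rw [indicator_of_mem (hKQ hz), hK z hz]
  · rw [hg z hz]
    exact indicator_apply_eq_zero.2 fun _ => hf z hz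

/-- By symmetry the mollifier moves from `v` and `F` onto `ψ`, and the mollified `ψ` is an
admissible test function supported in `K`. Cutting off with `K.indicator` makes the data globally
integrable without affecting the pairing. -/
theorem IsWeakSuperFlux.mollify {Q K : Set (SpaceTime n)} {v : SpaceTime n → ℝ}
    {F : SpaceTime n → Space n} (h : IsWeakSuperFlux Q v F) (hv : LocallyIntegrableOn v Q)
    (hF : LocallyIntegrableOn F Q) (hK : IsCompact K) (hKQ : K ⊆ Q) (hQ : MeasurableSet Q)
    (φ : ContDiffBump (0 : SpaceTime n)) {ψ : SpaceTime n → ℝ} (hψ : IsTestFunction Q ψ)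
    (hψ0 : ∀ z, 0 ≤ ψ z) (hψK : Metric.cthickening φ.rOut (tsupport ψ) ⊆ K) :
    0 ≤ - (∫ z, _root_.mollify φ (K.indicator v) z * timeDeriv ψ z)
      + ∫ z, inner ℝ (_root_.mollify φ (K.indicator F) z) (spaceGrad ψ z) := by
  have hvi : Integrable (K.indicator v) :=
    (integrable_indicator_iff hK.measurableSet).2 (hv.integrableOn_compact_subset hKQ hK)
  have hFi : Integrable (K.indicator F) :=
    (integrable_indicator_iff hK.measurableSet).2 (hF.integrableOn_compact_subset hKQ hK)
  have hηK : IsTestFunction K (_root_.mollify φ ψ) := hψ.mollify φ hψK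
  have key := h _ (hηK.mono hKQ) (mollify_nonneg φ hψ0)
  have e1 : ∫ z in Q, v z * timeDeriv (_root_.mollify φ ψ) z
      = ∫ z, _root_.mollify φ (K.indicator v) z * timeDeriv ψ z := by
    have hi : Integrable (timeDeriv ψ) :=
      hψ.continuous_timeDeriv.integrable_of_hasCompactSupport hψ.hasCompactSupport_timeDeriv
    have := integral_inner_mollify φ hvi hi
    simp only [RCLike.inner_apply, conj_trivial] at this
    rw [setIntegral_eq_integral_indicator hQ hKQ
      (g := fun z => _root_.mollify φ (timeDeriv ψ) z * K.indicator v z), this]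
    · congr 1; ext z; ring
    · intro z hz
      rw [hψ.timeDeriv_mollify, indicator_of_mem hz, mul_comm]
    · intro z hz
      rw [hηK.timeDeriv_eq_zero (fun hc => hz (hηK.support hc)), mul_zero]
    · intro z hz
      rw [indicator_of_notMem hz, mul_zero]
  have e2 : ∫ z in Q, inner ℝ (F z) (spaceGrad (_root_.mollify φ ψ) z)
      = ∫ z, inner ℝ (_root_.mollify φ (K.indicator F) z) (spaceGrad ψ z) := by
    rw [← integral_inner_mollify φ hFi hψ.integrable_spaceGrad]
    apply setIntegral_eq_integral_indicator hQ hKQ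
    · intro z hz
      rw [hψ.spaceGrad_mollify, indicator_of_mem hz]
    · intro z hz
      rw [hηK.spaceGrad_eq_zero (fun hc => hz (hηK.support hc)), inner_zero_right]
    · intro z hz
      rw [indicator_of_notMem hz, inner_zero_left]
  rwa [e1, e2] at key

/-- The integrand obtained by testing the inequalities for `a` and `b` with
`(δ - W'(a - b)) θ` and `(δ + W'(a - b)) θ` and adding the results. -/
noncomputable def comparisonIntegrand (δ : ℝ) (W S S' : ℝ → ℝ) (θ : SpaceTime n → ℝ)
    (z : SpaceTime n) (a b : ℝ) (Da Db Fa Fb : Space n) : ℝ :=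
  (W (a - b) - δ * (a + b)) * timeDeriv θ z + δ * inner ℝ (Fa + Fb) (spaceGrad θ z)
    - S (a - b) * inner ℝ (Fa - Fb) (spaceGrad θ z)
    - S' (a - b) * θ z * inner ℝ (Fa - Fb) (Da - Db)

theorem comparisonIntegrand_eq_zero {Q : Set (SpaceTime n)} {θ : SpaceTime n → ℝ}
    (hθ : IsTestFunction Q θ) {z : SpaceTime n} (hz : z ∉ tsupport θ) (δ : ℝ) (W S S' : ℝ → ℝ)
    (a b : ℝ) (Da Db Fa Fb : Space n) :
    comparisonIntegrand δ W S S' θ z a b Da Db Fa Fb = 0 := by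
  simp [comparisonIntegrand, hθ.timeDeriv_eq_zero hz, hθ.spaceGrad_eq_zero hz,
    image_eq_zero_of_notMem_tsupport hz]

/-- After mollification everything is smooth and the products of test functions are legitimate.
Mollification preserves the bound `M`, so `|S(w)| ≤ δ` for `w = a - b` and both test functions are
nonnegative. -/
theorem integral_comparisonIntegrand_mollify_nonneg {Q K : Set (SpaceTime n)}
    {v₁ v₂ : SpaceTime n → ℝ} {D₁ D₂ F₁ F₂ : SpaceTime n → Space n}
    (h₁ : IsWeakSuperFlux Q v₁ F₁) (h₂ : IsWeakSuperFlux Q v₂ F₂)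
    (hD₁ : IsWeakSpaceGrad Q v₁ D₁) (hD₂ : IsWeakSpaceGrad Q v₂ D₂)
    (hF₁ : LocallyIntegrableOn F₁ Q) (hF₂ : LocallyIntegrableOn F₂ Q)
    (hK : IsCompact K) (hKQ : K ⊆ Q) (hQ : MeasurableSet Q)
    {M δ : ℝ} (hM₁ : ∀ᵐ z, |K.indicator v₁ z| ≤ M) (hM₂ : ∀ᵐ z, |K.indicator v₂ z| ≤ M)
    {W S S' : ℝ → ℝ} (hW : ContDiff ℝ ∞ W) (hS : ContDiff ℝ ∞ S)
    (hWS : ∀ x, HasDerivAt W (S x) x) (hSS' : ∀ x, HasDerivAt S (S' x) x)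
    (hSδ : ∀ x, |x| ≤ 2 * M → |S x| ≤ δ)
    {θ : SpaceTime n → ℝ} (hθ : IsTestFunction Q θ) (hθ0 : ∀ z, 0 ≤ θ z)
    (φ : ContDiffBump (0 : SpaceTime n)) (hθK : Metric.cthickening φ.rOut (tsupport θ) ⊆ K) :
    0 ≤ ∫ z, comparisonIntegrand δ W S S' θ z (mollify φ (K.indicator v₁) z)
      (mollify φ (K.indicator v₂) z) (mollify φ (K.indicator D₁) z)
      (mollify φ (K.indicator D₂) z) (mollify φ (K.indicator F₁) z)
      (mollify φ (K.indicator F₂) z) := by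
  have hind : ∀ {E : Type} [NormedAddCommGroup E] {f : SpaceTime n → E},
      LocallyIntegrableOn f Q → Integrable (K.indicator f) := fun hf =>
    (integrable_indicator_iff hK.measurableSet).2 (hf.integrableOn_compact_subset hKQ hK)
  set a := mollify φ (K.indicator v₁) with ha
  set b := mollify φ (K.indicator v₂) with hb
  set Fa := mollify φ (K.indicator F₁) with hFa
  set Fb := mollify φ (K.indicator F₂) with hFb
  have has : ContDiff ℝ ∞ a := contDiff_mollify φ (hind hD₁.locInt)
  have hbs : ContDiff ℝ ∞ b := contDiff_mollify φ (hind hD₂.locInt)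
  have hFac : Continuous Fa := (contDiff_mollify φ (hind hF₁)).continuous
  have hFbc : Continuous Fb := (contDiff_mollify φ (hind hF₂)).continuous
  set w : SpaceTime n → ℝ := fun z => a z - b z with hw
  have hws : ContDiff ℝ ∞ w := has.sub hbs
  have hwb : ∀ z, |S (w z)| ≤ δ := by
    intro z
    apply hSδ
    have h1 : |a z| ≤ M := norm_mollify_le φ (hind hD₁.locInt) hM₁ z
    have h2 : |b z| ≤ M := norm_mollify_le φ (hind hD₂.locInt) hM₂ z
    calc |w z| ≤ |a z| + |b z| := abs_sub _ _
      _ ≤ 2 * M := by linarith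
  have hmulTest : ∀ {p : SpaceTime n → ℝ}, ContDiff ℝ ∞ p →
      IsTestFunction Q (fun z => p z * θ z) := fun hp =>
    ⟨hp.mul hθ.smooth, hθ.compact.mul_left, (tsupport_mul_subset_right).trans hθ.support⟩
  have hmulThick : ∀ {p : SpaceTime n → ℝ},
      Metric.cthickening φ.rOut (tsupport fun z => p z * θ z) ⊆ K := fun {p} =>
    (Metric.cthickening_subset_of_subset _ tsupport_mul_subset_right).trans hθK
  have hSw : ContDiff ℝ ∞ fun z => S (w z) := hS.comp hws
  have hWw : ContDiff ℝ ∞ fun z => W (w z) := hW.comp hws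
  have t₁ : IsTestFunction Q fun z => (δ - S (w z)) * θ z := hmulTest (contDiff_const.sub hSw)
  have t₂ : IsTestFunction Q fun z => (δ + S (w z)) * θ z := hmulTest (contDiff_const.add hSw)
  -- Since `W' = S`, `w ∂ₜ(S(w) θ)` equals `W(w) ∂ₜθ` plus the time derivative of this function,
  -- which integrates to zero.
  have t₃ : IsTestFunction Q fun z => (w z * S (w z) - W (w z)) * θ z :=
    hmulTest ((hws.mul hSw).sub hWw)
  have i₁ := h₁.mollify hD₁.locInt hF₁ hK hKQ hQ φ t₁
    (fun z => mul_nonneg (by linarith [(abs_le.1 (hwb z)).2]) (hθ0 z)) hmulThick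
  have i₂ := h₂.mollify hD₂.locInt hF₂ hK hKQ hQ φ t₂
    (fun z => mul_nonneg (by linarith [(abs_le.1 (hwb z)).1]) (hθ0 z)) hmulThick
  have i₃ := t₃.integral_timeDeriv
  rw [← ha, ← hFa] at i₁
  rw [← hb, ← hFb] at i₂
  have hSwd : ∀ z, HasFDerivAt (fun z => S (w z)) (S' (w z) • fderiv ℝ w z) z := fun z =>
    (hSS' (w z)).comp_hasFDerivAt z (hws.differentiable (by simp) z).hasFDerivAt
  have hWwd : ∀ z, HasFDerivAt (fun z => W (w z)) (S (w z) • fderiv ℝ w z) z := fun z =>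
    (hWS (w z)).comp_hasFDerivAt z (hws.differentiable (by simp) z).hasFDerivAt
  have hwd : ∀ z, HasFDerivAt w (fderiv ℝ w z) z := fun z =>
    (hws.differentiable (by simp) z).hasFDerivAt
  have hθd : ∀ z, HasFDerivAt θ (fderiv ℝ θ z) z := fun z => (hθ.differentiable z).hasFDerivAt
  have d₁ : ∀ z, fderiv ℝ (fun z => (δ - S (w z)) * θ z) z
      = (δ - S (w z)) • fderiv ℝ θ z - (θ z * S' (w z)) • fderiv ℝ w z := by
    intro z
    refine (((hasFDerivAt_const δ z).sub (hSwd z)).mul (hθd z)).fderiv.trans ?_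
    simp only [Pi.sub_apply]
    module
  have d₂ : ∀ z, fderiv ℝ (fun z => (δ + S (w z)) * θ z) z
      = (δ + S (w z)) • fderiv ℝ θ z + (θ z * S' (w z)) • fderiv ℝ w z := by
    intro z
    refine (((hasFDerivAt_const δ z).add (hSwd z)).mul (hθd z)).fderiv.trans ?_
    simp only [Pi.add_apply]
    module
  have d₃ : ∀ z, fderiv ℝ (fun z => (w z * S (w z) - W (w z)) * θ z) z
      = (w z * S (w z) - W (w z)) • fderiv ℝ θ z + (θ z * (w z * S' (w z))) • fderiv ℝ w z := by
    intro z
    refine ((((hwd z).mul (hSwd z)).sub (hWwd z)).mul (hθd z)).fderiv.trans ?_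
    simp only [Pi.sub_apply, Pi.mul_apply]
    module
  have hwD : ∀ z ∈ tsupport θ, spatialPart n (fderiv ℝ w z)
      = mollify φ (K.indicator D₁) z - mollify φ (K.indicator D₂) z := by
    intro z hz
    have hzK : Metric.closedBall z φ.rOut ⊆ K :=
      (Metric.closedBall_subset_cthickening hz _).trans hθK
    have : fderiv ℝ w z = fderiv ℝ a z - fderiv ℝ b z :=
      fderiv_sub (has.differentiable (by simp) z) (hbs.differentiable (by simp) z)
    rw [this, map_sub, hD₁.spatialPart_fderiv_mollify φ hK hKQ hQ hzK,
      hD₂.spatialPart_fderiv_mollify φ hK hKQ hQ hzK]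
  have c₁ : Integrable fun z => a z * timeDeriv (fun z => (δ - S (w z)) * θ z) z :=
    (has.continuous.mul t₁.continuous_timeDeriv).integrable_of_hasCompactSupport
      t₁.hasCompactSupport_timeDeriv.mul_left
  have c₂ : Integrable fun z => b z * timeDeriv (fun z => (δ + S (w z)) * θ z) z :=
    (hbs.continuous.mul t₂.continuous_timeDeriv).integrable_of_hasCompactSupport
      t₂.hasCompactSupport_timeDeriv.mul_left
  have c₃ : Integrable fun z => timeDeriv (fun z => (w z * S (w z) - W (w z)) * θ z) z :=
    t₃.continuous_timeDeriv.integrable_of_hasCompactSupport t₃.hasCompactSupport_timeDeriv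
  have c₄ : Integrable fun z => inner ℝ (Fa z) (spaceGrad (fun z => (δ - S (w z)) * θ z) z) :=
    (hFac.inner t₁.continuous_spaceGrad).integrable_of_hasCompactSupport
      (t₁.hasCompactSupport_spaceGrad.mono fun z hz hc => hz (by simp [hc]))
  have c₅ : Integrable fun z => inner ℝ (Fb z) (spaceGrad (fun z => (δ + S (w z)) * θ z) z) :=
    (hFbc.inner t₂.continuous_spaceGrad).integrable_of_hasCompactSupport
      (t₂.hasCompactSupport_spaceGrad.mono fun z hz hc => hz (by simp [hc]))
  have hsum : ∫ z, comparisonIntegrand δ W S S' θ z (a z) (b z) (mollify φ (K.indicator D₁) z)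
      (mollify φ (K.indicator D₂) z) (Fa z) (Fb z)
      = ∫ z, ((inner ℝ (Fa z) (spaceGrad (fun z => (δ - S (w z)) * θ z) z)
          - a z * timeDeriv (fun z => (δ - S (w z)) * θ z) z)
        + (inner ℝ (Fb z) (spaceGrad (fun z => (δ + S (w z)) * θ z) z)
          - b z * timeDeriv (fun z => (δ + S (w z)) * θ z) z)
        - timeDeriv (fun z => (w z * S (w z) - W (w z)) * θ z) z) := by
    congr 1
    ext1 z
    rw [t₁.spaceGrad_eq, t₂.spaceGrad_eq, t₁.timeDeriv_eq, t₂.timeDeriv_eq, t₃.timeDeriv_eq]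
    simp only [d₁, d₂, d₃]
    by_cases hz : z ∈ tsupport θ
    · have e := hwD z hz
      simp only [comparisonIntegrand, hθ.timeDeriv_eq, hθ.spaceGrad_eq, ← e, map_add, map_sub,
        map_smul, inner_add_right, inner_sub_right, inner_add_left, inner_sub_left,
        inner_smul_right, _root_.add_apply, _root_.sub_apply,
        _root_.smul_apply, smul_eq_mul]
      change (W (w z) - _) * _ + _ - S (w z) * _ - S' (w z) * _ * _ = _
      simp only [hw]
      ring
    · rw [comparisonIntegrand_eq_zero hθ hz, IsTestFunction.fderiv_eq_zero hz,
        image_eq_zero_of_notMem_tsupport hz]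
      simp
  have hlin : ∀ {f₁ f₂ f₃ f₄ f₅ : SpaceTime n → ℝ}, Integrable f₁ → Integrable f₂ →
      Integrable f₃ → Integrable f₄ → Integrable f₅ →
      ∫ z, (f₁ z - f₂ z + (f₃ z - f₄ z) - f₅ z)
        = (∫ z, f₁ z) - (∫ z, f₂ z) + ((∫ z, f₃ z) - ∫ z, f₄ z) - ∫ z, f₅ z := by
    intro f₁ f₂ f₃ f₄ f₅ k₁ k₂ k₃ k₄ k₅
    have k₁₂ : Integrable fun z => f₁ z - f₂ z := k₁.sub k₂
    have k₃₄ : Integrable fun z => f₃ z - f₄ z := k₃.sub k₄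
    have k₁₄ : Integrable fun z => f₁ z - f₂ z + (f₃ z - f₄ z) := k₁₂.add k₃₄
    rw [integral_sub k₁₄ k₅, integral_add k₁₂ k₃₄, integral_sub k₁ k₂, integral_sub k₃ k₄]
  rw [hsum, hlin c₄ c₁ c₅ c₂ c₃, i₃]
  linarith

/-- A sequence of bump functions at the origin that shrinks to a point. -/
noncomputable def shrinkingBump (n : ℕ) (r : ℝ) (hr : 0 < r) (m : ℕ) :
    ContDiffBump (0 : SpaceTime n) where
  rIn := r / (m + 1) / 2
  rOut := r / (m + 1)
  rIn_pos := by positivity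
  rIn_lt_rOut := half_lt_self (by positivity)

/-- Lebesgue differentiation, which needs `rOut ≤ K * rIn` with a fixed `K`; here the ratio is
always `2`. -/
theorem ae_tendsto_mollify_shrinkingBump {F : Type*} [NormedAddCommGroup F] [NormedSpace ℝ F]
    [CompleteSpace F] {r : ℝ} (hr : 0 < r) {f : SpaceTime n → F} (hf : Integrable f) :
    ∀ᵐ z, Tendsto (fun m => mollify (shrinkingBump n r hr m) f z) atTop (𝓝 (f z)) := by
  refine ContDiffBump.ae_convolution_tendsto_right_of_locallyIntegrable (K := 2) ?_ ?_
    hf.locallyIntegrable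
  · exact tendsto_const_div_atTop_nhds_zero_nat r |>.comp (tendsto_add_atTop_nat 1) |>.congr
      fun m => by simp [shrinkingBump]
  · refine Eventually.of_forall fun m => le_of_eq ?_
    simp only [shrinkingBump]; ring

theorem abs_comparisonIntegrand_le {δ c N s₀ w₀ : ℝ} {W S S' : ℝ → ℝ} {θ : SpaceTime n → ℝ}
    {z : SpaceTime n} {a b : ℝ} {Da Db Fa Fb : Space n} (hδ : |S (a - b)| ≤ δ)
    (hw : |W (a - b) - δ * (a + b)| ≤ w₀) (hs : |S' (a - b)| ≤ s₀) (ht : |timeDeriv θ z| ≤ c)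
    (hg : ‖spaceGrad θ z‖ ≤ c) (hθ : |θ z| ≤ c)
    (hN : (‖Fa‖ + ‖Fb‖) * (‖Da‖ + ‖Db‖) ≤ N) :
    |comparisonIntegrand δ W S S' θ z a b Da Db Fa Fb|
      ≤ w₀ * c + 2 * δ * c * (‖Fa‖ + ‖Fb‖) + s₀ * c * N := by
  have hδ0 : 0 ≤ δ := (abs_nonneg _).trans hδ
  have hw0 : 0 ≤ w₀ := (abs_nonneg _).trans hw
  have hs0 : 0 ≤ s₀ := (abs_nonneg _).trans hs
  have hc0 : 0 ≤ c := (abs_nonneg _).trans ht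
  have k1 : |(W (a - b) - δ * (a + b)) * timeDeriv θ z| ≤ w₀ * c := by
    rw [abs_mul]; gcongr
  have k2 : |δ * inner ℝ (Fa + Fb) (spaceGrad θ z)| ≤ δ * ((‖Fa‖ + ‖Fb‖) * c) := by
    rw [abs_mul, abs_of_nonneg hδ0]
    gcongr
    exact (abs_real_inner_le_norm _ _).trans (by gcongr; exact norm_add_le _ _)
  have k3 : |S (a - b) * inner ℝ (Fa - Fb) (spaceGrad θ z)| ≤ δ * ((‖Fa‖ + ‖Fb‖) * c) := by
    rw [abs_mul]
    gcongr
    exact (abs_real_inner_le_norm _ _).trans (by gcongr; exact norm_sub_le _ _)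
  have k4 : |S' (a - b) * θ z * inner ℝ (Fa - Fb) (Da - Db)| ≤ s₀ * c * N := by
    rw [abs_mul, abs_mul]
    gcongr
    refine ((abs_real_inner_le_norm _ _).trans ?_).trans hN
    gcongr <;> exact norm_sub_le _ _
  unfold comparisonIntegrand
  rw [abs_le] at *
  constructor <;> nlinarith [k1.1, k1.2, k2.1, k2.2, k3.1, k3.2, k4.1, k4.2]

/-- The mollification radius tends to zero. The critical term is the product of a mollified flux and
a mollified gradient; `hFD`, a bound for products taken at two different points, dominates it by a
multiple of the mollified `h`. These majorants vary with the radius, but they converge almost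
everywhere and have constant integral, which suffices. -/
theorem integral_comparisonIntegrand_nonneg {Q : Set (SpaceTime n)}
    {v₁ v₂ : SpaceTime n → ℝ} {D₁ D₂ F₁ F₂ : SpaceTime n → Space n}
    (h₁ : IsWeakSuperFlux Q v₁ F₁) (h₂ : IsWeakSuperFlux Q v₂ F₂)
    (hD₁ : IsWeakSpaceGrad Q v₁ D₁) (hD₂ : IsWeakSpaceGrad Q v₂ D₂)
    (hF₁ : LocallyIntegrableOn F₁ Q) (hF₂ : LocallyIntegrableOn F₂ Q) (hQ : IsOpen Q)
    {h : SpaceTime n → ℝ} (hh : LocallyIntegrableOn h Q) (hh0 : ∀ z, 0 ≤ h z)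
    (hFD : ∀ z z', (‖F₁ z‖ + ‖F₂ z‖) * (‖D₁ z'‖ + ‖D₂ z'‖) ≤ h z + h z')
    {M δ : ℝ} (hM₀ : 0 ≤ M) (hM₁ : ∀ᵐ z ∂volume.restrict Q, |v₁ z| ≤ M)
    (hM₂ : ∀ᵐ z ∂volume.restrict Q, |v₂ z| ≤ M)
    {W S S' : ℝ → ℝ} (hW : ContDiff ℝ ∞ W) (hS : ContDiff ℝ ∞ S) (hS' : Continuous S')
    (hWS : ∀ x, HasDerivAt W (S x) x) (hSS' : ∀ x, HasDerivAt S (S' x) x)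
    (hSδ : ∀ x, |x| ≤ 2 * M → |S x| ≤ δ)
    {θ : SpaceTime n → ℝ} (hθ : IsTestFunction Q θ) (hθ0 : ∀ z, 0 ≤ θ z) :
    Integrable (fun z =>
        comparisonIntegrand δ W S S' θ z (v₁ z) (v₂ z) (D₁ z) (D₂ z) (F₁ z) (F₂ z)) ∧
      0 ≤ ∫ z, comparisonIntegrand δ W S S' θ z (v₁ z) (v₂ z) (D₁ z) (D₂ z) (F₁ z) (F₂ z) := by
  -- All mollification radii are at most `r`, so every support stays inside the compact set `K ⊆ Q`.
  obtain ⟨r, hr, hrQ⟩ := hθ.compact.isCompact.exists_cthickening_subset_open hQ hθ.support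
  set K := Metric.cthickening r (tsupport θ) with hKdef
  have hK : IsCompact K := hθ.compact.isCompact.cthickening
  have hθK : tsupport θ ⊆ K := Metric.self_subset_cthickening _
  have hind : ∀ {E : Type} [NormedAddCommGroup E] {f : SpaceTime n → E},
      LocallyIntegrableOn f Q → Integrable (K.indicator f) := fun hf =>
    (integrable_indicator_iff hK.measurableSet).2 (hf.integrableOn_compact_subset hrQ hK)
  have hindM : ∀ {v : SpaceTime n → ℝ}, (∀ᵐ z ∂volume.restrict Q, |v z| ≤ M) →
      ∀ᵐ z, |K.indicator v z| ≤ M := by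
    intro v hv
    rw [ae_restrict_iff' hQ.measurableSet] at hv
    filter_upwards [hv] with z hz
    by_cases hzK : z ∈ K
    · rw [indicator_of_mem hzK]; exact hz (hrQ hzK)
    · rw [indicator_of_notMem hzK]; simpa using hM₀
  have hfg : (fun z => comparisonIntegrand δ W S S' θ z (v₁ z) (v₂ z) (D₁ z) (D₂ z) (F₁ z) (F₂ z))
      = fun z => comparisonIntegrand δ W S S' θ z (K.indicator v₁ z) (K.indicator v₂ z)
        (K.indicator D₁ z) (K.indicator D₂ z) (K.indicator F₁ z) (K.indicator F₂ z) := by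
    ext1 z
    by_cases hz : z ∈ K
    · simp only [indicator_of_mem hz]
    · rw [comparisonIntegrand_eq_zero hθ (fun hc => hz (hθK hc)),
        comparisonIntegrand_eq_zero hθ (fun hc => hz (hθK hc))]
  rw [hfg]
  set φ := shrinkingBump n r hr
  have hφr : ∀ m, (φ m).rOut ≤ r := fun m => by
    change r / (m + 1) ≤ r
    exact div_le_self hr.le (by linarith [Nat.cast_nonneg (α := ℝ) m])
  have hiv₁ := hind hD₁.locInt
  have hiv₂ := hind hD₂.locInt
  have hiD₁ := hind hD₁.locInt_grad
  have hiD₂ := hind hD₂.locInt_grad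
  have hiF₁ := hind hF₁
  have hiF₂ := hind hF₂
  have hih := hind hh
  set NF : SpaceTime n → ℝ := fun z => ‖K.indicator F₁ z‖ + ‖K.indicator F₂ z‖ with hNF
  set ND : SpaceTime n → ℝ := fun z => ‖K.indicator D₁ z‖ + ‖K.indicator D₂ z‖ with hND
  have hiNF : Integrable NF := hiF₁.norm.add hiF₂.norm
  have hiND : Integrable ND := hiD₁.norm.add hiD₂.norm
  have hNN : ∀ y y', NF y * ND y' ≤ K.indicator h y + K.indicator h y' := by
    intro y y'
    have n1 := indicator_nonneg (s := K) (fun z _ => hh0 z) y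
    have n2 := indicator_nonneg (s := K) (fun z _ => hh0 z) y'
    by_cases hy : y ∈ K
    · by_cases hy' : y' ∈ K
      · simp only [hNF, hND, indicator_of_mem hy, indicator_of_mem hy']
        exact hFD y y'
      · simp only [hND, indicator_of_notMem hy', norm_zero, add_zero, mul_zero]
        simpa using n1
    · simp only [hNF, indicator_of_notMem hy, norm_zero, add_zero, zero_mul]
      simpa using n2
  obtain ⟨c₁, hc₁⟩ := hθ.continuous_timeDeriv.bounded_above_of_compact_support
    hθ.hasCompactSupport_timeDeriv
  obtain ⟨c₂, hc₂⟩ := hθ.continuous_spaceGrad.bounded_above_of_compact_support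
    hθ.hasCompactSupport_spaceGrad
  obtain ⟨c₃, hc₃⟩ := hθ.smooth.continuous.bounded_above_of_compact_support hθ.compact
  set c := max c₁ (max c₂ c₃) with hc
  obtain ⟨s₀, hs₀⟩ := (isCompact_Icc (a := -(2 * M)) (b := 2 * M)).exists_bound_of_continuousOn
    hS'.continuousOn
  obtain ⟨w₁, hw₁⟩ := (isCompact_Icc (a := -(2 * M)) (b := 2 * M)).exists_bound_of_continuousOn
    hW.continuous.continuousOn
  have hδ0 : 0 ≤ δ := (abs_nonneg _).trans (hSδ 0 (by simpa using hM₀))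
  have hc0 : 0 ≤ c := (norm_nonneg _).trans ((hc₁ 0).trans (le_max_left _ _))
  have hs00 : 0 ≤ s₀ := (norm_nonneg _).trans (hs₀ 0 (by constructor <;> linarith))
  have hw10 : 0 ≤ w₁ := (norm_nonneg _).trans (hw₁ 0 (by constructor <;> linarith))
  set C₀ := (w₁ + δ * (2 * M)) * c
  -- Each of the two mollified fluxes is at most the mollified `NF`, and each of the two gradients
  -- at most the mollified `ND`. Their product therefore costs `2 · 2`, times `2` from
  -- `mollify_mul_mollify_le`.
  set Φ : (SpaceTime n → ℝ) → (SpaceTime n → ℝ) → SpaceTime n → ℝ := fun p q z =>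
    K.indicator (fun _ => C₀) z + (2 * δ * c * 2 * p z + s₀ * c * 8 * q z) with hΦ
  have hiC : Integrable (K.indicator fun _ : SpaceTime n => C₀) :=
    (integrable_indicator_iff hK.measurableSet).2 (integrableOn_const hK.measure_lt_top.ne)
  have hΦi : ∀ {p q : SpaceTime n → ℝ}, Integrable p → Integrable q → Integrable (Φ p q) :=
    fun hp hq => hiC.add ((hp.const_mul _).add (hq.const_mul _))
  have hΦint : ∀ {p q : SpaceTime n → ℝ}, Integrable p → Integrable q → ∫ z, Φ p q z
      = (∫ z, K.indicator (fun _ => C₀) z) + (2 * δ * c * 2 * (∫ z, p z)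
        + s₀ * c * 8 * ∫ z, q z) := by
    intro p q hp hq
    simp only [hΦ]
    have k₁ : Integrable fun z => 2 * δ * c * 2 * p z := hp.const_mul _
    have k₂ : Integrable fun z => s₀ * c * 8 * q z := hq.const_mul _
    have k₃ : Integrable fun z => 2 * δ * c * 2 * p z + s₀ * c * 8 * q z := k₁.add k₂
    rw [integral_add hiC k₃, integral_add k₁ k₂, integral_const_mul, integral_const_mul]
  have hcont : ∀ {E : Type} [NormedAddCommGroup E] [NormedSpace ℝ E] {f : SpaceTime n → E} (m : ℕ),
      Integrable f → Continuous (mollify (φ m) f) := fun m hf => (contDiff_mollify (φ m) hf).continuous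
  have hθc := hθ.continuous_timeDeriv
  have hθg := hθ.continuous_spaceGrad
  have hθs := hθ.smooth.continuous
  have hWc := hW.continuous
  have hSc := hS.continuous
  refine integral_nonneg_of_tendsto_of_dominated
    (f := fun m z => comparisonIntegrand δ W S S' θ z (mollify (φ m) (K.indicator v₁) z)
      (mollify (φ m) (K.indicator v₂) z) (mollify (φ m) (K.indicator D₁) z)
      (mollify (φ m) (K.indicator D₂) z) (mollify (φ m) (K.indicator F₁) z)
      (mollify (φ m) (K.indicator F₂) z))
    (Φ := fun m => Φ (mollify (φ m) NF) (mollify (φ m) (K.indicator h)))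
    (Φ₀ := Φ NF (K.indicator h)) ?_ ?_ (hΦi hiNF hih) ?_ ?_ ?_ ?_ ?_
  · intro m
    apply Continuous.aestronglyMeasurable
    have := hcont m hiv₁
    have := hcont m hiv₂
    have := hcont m hiD₁
    have := hcont m hiD₂
    have := hcont m hiF₁
    have := hcont m hiF₂
    unfold comparisonIntegrand
    fun_prop
  · intro m
    exact hΦi (integrable_mollify _ hiNF) (integrable_mollify _ hih)
  · intro m
    refine Eventually.of_forall fun z => ?_
    have p1 : 0 ≤ mollify (φ m) NF z := mollify_nonneg _ (fun y => by positivity) z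
    have p2 : 0 ≤ mollify (φ m) (K.indicator h) z :=
      mollify_nonneg _ (fun y => indicator_nonneg (fun z _ => hh0 z) y) z
    by_cases hz : z ∈ tsupport θ
    · have q1 : ‖mollify (φ m) (K.indicator F₁) z‖ ≤ mollify (φ m) NF z :=
        (norm_mollify_le_mollify_norm _ _ z).trans (mollify_mono _ hiF₁.norm hiNF
          (fun y => le_add_of_nonneg_right (norm_nonneg _)) z)
      have q2 : ‖mollify (φ m) (K.indicator F₂) z‖ ≤ mollify (φ m) NF z :=
        (norm_mollify_le_mollify_norm _ _ z).trans (mollify_mono _ hiF₂.norm hiNF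
          (fun y => le_add_of_nonneg_left (norm_nonneg _)) z)
      have q3 : ‖mollify (φ m) (K.indicator D₁) z‖ ≤ mollify (φ m) ND z :=
        (norm_mollify_le_mollify_norm _ _ z).trans (mollify_mono _ hiD₁.norm hiND
          (fun y => le_add_of_nonneg_right (norm_nonneg _)) z)
      have q4 : ‖mollify (φ m) (K.indicator D₂) z‖ ≤ mollify (φ m) ND z :=
        (norm_mollify_le_mollify_norm _ _ z).trans (mollify_mono _ hiD₂.norm hiND
          (fun y => le_add_of_nonneg_left (norm_nonneg _)) z)
      have q5 := mollify_mul_mollify_le (φ m) hiNF hiND hih hNN z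
      have q6 : |mollify (φ m) (K.indicator v₁) z| ≤ M := norm_mollify_le _ hiv₁ (hindM hM₁) z
      have q7 : |mollify (φ m) (K.indicator v₂) z| ≤ M := norm_mollify_le _ hiv₂ (hindM hM₂) z
      have q8 : |mollify (φ m) (K.indicator v₁) z - mollify (φ m) (K.indicator v₂) z| ≤ 2 * M :=
        (abs_sub _ _).trans (by linarith)
      have q9 : |mollify (φ m) (K.indicator v₁) z + mollify (φ m) (K.indicator v₂) z| ≤ 2 * M :=
        (abs_add_le _ _).trans (by linarith)
      have key := abs_comparisonIntegrand_le (δ := δ) (c := c)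
        (N := 8 * mollify (φ m) (K.indicator h) z) (s₀ := s₀)
        (w₀ := w₁ + δ * (2 * M)) (W := W) (S := S) (S' := S') (θ := θ) (z := z)
        (Da := mollify (φ m) (K.indicator D₁) z) (Db := mollify (φ m) (K.indicator D₂) z)
        (Fa := mollify (φ m) (K.indicator F₁) z) (Fb := mollify (φ m) (K.indicator F₂) z)
        (hSδ _ q8)
        ((abs_sub _ _).trans (add_le_add (hw₁ _ (abs_le.1 q8)) (by
          rw [abs_mul, abs_of_nonneg hδ0]; gcongr)))
        (hs₀ _ (abs_le.1 q8)) ((hc₁ z).trans (le_max_left _ _))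
        ((hc₂ z).trans ((le_max_left _ _).trans (le_max_right _ _)))
        ((hc₃ z).trans ((le_max_right _ _).trans (le_max_right _ _))) (by
          calc _ ≤ (2 * mollify (φ m) NF z) * (2 * mollify (φ m) ND z) := by
                gcongr <;> linarith
            _ ≤ _ := by linarith)
      refine key.trans ?_
      simp only [hΦ, indicator_of_mem (hθK hz)]
      have : 2 * δ * c * (‖mollify (φ m) (K.indicator F₁) z‖ + ‖mollify (φ m) (K.indicator F₂) z‖)
          ≤ 2 * δ * c * (2 * mollify (φ m) NF z) := by
        gcongr; linarith
      linarith
    · rw [comparisonIntegrand_eq_zero hθ hz, abs_zero]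
      simp only [hΦ]
      have : 0 ≤ K.indicator (fun _ : SpaceTime n => C₀) z :=
        indicator_nonneg (fun z _ => by positivity) z
      positivity
  · filter_upwards [ae_tendsto_mollify_shrinkingBump hr hiv₁,
      ae_tendsto_mollify_shrinkingBump hr hiv₂, ae_tendsto_mollify_shrinkingBump hr hiD₁,
      ae_tendsto_mollify_shrinkingBump hr hiD₂, ae_tendsto_mollify_shrinkingBump hr hiF₁,
      ae_tendsto_mollify_shrinkingBump hr hiF₂] with z k1 k2 k3 k4 k5 k6
    have l1 := ((hWc.tendsto _).comp (k1.sub k2)).sub ((k1.add k2).const_mul δ)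
      |>.mul_const (timeDeriv θ z)
    have l2 := ((k5.add k6).inner (tendsto_const_nhds (x := spaceGrad θ z)) (𝕜 := ℝ)).const_mul δ
    have l3 := ((hSc.tendsto _).comp (k1.sub k2)).mul
      ((k5.sub k6).inner (tendsto_const_nhds (x := spaceGrad θ z)) (𝕜 := ℝ))
    have l4 := (((hS'.tendsto _).comp (k1.sub k2)).mul_const (θ z)).mul
      ((k5.sub k6).inner (k3.sub k4) (𝕜 := ℝ))
    exact ((l1.add l2).sub l3).sub l4
  · filter_upwards [ae_tendsto_mollify_shrinkingBump hr hiNF,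
      ae_tendsto_mollify_shrinkingBump hr hih] with z k1 k2
    exact ((k1.const_mul _).add (k2.const_mul _)).const_add _
  · rw [hΦint hiNF hih]
    refine tendsto_const_nhds.congr fun m => ?_
    rw [hΦint (integrable_mollify _ hiNF) (integrable_mollify _ hih), integral_mollify _ hiNF,
      integral_mollify _ hih]
  · intro m
    exact integral_comparisonIntegrand_mollify_nonneg h₁ h₂ hD₁ hD₂ hF₁ hF₂ hK hrQ
      hQ.measurableSet (hindM hM₁) (hindM hM₂) hW hS hWS hSS' hSδ hθ hθ0 (φ m)
      (Metric.cthickening_mono (hφr m) _)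

end Comparison

/-! ### Young inequalities and the Caccioppoli estimate. -/

section Energy

variable {n : ℕ} {γ : ℝ → ℝ} {P : ℕ} {A : Space n → Space n} {C c : ℝ}

namespace IsGrowthFunction

/-- Replace the smaller of `s`, `t` by the larger one. This form of Young's inequality needs neither
convexity nor a conjugate function. -/
theorem mul_le_add (hγ : IsGrowthFunction γ P) {s t : ℝ} (hs : 0 ≤ s) (ht : 0 ≤ t) :
    γ s * t ≤ s * γ s + t * γ t := by
  have h1 := mul_nonneg hs (hγ.nonneg s)
  have h2 := mul_nonneg ht (hγ.nonneg t)
  rcases le_total s t with h | h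
  · have := mul_le_mul_of_nonneg_right (hγ.monotone h) ht
    linarith
  · have := mul_le_mul_of_nonneg_left h (hγ.nonneg s)
    linarith

/-- Separates `s ≤ ε⁻¹`, where `γ` is bounded, from `s ≥ ε⁻¹`, where `1 ≤ ε s`. It shows that the
flux is integrable wherever the energy is. -/
theorem le_mul_add (hγ : IsGrowthFunction γ P) {s ε : ℝ} (hs : 0 ≤ s) (hε : 0 < ε) :
    γ s ≤ ε * (s * γ s) + γ ε⁻¹ := by
  have h0 := hγ.nonneg s
  rcases le_total s ε⁻¹ with h | h
  · have := mul_nonneg hε.le (mul_nonneg hs h0)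
    linarith [hγ.monotone h]
  · have h1 : 1 ≤ ε * s := by rwa [← inv_le_iff_one_le_mul₀' hε]
    have := hγ.nonneg ε⁻¹
    nlinarith

/-- The argument is negligible with respect to the energy density for large arguments. -/
theorem exists_forall_le_mul (hγ : IsGrowthFunction γ P) {ε : ℝ} (hε : 0 < ε) :
    ∃ R, 0 ≤ R ∧ ∀ s, R ≤ s → s ≤ ε * (s * γ s) := by
  obtain ⟨R, hR⟩ := (hγ.tendsto_atTop.eventually_ge_atTop ε⁻¹).exists_forall_of_atTop
  refine ⟨max R 0, le_max_right _ _, fun s hs => ?_⟩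
  have hs0 : 0 ≤ s := (le_max_right _ _).trans hs
  have h1 : ε⁻¹ ≤ γ s := hR s ((le_max_left _ _).trans hs)
  have h2 : 1 ≤ ε * γ s := by rwa [← inv_le_iff_one_le_mul₀' hε]
  nlinarith

theorem exists_le_mul_add (hγ : IsGrowthFunction γ P) {ε : ℝ} (hε : 0 < ε) :
    ∃ R, 0 ≤ R ∧ ∀ s, 0 ≤ s → s ≤ ε * (s * γ s) + R := by
  obtain ⟨R, hR0, hR⟩ := hγ.exists_forall_le_mul hε
  refine ⟨R, hR0, fun s hs => ?_⟩
  rcases le_total R s with h | h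
  · linarith [hR s h]
  · have := mul_nonneg hε.le (mul_nonneg hs (hγ.nonneg s))
    linarith

/-- Young's inequality with a cutoff factor. -/
theorem mul_pow_mul_le (hγ : IsGrowthFunction γ P) (hP : 1 ≤ P) {s φ T ε : ℝ} (hs : 0 ≤ s)
    (hφ : 0 ≤ φ) (hφ1 : φ ≤ 1) (hT : 0 ≤ T) (hε : 0 < ε) :
    γ s * φ ^ P * T ≤ ε * (s * γ s * φ ^ (P + 1)) + T * γ (T / ε) := by
  have hγs := hγ.nonneg s
  have hγT := mul_nonneg hT (hγ.nonneg (T / ε))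
  rcases hφ.eq_or_lt with rfl | hφ
  · rw [zero_pow (by omega), zero_pow (by omega)]
    simpa using hγT
  have hpos : 0 < φ ^ P := by positivity
  -- If `T ≤ ε φ s`, the left side is absorbed directly. Otherwise `s ≤ φ⁻¹ (T / ε)`, and doubling
  -- with the factor `φ⁻¹ ≥ 1` loses exactly `φ⁻¹ ^ P`, which the cutoff power cancels.
  rcases le_total (T / ε) (φ * s) with h | h
  · rw [div_le_iff₀ hε] at h
    have : γ s * φ ^ P * T ≤ γ s * φ ^ P * (φ * s * ε) := by gcongr
    calc _ ≤ γ s * φ ^ P * (φ * s * ε) := this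
      _ = ε * (s * γ s * φ ^ (P + 1)) := by ring
      _ ≤ _ := by linarith
  · have h1 : s ≤ φ⁻¹ * (T / ε) := by rwa [le_inv_mul_iff₀ hφ]
    have h2 := (hγ.monotone h1).trans
      (hγ.doubling φ⁻¹ (T / ε) ((one_le_inv₀ hφ).2 hφ1) (by positivity))
    have h3 : γ s * φ ^ P ≤ γ (T / ε) := by
      calc γ s * φ ^ P ≤ (φ⁻¹ ^ P * γ (T / ε)) * φ ^ P := by gcongr
        _ = γ (T / ε) := by rw [inv_pow]; field_simp
    have h4 : 0 ≤ ε * (s * γ s * φ ^ (P + 1)) := by positivity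
    have := mul_le_mul_of_nonneg_right h3 hT
    linarith

end IsGrowthFunction

/-- A weak supersolution that is bounded by `M`, with locally integrable energy density. -/
structure IsBoundedSupersolution (A : Space n → Space n) (γ : ℝ → ℝ) (Q : Set (SpaceTime n))
    (M : ℝ) (v : SpaceTime n → ℝ) (Dv : SpaceTime n → Space n) : Prop where
  weakGrad : IsWeakSpaceGrad Q v Dv
  energy : LocallyIntegrableOn (fun z => ‖Dv z‖ * γ ‖Dv z‖) Q
  super : IsWeakSuperFlux Q v fun z => A (Dv z)
  bounded : ∀ᵐ z ∂volume.restrict Q, |v z| ≤ M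

theorem locallyIntegrableOn_of_norm_le {F F' : Type*} [NormedAddCommGroup F]
    [NormedAddCommGroup F'] {Q : Set (SpaceTime n)} (hQ : IsOpen Q) {f : SpaceTime n → F}
    {g : SpaceTime n → F'} (hf : LocallyIntegrableOn f Q)
    (hg : AEStronglyMeasurable g (volume.restrict Q)) (h : ∀ z, ‖g z‖ ≤ ‖f z‖) :
    LocallyIntegrableOn g Q := by
  rw [locallyIntegrableOn_iff hQ.isLocallyClosed] at hf ⊢
  intro K hKQ hK
  exact Integrable.mono (hf K hKQ hK) (hg.mono_measure (Measure.restrict_mono hKQ le_rfl))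
    (Eventually.of_forall h)

theorem integrable_smul_of_tsupport_subset {F : Type*} [NormedAddCommGroup F] [NormedSpace ℝ F]
    {Q : Set (SpaceTime n)} {f : SpaceTime n → F} (hf : LocallyIntegrableOn f Q)
    {ψ : SpaceTime n → ℝ} (hψ : Continuous ψ) (hc : HasCompactSupport ψ) (hs : tsupport ψ ⊆ Q) :
    Integrable fun z => ψ z • f z := by
  obtain ⟨B, hB⟩ := hψ.bounded_above_of_compact_support hc
  have h1 : Integrable ((tsupport ψ).indicator f) :=
    (integrable_indicator_iff (isClosed_tsupport ψ).measurableSet).2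
      (hf.integrableOn_compact_subset hs hc)
  have h2 := h1.bdd_smul B hψ.aestronglyMeasurable (Eventually.of_forall hB)
  refine h2.congr (Eventually.of_forall fun z => ?_)
  by_cases hz : z ∈ tsupport ψ
  · simp [indicator_of_mem hz]
  · simp [image_eq_zero_of_notMem_tsupport hz]

theorem IsMonotoneField.norm_le (hA : IsMonotoneField A γ C c) (ξ : Space n) :
    ‖A ξ‖ ≤ ‖A 0‖ + C * γ ‖ξ‖ := by
  have h1 := hA.growth ξ
  have h2 := norm_sub_norm_le (A ξ) (A 0)
  linarith

/-- A function that bounds the products of fluxes and gradients of two functions. -/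
noncomputable def pairEnergy (A : Space n → Space n) (γ : ℝ → ℝ) (C : ℝ)
    (D₁ D₂ : SpaceTime n → Space n) (z : SpaceTime n) : ℝ :=
  2 * ‖A 0‖ * (‖D₁ z‖ + ‖D₂ z‖) + 2 * C * (‖D₁ z‖ * γ ‖D₁ z‖ + ‖D₂ z‖ * γ ‖D₂ z‖)

namespace IsBoundedSupersolution

variable {Q : Set (SpaceTime n)} {M : ℝ} {v v₁ v₂ : SpaceTime n → ℝ}
  {Dv D₁ D₂ : SpaceTime n → Space n}

theorem aestronglyMeasurable_grad (h : IsBoundedSupersolution A γ Q M v Dv) :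
    AEStronglyMeasurable Dv (volume.restrict Q) :=
  h.weakGrad.locInt_grad.aestronglyMeasurable

theorem locallyIntegrableOn_flux (h : IsBoundedSupersolution A γ Q M v Dv) (hQ : IsOpen Q)
    (hγ : IsGrowthFunction γ P) (hA : IsMonotoneField A γ C c) (hC : 0 ≤ C) :
    LocallyIntegrableOn (fun z => A (Dv z)) Q := by
  have h1 : LocallyIntegrableOn
      (fun z => (‖A 0‖ + C * γ 1⁻¹) + C * (‖Dv z‖ * γ ‖Dv z‖)) Q :=
    (locallyIntegrableOn_const (‖A 0‖ + C * γ 1⁻¹)).add (h.energy.smul C)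
  refine locallyIntegrableOn_of_norm_le hQ h1
    (hA.continuous.comp_aestronglyMeasurable h.aestronglyMeasurable_grad) fun z => ?_
  refine ((hA.norm_le _).trans ?_).trans (le_abs_self _)
  have := mul_le_mul_of_nonneg_left (hγ.le_mul_add (norm_nonneg (Dv z)) one_pos) hC
  linarith

/-- The flux is the constant vector `A 0`, which need not vanish but is divergence-free. Comparing
with this function yields the energy estimate. -/
theorem const_zero (hQ : MeasurableSet Q) (hM : 0 ≤ M) :
    IsBoundedSupersolution A γ Q M (fun _ => 0) (fun _ => 0) where
  weakGrad := ⟨locallyIntegrableOn_const _, locallyIntegrableOn_const _, fun φ _ => by simp⟩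
  energy := by simpa using locallyIntegrableOn_const (μ := (volume : Measure (SpaceTime n))) (0 : ℝ)
  super := fun η hη _ => by
    have : ∫ z in Q, inner ℝ (A 0) (spaceGrad η z) = ∫ z, inner ℝ (A 0) (spaceGrad η z) :=
      setIntegral_eq_integral_indicator hQ hη.support (fun _ _ => rfl)
        (fun z hz => by rw [hη.spaceGrad_eq_zero hz, inner_zero_right])
        (fun z hz => by rw [hη.spaceGrad_eq_zero hz, inner_zero_right])
    simp [this, hη.integral_spaceGrad]
  bounded := by simp [hM]

/-- The flux and the gradient are taken at two unrelated points because mollification averages them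
independently. -/
theorem norm_flux_mul_norm_grad_le (hγ : IsGrowthFunction γ P) (hA : IsMonotoneField A γ C c)
    (hC : 0 ≤ C) (D₁ D₂ : SpaceTime n → Space n) (z z' : SpaceTime n) :
    (‖A (D₁ z)‖ + ‖A (D₂ z)‖) * (‖D₁ z'‖ + ‖D₂ z'‖)
      ≤ pairEnergy A γ C D₁ D₂ z + pairEnergy A γ C D₁ D₂ z' := by
  have a1 := hA.norm_le (D₁ z)
  have a2 := hA.norm_le (D₂ z)
  have m11 := hγ.mul_le_add (norm_nonneg (D₁ z)) (norm_nonneg (D₁ z'))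
  have m12 := hγ.mul_le_add (norm_nonneg (D₁ z)) (norm_nonneg (D₂ z'))
  have m21 := hγ.mul_le_add (norm_nonneg (D₂ z)) (norm_nonneg (D₁ z'))
  have m22 := hγ.mul_le_add (norm_nonneg (D₂ z)) (norm_nonneg (D₂ z'))
  have key : (γ ‖D₁ z‖ + γ ‖D₂ z‖) * (‖D₁ z'‖ + ‖D₂ z'‖)
      ≤ 2 * (‖D₁ z‖ * γ ‖D₁ z‖ + ‖D₂ z‖ * γ ‖D₂ z‖)
        + 2 * (‖D₁ z'‖ * γ ‖D₁ z'‖ + ‖D₂ z'‖ * γ ‖D₂ z'‖) := by linarith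
  have key' := mul_le_mul_of_nonneg_left key hC
  have hpos : 0 ≤ 2 * ‖A 0‖ * (‖D₁ z‖ + ‖D₂ z‖) := by positivity
  unfold pairEnergy
  calc (‖A (D₁ z)‖ + ‖A (D₂ z)‖) * (‖D₁ z'‖ + ‖D₂ z'‖)
      ≤ (2 * ‖A 0‖ + C * (γ ‖D₁ z‖ + γ ‖D₂ z‖)) * (‖D₁ z'‖ + ‖D₂ z'‖) := by
        refine mul_le_mul_of_nonneg_right ?_ (by positivity)
        linarith
    _ ≤ _ := by linarith

theorem pairEnergy_nonneg (hγ : IsGrowthFunction γ P) (hC : 0 ≤ C)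
    (D₁ D₂ : SpaceTime n → Space n) (z : SpaceTime n) : 0 ≤ pairEnergy A γ C D₁ D₂ z := by
  have := hγ.nonneg ‖D₁ z‖
  have := hγ.nonneg ‖D₂ z‖
  unfold pairEnergy
  positivity

theorem locallyIntegrableOn_pairEnergy (h₁ : IsBoundedSupersolution A γ Q M v₁ D₁)
    (h₂ : IsBoundedSupersolution A γ Q M v₂ D₂) :
    LocallyIntegrableOn (pairEnergy A γ C D₁ D₂) Q :=
  ((h₁.weakGrad.locInt_grad.norm.add h₂.weakGrad.locInt_grad.norm).smul (2 * ‖A 0‖)).add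
    ((h₁.energy.add h₂.energy).smul (2 * C))

theorem integral_comparisonIntegrand_nonneg (h₁ : IsBoundedSupersolution A γ Q M v₁ D₁)
    (h₂ : IsBoundedSupersolution A γ Q M v₂ D₂) (hQ : IsOpen Q) (hγ : IsGrowthFunction γ P)
    (hA : IsMonotoneField A γ C c) (hC : 0 ≤ C) (hM : 0 ≤ M) {δ : ℝ}
    {W S S' : ℝ → ℝ} (hW : ContDiff ℝ ∞ W) (hS : ContDiff ℝ ∞ S) (hS' : Continuous S')
    (hWS : ∀ x, HasDerivAt W (S x) x) (hSS' : ∀ x, HasDerivAt S (S' x) x)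
    (hSδ : ∀ x, |x| ≤ 2 * M → |S x| ≤ δ)
    {θ : SpaceTime n → ℝ} (hθ : IsTestFunction Q θ) (hθ0 : ∀ z, 0 ≤ θ z) :
    Integrable (fun z => comparisonIntegrand δ W S S' θ z (v₁ z) (v₂ z) (D₁ z) (D₂ z)
        (A (D₁ z)) (A (D₂ z))) ∧
      0 ≤ ∫ z, comparisonIntegrand δ W S S' θ z (v₁ z) (v₂ z) (D₁ z) (D₂ z)
        (A (D₁ z)) (A (D₂ z)) := by
  exact _root_.integral_comparisonIntegrand_nonneg h₁.super h₂.super h₁.weakGrad h₂.weakGrad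
    (h₁.locallyIntegrableOn_flux hQ hγ hA hC) (h₂.locallyIntegrableOn_flux hQ hγ hA hC) hQ
    (locallyIntegrableOn_pairEnergy h₁ h₂) (pairEnergy_nonneg hγ hC D₁ D₂)
    (norm_flux_mul_norm_grad_le hγ hA hC D₁ D₂) hM h₁.bounded h₂.bounded
    hW hS hS' hWS hSS' hSδ hθ hθ0

/-- The Caccioppoli estimate. The time derivative of the cutoff function enters only through an
upper bound, which makes the estimate uniform up to the final time. -/
theorem integral_energy_le (hγ : IsGrowthFunction γ P) (hP : 1 ≤ P)
    (hA : IsMonotoneField A γ C c) (hC : 0 ≤ C) (hc : 0 < c) (hM : 0 ≤ M) {κ : ℝ} (hκ : 0 ≤ κ)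
    (m : ℝ) : ∃ B : ℝ, ∀ (Q : Set (SpaceTime n)) (v : SpaceTime n → ℝ) (Dv : SpaceTime n → Space n)
      (φ : SpaceTime n → ℝ), IsOpen Q → IsBoundedSupersolution A γ Q M v Dv →
      IsTestFunction Q φ → (∀ z, 0 ≤ φ z) → (∀ z, φ z ≤ 1) → (∀ z, ‖spaceGrad φ z‖ ≤ κ) →
      (∀ z, timeDeriv φ z ≤ κ) → volume.real (tsupport φ) ≤ m →
      Integrable (fun z => φ z ^ (P + 1) * (‖Dv z‖ * γ ‖Dv z‖)) ∧
        ∫ z, φ z ^ (P + 1) * (‖Dv z‖ * γ ‖Dv z‖) ≤ B := by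
  set p : ℝ := P + 1 with hp
  have hp0 : 0 ≤ p := by positivity
  -- `3M` bounds `2M - v`, and `p κ φ ^ P` bounds the gradient of `φ ^ (P + 1)`.
  set T : ℝ := 3 * M * C * (p * κ) with hTdef
  have hT : 0 ≤ T := by positivity
  set B₀ : ℝ := 9 / 2 * M ^ 2 * (p * κ) + T * γ (T / (c / 2)) + 4 * M * ‖A 0‖ * (p * κ) with hB₀
  have hB₀0 : 0 ≤ B₀ := by
    have := hγ.nonneg (T / (c / 2))
    positivity
  refine ⟨2 / c * (B₀ * m), ?_⟩
  intro Q v Dv φ hQ h hφ hφ0 hφ1 hgrad htime hm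
  have hθ : IsTestFunction Q fun z => φ z ^ (P + 1) := by
    have hts : tsupport (fun z => φ z ^ (P + 1)) ⊆ tsupport φ := by
      apply closure_mono
      intro z hz hz0
      exact hz (by simp [hz0])
    exact ⟨hφ.smooth.pow _, hφ.compact.of_isClosed_subset (isClosed_tsupport _) hts,
      hts.trans hφ.support⟩
  have hθ0 : ∀ z, 0 ≤ φ z ^ (P + 1) := fun z => pow_nonneg (hφ0 z) _
  have hfd : ∀ z, fderiv ℝ (fun z => φ z ^ (P + 1)) z = (p * φ z ^ P) • fderiv ℝ φ z := by
    intro z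
    rw [((hφ.differentiable z).hasFDerivAt.pow (P + 1)).fderiv]
    simp [hp]
  have hθt : ∀ z, timeDeriv (fun z => φ z ^ (P + 1)) z = p * φ z ^ P * timeDeriv φ z := by
    intro z
    rw [hθ.timeDeriv_eq, hφ.timeDeriv_eq]
    simp [hfd]
  have hθg : ∀ z, spaceGrad (fun z => φ z ^ (P + 1)) z = (p * φ z ^ P) • spaceGrad φ z := by
    intro z
    rw [hθ.spaceGrad_eq, hφ.spaceGrad_eq]
    simp only [hfd, map_smul]
  have hEint : Integrable fun z => φ z ^ (P + 1) * (‖Dv z‖ * γ ‖Dv z‖) :=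
    integrable_smul_of_tsupport_subset h.energy hθ.smooth.continuous hθ.compact hθ.support
  refine ⟨hEint, ?_⟩
  -- Comparison with the zero function, with `S` the identity; `|x| ≤ 2M` dictates `δ = 2M`.
  obtain ⟨hint, hnn⟩ := h.integral_comparisonIntegrand_nonneg (const_zero hQ.measurableSet hM) hQ hγ
    hA hC hM (δ := 2 * M) (W := fun x => x ^ 2 / 2) (S := fun x => x) (S' := fun _ => 1)
    (by fun_prop) (by fun_prop) (by fun_prop)
    (fun x => by simpa using (hasDerivAt_pow 2 x).div_const 2) (fun x => hasDerivAt_id x)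
    (fun x hx => hx) hθ hθ0
  have htint : Integrable (timeDeriv fun z => φ z ^ (P + 1)) :=
    hθ.continuous_timeDeriv.integrable_of_hasCompactSupport hθ.hasCompactSupport_timeDeriv
  have hKint : Integrable ((tsupport φ).indicator fun _ => B₀) :=
    (integrable_indicator_iff (isClosed_tsupport φ).measurableSet).2
      (integrableOn_const hφ.compact.isCompact.measure_lt_top.ne)
  -- The factor of the time derivative is `v²/2 - 2Mv = (v - 2M)²/2 - 2M²`. The square is
  -- nonnegative, so only an upper bound for `∂ₜφ` is needed, and the constant part integrates to
  -- zero. Young's inequality with `ε = c / 2` absorbs the flux term into half of the coercive term.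
  have hbd : ∀ᵐ z, comparisonIntegrand (2 * M) (fun x => x ^ 2 / 2) (fun x => x) (fun _ => 1)
      (fun z => φ z ^ (P + 1)) z (v z) 0 (Dv z) 0 (A (Dv z)) (A 0)
      ≤ (tsupport φ).indicator (fun _ => B₀) z
        - 2 * M ^ 2 * timeDeriv (fun z => φ z ^ (P + 1)) z
        - c / 2 * (φ z ^ (P + 1) * (‖Dv z‖ * γ ‖Dv z‖)) := by
    have hMv := h.bounded
    rw [ae_restrict_iff' hQ.measurableSet] at hMv
    filter_upwards [hMv] with z hz
    by_cases hzs : z ∈ tsupport φ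
    · have hv := abs_le.1 (hz (hφ.support hzs))
      rw [indicator_of_mem hzs]
      have hφP : 0 ≤ φ z ^ P := pow_nonneg (hφ0 z) _
      have hφP1 : φ z ^ P ≤ 1 := pow_le_one₀ (hφ0 z) (hφ1 z)
      have y := hγ.mul_pow_mul_le hP (norm_nonneg (Dv z)) (hφ0 z) (hφ1 z) hT (half_pos hc)
      have gr := hA.growth (Dv z)
      have co := mul_le_mul_of_nonneg_left (hA.coercive (Dv z)) (hθ0 z)
      have hgn : ‖spaceGrad (fun z => φ z ^ (P + 1)) z‖ ≤ p * κ * φ z ^ P := by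
        rw [hθg, norm_smul, Real.norm_of_nonneg (by positivity)]
        have := mul_le_mul_of_nonneg_left (hgrad z) (by positivity : 0 ≤ p * φ z ^ P)
        linarith
      have tt : (v z - 2 * M) ^ 2 / 2 * timeDeriv (fun z => φ z ^ (P + 1)) z
          ≤ 9 / 2 * M ^ 2 * (p * κ) := by
        rw [hθt]
        have e1 : (v z - 2 * M) ^ 2 ≤ 9 * M ^ 2 := by nlinarith [hv.1, hv.2]
        have e2 : p * φ z ^ P * timeDeriv φ z ≤ p * κ := by
          calc p * φ z ^ P * timeDeriv φ z ≤ p * φ z ^ P * κ := by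
                gcongr; exact htime z
            _ ≤ p * 1 * κ := by gcongr
            _ = p * κ := by ring
        calc (v z - 2 * M) ^ 2 / 2 * (p * φ z ^ P * timeDeriv φ z)
            ≤ (v z - 2 * M) ^ 2 / 2 * (p * κ) := by gcongr
          _ ≤ 9 * M ^ 2 / 2 * (p * κ) := by gcongr
          _ = _ := by ring
      set Θ := spaceGrad (fun z => φ z ^ (P + 1)) z with hΘ
      set X := A (Dv z) - A 0 with hX
      have hXΘ : |inner ℝ X Θ| ≤ C * γ ‖Dv z‖ * (p * κ * φ z ^ P) :=
        (abs_real_inner_le_norm _ _).trans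
          (mul_le_mul gr hgn (norm_nonneg _) (by have := hγ.nonneg ‖Dv z‖; positivity))
      have hAΘ : |inner ℝ (A 0) Θ| ≤ ‖A 0‖ * (p * κ) := by
        refine (abs_real_inner_le_norm _ _).trans ?_
        gcongr
        exact hgn.trans (mul_le_of_le_one_right (by positivity) hφP1)
      have f1 : (2 * M - v z) * inner ℝ X Θ ≤ γ ‖Dv z‖ * φ z ^ P * T := by
        calc (2 * M - v z) * inner ℝ X Θ ≤ (2 * M - v z) * |inner ℝ X Θ| := by
              apply mul_le_mul_of_nonneg_left (le_abs_self _); linarith [hv.2]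
          _ ≤ (3 * M) * |inner ℝ X Θ| := by
              apply mul_le_mul_of_nonneg_right _ (abs_nonneg _); linarith [hv.1]
          _ ≤ (3 * M) * (C * γ ‖Dv z‖ * (p * κ * φ z ^ P)) := by gcongr
          _ = γ ‖Dv z‖ * φ z ^ P * T := by rw [hTdef]; ring
      have f2 : 4 * M * inner ℝ (A 0) Θ ≤ 4 * M * ‖A 0‖ * (p * κ) := by
        calc 4 * M * inner ℝ (A 0) Θ ≤ 4 * M * (‖A 0‖ * (p * κ)) := by
              gcongr; exact (le_abs_self _).trans hAΘ
          _ = _ := by ring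
      have expand : comparisonIntegrand (2 * M) (fun x => x ^ 2 / 2) (fun x => x) (fun _ => 1)
          (fun z => φ z ^ (P + 1)) z (v z) 0 (Dv z) 0 (A (Dv z)) (A 0)
          = (v z - 2 * M) ^ 2 / 2 * timeDeriv (fun z => φ z ^ (P + 1)) z
            - 2 * M ^ 2 * timeDeriv (fun z => φ z ^ (P + 1)) z
            + (2 * M - v z) * inner ℝ X Θ + 4 * M * inner ℝ (A 0) Θ
            - φ z ^ (P + 1) * inner ℝ X (Dv z) := by
        simp only [comparisonIntegrand, sub_zero, ← hΘ, ← hX]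
        have : A (Dv z) + A 0 = X + A 0 + A 0 := by rw [hX]; abel
        rw [this, inner_add_left, inner_add_left]
        ring
      rw [expand, hB₀]
      linarith
    · have hz' : z ∉ tsupport fun z => φ z ^ (P + 1) := by
        intro hc'
        apply hzs
        refine closure_mono ?_ hc'
        intro y hy hy0
        exact hy (by simp [hy0])
      rw [comparisonIntegrand_eq_zero hθ hz', indicator_of_notMem hzs,
        hθ.timeDeriv_eq_zero hz', image_eq_zero_of_notMem_tsupport hzs]
      simp
  have k₁ : Integrable fun z => (tsupport φ).indicator (fun _ => B₀) z
        - 2 * M ^ 2 * timeDeriv (fun z => φ z ^ (P + 1)) z := hKint.sub (htint.const_mul _)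
  have k₂ : Integrable fun z => c / 2 * (φ z ^ (P + 1) * (‖Dv z‖ * γ ‖Dv z‖)) :=
    hEint.const_mul _
  have hmono := hnn.trans (integral_mono_ae hint (k₁.sub k₂) hbd)
  have hrw : ∫ z, ((tsupport φ).indicator (fun _ => B₀) z
        - 2 * M ^ 2 * timeDeriv (fun z => φ z ^ (P + 1)) z
        - c / 2 * (φ z ^ (P + 1) * (‖Dv z‖ * γ ‖Dv z‖)))
      = volume.real (tsupport φ) * B₀
        - c / 2 * ∫ z, φ z ^ (P + 1) * (‖Dv z‖ * γ ‖Dv z‖) := by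
    rw [integral_sub k₁ k₂, integral_sub hKint (htint.const_mul _), integral_const_mul,
      integral_const_mul, hθ.integral_timeDeriv,
      integral_indicator (isClosed_tsupport φ).measurableSet, setIntegral_const]
    simp
  have hmono' : 0 ≤ volume.real (tsupport φ) * B₀
        - c / 2 * ∫ z, φ z ^ (P + 1) * (‖Dv z‖ * γ ‖Dv z‖) := hrw ▸ hmono
  have hlast : c / 2 * ∫ z, φ z ^ (P + 1) * (‖Dv z‖ * γ ‖Dv z‖) ≤ B₀ * m := by
    have := mul_le_mul_of_nonneg_right hm hB₀0
    linarith
  rw [div_mul_eq_mul_div, le_div_iff₀ hc]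
  linarith

end IsBoundedSupersolution

/-- A smooth cutoff function between a compact set and an open set. -/
theorem exists_contDiff_cutoff {E : Type*} [NormedAddCommGroup E] [NormedSpace ℝ E]
    [FiniteDimensional ℝ E] {K U : Set E} (hK : IsCompact K) (hU : IsOpen U) (hKU : K ⊆ U) :
    ∃ φ : E → ℝ, ContDiff ℝ ∞ φ ∧ HasCompactSupport φ ∧ tsupport φ ⊆ U ∧ (∀ x, 0 ≤ φ x) ∧
      (∀ x, φ x ≤ 1) ∧ ∀ x ∈ K, φ x = 1 := by
  have : ProperSpace E := FiniteDimensional.proper_real E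
  obtain ⟨K', hK', h1, h2⟩ := exists_compact_between hK hU hKU
  obtain ⟨f, hf, hr, hs, ht⟩ := exists_contMDiff_support_eq_eq_one_iff
    (modelWithCornersSelf ℝ E) (n := ⊤) isOpen_interior hK.isClosed h1
  have hts : tsupport f ⊆ K' :=
    closure_minimal (by rw [hs]; exact interior_subset) hK'.isClosed
  exact ⟨f, hf.contDiff, hK'.of_isClosed_subset (isClosed_tsupport f) hts, hts.trans h2,
    fun z => (hr ⟨z, rfl⟩).1, fun z => (hr ⟨z, rfl⟩).2, fun z hz => (ht z).1 hz⟩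

theorem exists_isTestFunction_eq_one {K Q : Set (SpaceTime n)} (hK : IsCompact K) (hQ : IsOpen Q)
    (hKQ : K ⊆ Q) : ∃ φ : SpaceTime n → ℝ, IsTestFunction Q φ ∧ (∀ z, 0 ≤ φ z) ∧ (∀ z, φ z ≤ 1) ∧
      ∀ z ∈ K, φ z = 1 := by
  obtain ⟨φ, h1, h2, h3, h4⟩ := exists_contDiff_cutoff hK hQ hKQ
  exact ⟨φ, ⟨h1, h2, h3⟩, h4⟩

/-- The energies of bounded supersolutions are uniformly bounded on compact sets. -/
theorem exists_setIntegral_energy_le (hγ : IsGrowthFunction γ P) (hP : 1 ≤ P)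
    (hA : IsMonotoneField A γ C c) (hC : 0 ≤ C) (hc : 0 < c) {M : ℝ} (hM : 0 ≤ M)
    {K Q : Set (SpaceTime n)} (hK : IsCompact K) (hQ : IsOpen Q) (hKQ : K ⊆ Q) :
    ∃ B : ℝ, ∀ (v : SpaceTime n → ℝ) (Dv : SpaceTime n → Space n),
      IsBoundedSupersolution A γ Q M v Dv → ∫ z in K, ‖Dv z‖ * γ ‖Dv z‖ ≤ B := by
  obtain ⟨φ, hφ, hφ0, hφ1, hφK⟩ := exists_isTestFunction_eq_one hK hQ hKQ
  obtain ⟨c₁, hc₁⟩ := hφ.continuous_timeDeriv.bounded_above_of_compact_support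
    hφ.hasCompactSupport_timeDeriv
  obtain ⟨c₂, hc₂⟩ := hφ.continuous_spaceGrad.bounded_above_of_compact_support
    hφ.hasCompactSupport_spaceGrad
  have hc0 : 0 ≤ max c₁ c₂ := (norm_nonneg _).trans ((hc₁ 0).trans (le_max_left _ _))
  obtain ⟨B, hB⟩ := IsBoundedSupersolution.integral_energy_le hγ hP hA hC hc hM hc0
    (volume.real (tsupport φ))
  refine ⟨B, fun v Dv h => ?_⟩
  obtain ⟨h1, h2⟩ := hB Q v Dv φ hQ h hφ hφ0 hφ1 (fun z => (hc₂ z).trans (le_max_right _ _))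
    (fun z => (le_abs_self _).trans ((hc₁ z).trans (le_max_left _ _))) le_rfl
  refine le_trans ?_ h2
  have h0 : ∀ z, 0 ≤ φ z ^ (P + 1) * (‖Dv z‖ * γ ‖Dv z‖) := fun z =>
    mul_nonneg (pow_nonneg (hφ0 z) _) (mul_nonneg (norm_nonneg _) (hγ.nonneg _))
  refine le_trans (le_of_eq ?_) (setIntegral_le_integral h1 (Eventually.of_forall h0) (s := K))
  refine setIntegral_congr_fun hK.measurableSet fun z hz => ?_
  simp [hφK z hz]

end Energy

/-! ### A smooth truncation at height `δ`. -/

section Truncation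

/-- A smooth convex function whose derivative is a truncation at height `δ`. -/
noncomputable def truncPrimitive (δ x : ℝ) : ℝ := δ * √(δ ^ 2 + x ^ 2)

/-- The derivative of `truncPrimitive δ`. -/
noncomputable def trunc (δ x : ℝ) : ℝ := δ * x / √(δ ^ 2 + x ^ 2)

/-- The derivative of `trunc δ`. -/
noncomputable def truncDeriv (δ x : ℝ) : ℝ := δ ^ 3 / √(δ ^ 2 + x ^ 2) ^ 3

variable {δ : ℝ}

theorem trunc_radicand_pos (hδ : 0 < δ) (x : ℝ) : 0 < δ ^ 2 + x ^ 2 := by positivity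

theorem contDiff_truncPrimitive (hδ : 0 < δ) : ContDiff ℝ ∞ (truncPrimitive δ) :=
  contDiff_const.mul (ContDiff.sqrt (by fun_prop) fun x => (trunc_radicand_pos hδ x).ne')

theorem contDiff_trunc (hδ : 0 < δ) : ContDiff ℝ ∞ (trunc δ) :=
  ContDiff.div (by fun_prop) (ContDiff.sqrt (by fun_prop) fun x => (trunc_radicand_pos hδ x).ne')
    fun x => (Real.sqrt_pos.2 (trunc_radicand_pos hδ x)).ne'

theorem continuous_truncDeriv (hδ : 0 < δ) : Continuous (truncDeriv δ) :=
  Continuous.div (by fun_prop) (by fun_prop)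
    fun x => (pow_pos (Real.sqrt_pos.2 (trunc_radicand_pos hδ x)) 3).ne'

theorem hasDerivAt_sqrt_radicand (hδ : 0 < δ) (x : ℝ) :
    HasDerivAt (fun x => √(δ ^ 2 + x ^ 2)) (x / √(δ ^ 2 + x ^ 2)) x := by
  have h := (((hasDerivAt_pow 2 x).const_add (δ ^ 2)).sqrt (trunc_radicand_pos hδ x).ne')
  have hs := Real.sqrt_pos.2 (trunc_radicand_pos hδ x)
  convert h using 1
  simp; field_simp

theorem hasDerivAt_truncPrimitive (hδ : 0 < δ) (x : ℝ) :
    HasDerivAt (truncPrimitive δ) (trunc δ x) x := by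
  have h := (hasDerivAt_sqrt_radicand hδ x).const_mul δ
  exact h.congr_deriv (by rw [trunc, mul_div_assoc])

theorem hasDerivAt_trunc (hδ : 0 < δ) (x : ℝ) : HasDerivAt (trunc δ) (truncDeriv δ x) x := by
  have hs := Real.sqrt_pos.2 (trunc_radicand_pos hδ x)
  have hsq := Real.sq_sqrt (trunc_radicand_pos hδ x).le
  have h := ((hasDerivAt_id x).const_mul δ).div (hasDerivAt_sqrt_radicand hδ x) hs.ne'
  refine h.congr_deriv ?_
  simp only [truncDeriv, id]
  set r := √(δ ^ 2 + x ^ 2)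
  field_simp
  rw [hsq]; ring

theorem abs_trunc_le (hδ : 0 < δ) (x : ℝ) : |trunc δ x| ≤ δ := by
  have hs := Real.sqrt_pos.2 (trunc_radicand_pos hδ x)
  rw [trunc, abs_div, abs_mul, abs_of_pos hδ, abs_of_pos hs, div_le_iff₀ hs]
  gcongr
  exact Real.abs_le_sqrt (by nlinarith)

theorem truncPrimitive_nonneg (hδ : 0 < δ) (x : ℝ) : 0 ≤ truncPrimitive δ x := by
  unfold truncPrimitive; positivity

theorem truncPrimitive_le (hδ : 0 < δ) (x : ℝ) : truncPrimitive δ x ≤ δ * (δ + |x|) := by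
  unfold truncPrimitive
  gcongr
  rw [Real.sqrt_le_left (by positivity)]
  nlinarith [sq_abs x, abs_nonneg x, mul_nonneg hδ.le (abs_nonneg x)]

theorem truncDeriv_nonneg (hδ : 0 < δ) (x : ℝ) : 0 ≤ truncDeriv δ x := by
  unfold truncDeriv; positivity

theorem truncDeriv_le_one (hδ : 0 < δ) (x : ℝ) : truncDeriv δ x ≤ 1 := by
  have hs := Real.sqrt_pos.2 (trunc_radicand_pos hδ x)
  rw [truncDeriv, div_le_one (by positivity)]
  gcongr
  exact Real.le_sqrt_of_sq_le (by nlinarith)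

/-- For `|x| ≤ δ` the square root is at most `2δ`, and `8 = 2 ^ 3`. -/
theorem one_le_truncDeriv (hδ : 0 < δ) {x : ℝ} (hx : |x| ≤ δ) : 1 ≤ 8 * truncDeriv δ x := by
  have hs := Real.sqrt_pos.2 (trunc_radicand_pos hδ x)
  have h1 : √(δ ^ 2 + x ^ 2) ≤ 2 * δ := by
    rw [Real.sqrt_le_left (by positivity)]
    nlinarith [sq_abs x, abs_nonneg x]
  have h2 : √(δ ^ 2 + x ^ 2) ^ 3 ≤ (2 * δ) ^ 3 := by gcongr
  rw [truncDeriv, ← mul_div_assoc, one_le_div (by positivity)]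
  linarith

end Truncation

/-! ### Quantitative monotonicity and the estimate of order `δ`. -/

section Convergence

variable {n : ℕ} {γ : ℝ → ℝ} {P : ℕ} {A : Space n → Space n} {C c : ℝ}

theorem IsMonotoneField.inner_nonneg (hA : IsMonotoneField A γ C c) (ξ ζ : Space n) :
    0 ≤ inner ℝ (A ξ - A ζ) (ξ - ζ) := by
  rcases eq_or_ne ξ ζ with rfl | h
  · simp
  · exact (hA.strictMono ξ ζ h).le

/-- Quantitative strict monotonicity, modulo a small multiple of the energy. -/
theorem IsMonotoneField.exists_norm_sub_le (hA : IsMonotoneField A γ C c)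
    (hγ : IsGrowthFunction γ P) {η : ℝ} (hη : 0 < η) :
    ∃ B : ℝ, 0 ≤ B ∧ ∀ ξ ζ : Space n, ‖ξ - ζ‖ ≤ η * (1 + ‖ξ‖ * γ ‖ξ‖ + ‖ζ‖ * γ ‖ζ‖)
      + B * inner ℝ (A ξ - A ζ) (ξ - ζ) := by
  obtain ⟨R, hR0, hR⟩ := hγ.exists_forall_le_mul (half_pos hη)
  -- On pairs bounded by `R` and at distance at least `η`, compactness gives the monotone expression
  -- a positive minimum. Closer pairs are covered by `η`, and pairs with a member beyond `R` by the
  -- energy, since the larger norm controls both.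
  set K : Set (Space n × Space n) :=
    (Metric.closedBall 0 R ×ˢ Metric.closedBall 0 R) ∩ {p | η ≤ ‖p.1 - p.2‖} with hK
  have hKc : IsCompact K := by
    apply ((isCompact_closedBall _ _).prod (isCompact_closedBall _ _)).inter_right
    exact isClosed_le continuous_const (by fun_prop)
  have hcont : Continuous fun p : Space n × Space n => inner ℝ (A p.1 - A p.2) (p.1 - p.2) := by
    have := hA.continuous
    fun_prop
  obtain ⟨m, hm0, hm⟩ := hKc.exists_forall_le' (a := 0) hcont.continuousOn (by
    rintro ⟨ξ, ζ⟩ ⟨-, h⟩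
    refine hA.strictMono ξ ζ fun he => ?_
    simp only [mem_ofPred_eq, he, sub_self, norm_zero] at h
    linarith)
  refine ⟨2 * R / m, by positivity, fun ξ ζ => ?_⟩
  have hin := hA.inner_nonneg ξ ζ
  have e1 := mul_nonneg (norm_nonneg ξ) (hγ.nonneg ‖ξ‖)
  have e2 := mul_nonneg (norm_nonneg ζ) (hγ.nonneg ‖ζ‖)
  have e3 : 0 ≤ 2 * R / m * inner ℝ (A ξ - A ζ) (ξ - ζ) := by positivity
  have e4 := mul_nonneg hη.le e1
  have e5 := mul_nonneg hη.le e2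
  rcases lt_or_ge ‖ξ - ζ‖ η with h | h
  · linarith
  by_cases hξ : ‖ξ‖ ≤ R
  · by_cases hζ : ‖ζ‖ ≤ R
    · have hmem : (ξ, ζ) ∈ K := ⟨⟨by simpa using hξ, by simpa using hζ⟩, h⟩
      have h1 : m ≤ inner ℝ (A ξ - A ζ) (ξ - ζ) := hm _ hmem
      have h2 : ‖ξ - ζ‖ ≤ 2 * R := (norm_sub_le _ _).trans (by linarith)
      have h3 : 2 * R ≤ 2 * R / m * inner ℝ (A ξ - A ζ) (ξ - ζ) := by
        rw [div_mul_eq_mul_div, le_div_iff₀ hm0]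
        gcongr
      linarith
    · push Not at hζ
      have h1 := hR ‖ζ‖ hζ.le
      have h2 := norm_sub_le ξ ζ
      linarith
  · push Not at hξ
    have h1 := hR ‖ξ‖ hξ.le
    have h2 := norm_sub_le ξ ζ
    rcases le_total ‖ζ‖ ‖ξ‖ with h3 | h3
    · linarith
    · have := hR ‖ζ‖ (hξ.le.trans h3)
      linarith

/-- Continuity of the field on compact sets, extended by a small multiple of the energy. -/
theorem IsMonotoneField.exists_norm_sub_map_le (hA : IsMonotoneField A γ C c) (hC : 0 ≤ C)
    (hγ : IsGrowthFunction γ P) {η : ℝ} (hη : 0 < η) :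
    ∃ B : ℝ, 0 ≤ B ∧ ∀ ξ ζ : Space n, ‖A ξ - A ζ‖ ≤ η * (1 + ‖ξ‖ * γ ‖ξ‖ + ‖ζ‖ * γ ‖ζ‖)
      + B * ‖ξ - ζ‖ := by
  -- From this radius on, the flux is dominated by a small multiple of the energy; inside the ball,
  -- uniform continuity of `A` is used.
  set R : ℝ := 2 * C / η with hRdef
  have hR0 : 0 ≤ R := by positivity
  have hlarge : ∀ s, R ≤ s → 2 * (C * γ s) ≤ η * (s * γ s) := by
    intro s hs
    rw [hRdef, div_le_iff₀ hη] at hs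
    have := mul_le_mul_of_nonneg_right hs (hγ.nonneg s)
    linarith
  have huc := (isCompact_closedBall (0 : Space n) R).uniformContinuousOn_of_continuous
    hA.continuous.continuousOn
  obtain ⟨d, hd, huc⟩ := Metric.uniformContinuousOn_iff.1 huc η hη
  refine ⟨2 * (C * γ R) / d, by have := hγ.nonneg R; positivity, fun ξ ζ => ?_⟩
  have e1 := mul_nonneg hη.le (mul_nonneg (norm_nonneg ξ) (hγ.nonneg ‖ξ‖))
  have e2 := mul_nonneg hη.le (mul_nonneg (norm_nonneg ζ) (hγ.nonneg ‖ζ‖))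
  have e3 : 0 ≤ 2 * (C * γ R) / d * ‖ξ - ζ‖ := by have := hγ.nonneg R; positivity
  have tri : ‖A ξ - A ζ‖ ≤ C * γ ‖ξ‖ + C * γ ‖ζ‖ := by
    have h1 := hA.growth ξ
    have h2 := hA.growth ζ
    have h3 := norm_sub_le (A ξ - A 0) (A ζ - A 0)
    rw [sub_sub_sub_cancel_right] at h3
    linarith
  have mono : ∀ {s t : ℝ}, s ≤ t → C * γ s ≤ C * γ t := fun h =>
    mul_le_mul_of_nonneg_left (hγ.monotone h) hC
  by_cases hξ : ‖ξ‖ ≤ R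
  · by_cases hζ : ‖ζ‖ ≤ R
    · rcases lt_or_ge ‖ξ - ζ‖ d with h | h
      · have := huc ξ (by simpa using hξ) ζ (by simpa using hζ) (by rwa [dist_eq_norm])
        rw [dist_eq_norm] at this
        linarith
      · have h3 : 2 * (C * γ R) ≤ 2 * (C * γ R) / d * ‖ξ - ζ‖ := by
          rw [div_mul_eq_mul_div, le_div_iff₀ hd]
          have := hγ.nonneg R
          gcongr
        linarith [mono hξ, mono hζ]
    · push Not at hζ
      linarith [hlarge _ hζ.le, mono (hξ.trans hζ.le)]
  · push Not at hξ
    rcases le_total ‖ζ‖ ‖ξ‖ with h3 | h3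
    · linarith [hlarge _ hξ.le, mono h3]
    · linarith [hlarge _ (hξ.le.trans h3), mono h3]

namespace IsBoundedSupersolution

variable {Q : Set (SpaceTime n)} {M : ℝ} {v v₁ v₂ : SpaceTime n → ℝ}
  {Dv D₁ D₂ : SpaceTime n → Space n}

theorem aestronglyMeasurable (h : IsBoundedSupersolution A γ Q M v Dv) :
    AEStronglyMeasurable v (volume.restrict Q) :=
  h.weakGrad.locInt.aestronglyMeasurable

theorem locallyIntegrableOn_truncDeriv_mul_inner (h₁ : IsBoundedSupersolution A γ Q M v₁ D₁)
    (h₂ : IsBoundedSupersolution A γ Q M v₂ D₂) (hQ : IsOpen Q) (hγ : IsGrowthFunction γ P)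
    (hA : IsMonotoneField A γ C c) (hC : 0 ≤ C) {δ : ℝ} (hδ : 0 < δ) :
    LocallyIntegrableOn (fun z => truncDeriv δ (v₁ z - v₂ z)
      * inner ℝ (A (D₁ z) - A (D₂ z)) (D₁ z - D₂ z)) Q := by
  refine locallyIntegrableOn_of_norm_le hQ
    ((locallyIntegrableOn_pairEnergy h₁ h₂ (C := C)).smul (2 : ℝ)) ?_ fun z => ?_
  · refine ((continuous_truncDeriv hδ).comp_aestronglyMeasurable
      (h₁.aestronglyMeasurable.sub h₂.aestronglyMeasurable)).mul ?_
    exact ((hA.continuous.comp_aestronglyMeasurable h₁.aestronglyMeasurable_grad).sub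
      (hA.continuous.comp_aestronglyMeasurable h₂.aestronglyMeasurable_grad)).inner
      (h₁.aestronglyMeasurable_grad.sub h₂.aestronglyMeasurable_grad)
  · have h0 := pairEnergy_nonneg (A := A) hγ hC D₁ D₂ z
    have h1 := norm_flux_mul_norm_grad_le hγ hA hC D₁ D₂ z z
    rw [norm_mul, Real.norm_of_nonneg (truncDeriv_nonneg hδ _)]
    have h2 : ‖inner ℝ (A (D₁ z) - A (D₂ z)) (D₁ z - D₂ z)‖
        ≤ (‖A (D₁ z)‖ + ‖A (D₂ z)‖) * (‖D₁ z‖ + ‖D₂ z‖) :=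
      (norm_inner_le_norm _ _).trans (by gcongr <;> exact norm_sub_le _ _)
    calc _ ≤ 1 * ((‖A (D₁ z)‖ + ‖A (D₂ z)‖) * (‖D₁ z‖ + ‖D₂ z‖)) := by
          gcongr; exact truncDeriv_le_one hδ _
      _ ≤ 2 * pairEnergy A γ C D₁ D₂ z := by linarith
      _ ≤ _ := by simp [Real.norm_eq_abs, abs_of_nonneg h0]

/-- On the set where two bounded supersolutions are `δ`-close, the monotonicity expression of
their gradients has an integral of order `δ`. -/
theorem exists_integral_truncDeriv_mul_le (hγ : IsGrowthFunction γ P) (hP : 1 ≤ P)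
    (hA : IsMonotoneField A γ C c) (hC : 0 ≤ C) (hc : 0 < c) (hM : 0 ≤ M)
    {K : Set (SpaceTime n)} (hK : IsCompact K) (hQ : IsOpen Q) (hKQ : K ⊆ Q) :
    ∃ B : ℝ, 0 ≤ B ∧ ∀ (v₁ v₂ : SpaceTime n → ℝ) (D₁ D₂ : SpaceTime n → Space n) (δ : ℝ),
      IsBoundedSupersolution A γ Q M v₁ D₁ → IsBoundedSupersolution A γ Q M v₂ D₂ →
      0 < δ → δ ≤ 1 → ∫ z in K, truncDeriv δ (v₁ z - v₂ z)
        * inner ℝ (A (D₁ z) - A (D₂ z)) (D₁ z - D₂ z) ≤ B * δ := by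
  obtain ⟨θ, hθ, hθ0, hθ1, hθK⟩ := exists_isTestFunction_eq_one hK hQ hKQ
  obtain ⟨c₁, hc₁⟩ := hθ.continuous_timeDeriv.bounded_above_of_compact_support
    hθ.hasCompactSupport_timeDeriv
  obtain ⟨c₂, hc₂⟩ := hθ.continuous_spaceGrad.bounded_above_of_compact_support
    hθ.hasCompactSupport_spaceGrad
  have hc₁0 : 0 ≤ c₁ := (norm_nonneg _).trans (hc₁ 0)
  have hc₂0 : 0 ≤ c₂ := (norm_nonneg _).trans (hc₂ 0)
  set K' := tsupport θ with hK'def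
  have hK' : IsCompact K' := hθ.compact
  obtain ⟨B', hB'⟩ := exists_setIntegral_energy_le hγ hP hA hC hc hM hK' hQ hθ.support
  have hγ1 := hγ.nonneg (1 : ℝ)⁻¹
  -- `a₀` collects the time term and the constant parts of the two flux terms; `a₁` is the weight of
  -- the energies, which the Caccioppoli estimate bounds on the support of `θ`.
  set a₀ : ℝ := (1 + 4 * M) * c₁ + 4 * c₂ * (‖A 0‖ + C * γ 1⁻¹) with ha₀
  set a₁ : ℝ := 2 * c₂ * C with ha₁
  have ha₀0 : 0 ≤ a₀ := by positivity
  have ha₁0 : 0 ≤ a₁ := by positivity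
  refine ⟨max 0 (volume.real K' * a₀ + a₁ * (B' + B')), le_max_left _ _, ?_⟩
  intro v₁ v₂ D₁ D₂ δ h₁ h₂ hδ hδ1
  obtain ⟨hint, hnn⟩ := h₁.integral_comparisonIntegrand_nonneg h₂ hQ hγ hA hC hM (δ := δ)
    (contDiff_truncPrimitive hδ) (contDiff_trunc hδ) (continuous_truncDeriv hδ)
    (hasDerivAt_truncPrimitive hδ) (hasDerivAt_trunc hδ) (fun x _ => abs_trunc_le hδ x) hθ hθ0
  set I : SpaceTime n → ℝ := fun z => truncDeriv δ (v₁ z - v₂ z)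
    * inner ℝ (A (D₁ z) - A (D₂ z)) (D₁ z - D₂ z) with hI
  have hI0 : ∀ z, 0 ≤ I z := fun z =>
    mul_nonneg (truncDeriv_nonneg hδ _) (hA.inner_nonneg _ _)
  have hθI : Integrable fun z => θ z * I z :=
    integrable_smul_of_tsupport_subset
      (h₁.locallyIntegrableOn_truncDeriv_mul_inner h₂ hQ hγ hA hC hδ)
      hθ.smooth.continuous hθ.compact hθ.support
  have hE₁ : IntegrableOn (fun z => ‖D₁ z‖ * γ ‖D₁ z‖) K' :=
    h₁.energy.integrableOn_compact_subset hθ.support hK'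
  have hE₂ : IntegrableOn (fun z => ‖D₂ z‖ * γ ‖D₂ z‖) K' :=
    h₂.energy.integrableOn_compact_subset hθ.support hK'
  have hcst : IntegrableOn (fun _ : SpaceTime n => a₀) K' :=
    integrableOn_const hK'.measure_lt_top.ne
  set J : SpaceTime n → ℝ := fun z => a₀ + a₁ * (‖D₁ z‖ * γ ‖D₁ z‖ + ‖D₂ z‖ * γ ‖D₂ z‖) with hJ
  have hJi : IntegrableOn J K' := hcst.add ((hE₁.add hE₂).const_mul a₁)
  have hJi' : Integrable (K'.indicator J) := (integrable_indicator_iff hK'.measurableSet).2 hJi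
  -- Both `truncPrimitive δ` on bounded sets and `trunc δ` are `O(δ)`, so every term except the
  -- monotone one carries a factor `δ`.
  have hbd : ∀ᵐ z, comparisonIntegrand δ (truncPrimitive δ) (trunc δ) (truncDeriv δ) θ z
      (v₁ z) (v₂ z) (D₁ z) (D₂ z) (A (D₁ z)) (A (D₂ z))
      ≤ δ * K'.indicator J z - θ z * I z := by
    have hM₁ := h₁.bounded
    have hM₂ := h₂.bounded
    rw [ae_restrict_iff' hQ.measurableSet] at hM₁ hM₂
    filter_upwards [hM₁, hM₂] with z hz₁ hz₂
    by_cases hz : z ∈ K'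
    · rw [indicator_of_mem hz]
      have b₁ := hz₁ (hθ.support hz)
      have b₂ := hz₂ (hθ.support hz)
      have t1 : |truncPrimitive δ (v₁ z - v₂ z) - δ * (v₁ z + v₂ z)| ≤ δ * (1 + 4 * M) := by
        have w0 := truncPrimitive_nonneg hδ (v₁ z - v₂ z)
        have w1 := truncPrimitive_le hδ (v₁ z - v₂ z)
        have w2 : |v₁ z - v₂ z| ≤ 2 * M := (abs_sub _ _).trans (by linarith)
        have w3 : |v₁ z + v₂ z| ≤ 2 * M := (abs_add_le _ _).trans (by linarith)
        calc |truncPrimitive δ (v₁ z - v₂ z) - δ * (v₁ z + v₂ z)|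
            ≤ |truncPrimitive δ (v₁ z - v₂ z)| + |δ * (v₁ z + v₂ z)| := abs_sub _ _
          _ ≤ δ * (δ + |v₁ z - v₂ z|) + δ * |v₁ z + v₂ z| := by
              rw [abs_of_nonneg w0, abs_mul, abs_of_pos hδ]; gcongr
          _ ≤ δ * (1 + 2 * M) + δ * (2 * M) := by gcongr
          _ = _ := by ring
      have f1 : (truncPrimitive δ (v₁ z - v₂ z) - δ * (v₁ z + v₂ z)) * timeDeriv θ z
          ≤ δ * (1 + 4 * M) * c₁ := by
        refine (le_abs_self _).trans ?_
        rw [abs_mul]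
        gcongr
        exact hc₁ z
      have N₁ := hA.norm_le (D₁ z)
      have N₂ := hA.norm_le (D₂ z)
      have L₁ := mul_le_mul_of_nonneg_left (hγ.le_mul_add (norm_nonneg (D₁ z)) one_pos) hC
      have L₂ := mul_le_mul_of_nonneg_left (hγ.le_mul_add (norm_nonneg (D₂ z)) one_pos) hC
      have f2 : δ * inner ℝ (A (D₁ z) + A (D₂ z)) (spaceGrad θ z)
          ≤ δ * ((‖A (D₁ z)‖ + ‖A (D₂ z)‖) * c₂) := by
        gcongr
        exact (real_inner_le_norm _ _).trans (by gcongr; exacts [norm_add_le _ _, hc₂ z])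
      have f3 : -(trunc δ (v₁ z - v₂ z) * inner ℝ (A (D₁ z) - A (D₂ z)) (spaceGrad θ z))
          ≤ δ * ((‖A (D₁ z)‖ + ‖A (D₂ z)‖) * c₂) := by
        refine (neg_le_abs _).trans ?_
        rw [abs_mul]
        gcongr
        · exact abs_trunc_le hδ _
        · exact (abs_real_inner_le_norm _ _).trans (by gcongr; exacts [norm_sub_le _ _, hc₂ z])
      have f4 : (‖A (D₁ z)‖ + ‖A (D₂ z)‖) * c₂ ≤ (2 * (‖A 0‖ + C * γ 1⁻¹)
          + C * (‖D₁ z‖ * γ ‖D₁ z‖ + ‖D₂ z‖ * γ ‖D₂ z‖)) * c₂ := by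
        refine mul_le_mul_of_nonneg_right ?_ hc₂0
        linarith
      have f5 := mul_le_mul_of_nonneg_left f4 hδ.le
      simp only [comparisonIntegrand, hJ, hI, ha₀, ha₁]
      linarith
    · rw [comparisonIntegrand_eq_zero hθ hz, indicator_of_notMem hz,
        image_eq_zero_of_notMem_tsupport hz]
      simp
  have hmono := hnn.trans (integral_mono_ae hint ((hJi'.const_mul δ).sub hθI) hbd)
  have hrw : ∫ z, (δ * K'.indicator J z - θ z * I z) = δ * (∫ z in K', J z) - ∫ z, θ z * I z := by
    rw [integral_sub (hJi'.const_mul δ) hθI, integral_const_mul,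
      integral_indicator hK'.measurableSet]
  have hmono' : 0 ≤ δ * (∫ z in K', J z) - ∫ z, θ z * I z := hrw ▸ hmono
  have hJle : ∫ z in K', J z ≤ volume.real K' * a₀ + a₁ * (B' + B') := by
    have k₁ : IntegrableOn (fun z => ‖D₁ z‖ * γ ‖D₁ z‖ + ‖D₂ z‖ * γ ‖D₂ z‖) K' := hE₁.add hE₂
    simp only [hJ]
    rw [integral_add hcst (k₁.const_mul a₁), integral_const_mul, integral_add hE₁ hE₂,
      setIntegral_const, smul_eq_mul]
    have := hB' v₁ D₁ h₁
    have := hB' v₂ D₂ h₂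
    gcongr
  have hKI : ∫ z in K, I z ≤ ∫ z, θ z * I z := by
    refine le_trans (le_of_eq ?_) (setIntegral_le_integral hθI
      (Eventually.of_forall fun z => mul_nonneg (hθ0 z) (hI0 z)) (s := K))
    refine setIntegral_congr_fun hK.measurableSet fun z hz => ?_
    simp [hθK z hz]
  calc ∫ z in K, I z ≤ δ * ∫ z in K', J z := by linarith
    _ ≤ δ * max 0 (volume.real K' * a₀ + a₁ * (B' + B')) := by
        gcongr
        exact hJle.trans (le_max_right _ _)
    _ = _ := mul_comm _ _

end IsBoundedSupersolution

end Convergence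

/-! ### Strong local convergence of the gradients. -/

section CauchyLimit

theorem exists_tendsto_integral_norm_sub {α F : Type*} [MeasurableSpace α] {μ : Measure α}
    [NormedAddCommGroup F] [NormedSpace ℝ F] [CompleteSpace F] {f : ℕ → α → F}
    (hf : ∀ i, Integrable (f i) μ)
    (hc : ∀ ε > 0, ∃ N, ∀ j ≥ N, ∀ k ≥ N, ∫ x, ‖f j x - f k x‖ ∂μ < ε) :
    ∃ g, Integrable g μ ∧ Tendsto (fun j => ∫ x, ‖f j x - g x‖ ∂μ) atTop (𝓝 0) := by
  have hdist : ∀ j (g : α → F) (hg : Integrable g μ),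
      dist ((hf j).toL1 (f j)) (hg.toL1 g) = ∫ x, ‖f j x - g x‖ ∂μ := by
    intro j g hg
    rw [dist_eq_norm, ← Integrable.toL1_sub (f j) g (hf j) hg, L1.norm_of_fun_eq_integral_norm]
    rfl
  have hcs : CauchySeq fun j => (hf j).toL1 (f j) := by
    rw [Metric.cauchySeq_iff]
    intro ε hε
    obtain ⟨N, hN⟩ := hc ε hε
    exact ⟨N, fun j hj k hk => by rw [hdist j (f k) (hf k)]; exact hN j hj k hk⟩
  obtain ⟨g, hg⟩ := cauchySeq_tendsto_of_complete hcs
  refine ⟨g, L1.integrable_coeFn g, ?_⟩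
  rw [tendsto_iff_dist_tendsto_zero] at hg
  refine hg.congr fun j => ?_
  rw [← hdist j g (L1.integrable_coeFn g), Integrable.toL1_coeFn]

variable {n : ℕ} {γ : ℝ → ℝ} {P : ℕ} {A : Space n → Space n} {C c : ℝ}
  {Q : Set (SpaceTime n)} {M : ℝ} {v : ℕ → SpaceTime n → ℝ} {u : SpaceTime n → ℝ}
  {D : ℕ → SpaceTime n → Space n}

theorem ae_abs_le_of_tendsto (hv : ∀ i, IsBoundedSupersolution A γ Q M (v i) (D i))
    (hlim : ∀ᵐ z ∂volume.restrict Q, Tendsto (fun i => v i z) atTop (𝓝 (u z))) :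
    ∀ᵐ z ∂volume.restrict Q, |u z| ≤ M := by
  have h := ae_all_iff.2 fun i => (hv i).bounded
  filter_upwards [h, hlim] with z h1 h2
  exact le_of_tendsto' h2.abs h1

theorem aestronglyMeasurable_limit (hv : ∀ i, IsBoundedSupersolution A γ Q M (v i) (D i))
    (hlim : ∀ᵐ z ∂volume.restrict Q, Tendsto (fun i => v i z) atTop (𝓝 (u z))) :
    AEStronglyMeasurable u (volume.restrict Q) :=
  aestronglyMeasurable_of_tendsto_ae atTop (fun i => (hv i).aestronglyMeasurable) hlim

theorem integrableOn_limit (hv : ∀ i, IsBoundedSupersolution A γ Q M (v i) (D i))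
    (hlim : ∀ᵐ z ∂volume.restrict Q, Tendsto (fun i => v i z) atTop (𝓝 (u z)))
    {K : Set (SpaceTime n)} (hK : volume K ≠ ⊤) (hKQ : K ⊆ Q) : IntegrableOn u K := by
  refine Integrable.mono' (g := fun _ => M) (integrableOn_const hK)
    ((aestronglyMeasurable_limit hv hlim).mono_measure (Measure.restrict_mono hKQ le_rfl)) ?_
  exact ae_restrict_of_ae_restrict_of_subset hKQ (ae_abs_le_of_tendsto hv hlim)

theorem tendsto_setIntegral_abs_sub (hv : ∀ i, IsBoundedSupersolution A γ Q M (v i) (D i))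
    (hlim : ∀ᵐ z ∂volume.restrict Q, Tendsto (fun i => v i z) atTop (𝓝 (u z)))
    {K : Set (SpaceTime n)} (hK : IsCompact K) (hKQ : K ⊆ Q) :
    Tendsto (fun i => ∫ z in K, |v i z - u z|) atTop (𝓝 0) := by
  have hsub : volume.restrict K ≤ volume.restrict Q := Measure.restrict_mono hKQ le_rfl
  have hu := (aestronglyMeasurable_limit hv hlim).mono_measure hsub
  have key := tendsto_integral_of_dominated_convergence (μ := volume.restrict K)
    (F := fun i z => |v i z - u z|) (f := fun _ => 0) (fun _ => 2 * M)
    (fun i => (((hv i).aestronglyMeasurable.mono_measure hsub).sub hu).norm)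
    (integrableOn_const hK.measure_lt_top.ne) ?_ ?_
  · simpa using key
  · intro i
    filter_upwards [ae_mono hsub (hv i).bounded, ae_mono hsub (ae_abs_le_of_tendsto hv hlim)]
      with z h1 h2
    rw [Real.norm_eq_abs, abs_abs]
    exact (abs_sub _ _).trans (by linarith)
  · filter_upwards [ae_mono hsub hlim] with z hz
    have := (hz.sub_const (u z)).abs
    simpa using this

/-- The gradients form a Cauchy sequence in `L¹` of every compact subset. -/
theorem exists_forall_setIntegral_norm_grad_sub_lt (hγ : IsGrowthFunction γ P) (hP : 1 ≤ P)
    (hA : IsMonotoneField A γ C c) (hC : 0 ≤ C) (hc : 0 < c) (hM : 0 ≤ M) (hQ : IsOpen Q)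
    (hv : ∀ i, IsBoundedSupersolution A γ Q M (v i) (D i))
    (hlim : ∀ᵐ z ∂volume.restrict Q, Tendsto (fun i => v i z) atTop (𝓝 (u z)))
    {K : Set (SpaceTime n)} (hK : IsCompact K) (hKQ : K ⊆ Q) (ε : ℝ) (hε : 0 < ε) :
    ∃ N, ∀ j ≥ N, ∀ k ≥ N, ∫ z in K, ‖D j z - D k z‖ < ε := by
  obtain ⟨B₁, hB₁⟩ := exists_setIntegral_energy_le hγ hP hA hC hc hM hK hQ hKQ
  obtain ⟨B₂, hB₂0, hB₂⟩ :=
    IsBoundedSupersolution.exists_integral_truncDeriv_mul_le hγ hP hA hC hc hM hK hQ hKQ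
  have hB₁0 : 0 ≤ B₁ := le_trans
    (integral_nonneg fun z => mul_nonneg (norm_nonneg _) (hγ.nonneg _)) (hB₁ _ _ (hv 0))
  set V := volume.real K with hV
  have hV0 : 0 ≤ V := measureReal_nonneg
  -- The order of choice is essential: `η` against the energy bound, then `δ` against `Cη` and `B₂`,
  -- finally `N` depending on `δ`. Each of the three contributions is at most `ε / 4`.
  set η : ℝ := ε / (4 * (V + 2 * B₁ + 1)) with hη
  have hη0 : 0 < η := by positivity
  have hηle : η * (V + 2 * B₁) ≤ ε / 4 := by
    rw [hη, div_mul_eq_mul_div, div_le_div_iff₀ (by positivity) (by norm_num)]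
    nlinarith
  obtain ⟨Cη, hCη0, hCη⟩ := hA.exists_norm_sub_le hγ hη0
  obtain ⟨R, hR0, hR⟩ := hγ.exists_le_mul_add hη0
  set δ : ℝ := min 1 (ε / (4 * (8 * Cη * B₂ + 1))) with hδdef
  have hδ0 : 0 < δ := lt_min one_pos (by positivity)
  have hδ1 : δ ≤ 1 := min_le_left _ _
  have hδle : 8 * Cη * B₂ * δ ≤ ε / 4 := by
    have h1 : δ ≤ ε / (4 * (8 * Cη * B₂ + 1)) := min_le_right _ _
    rw [le_div_iff₀ (by positivity)] at h1
    nlinarith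
  have htend := tendsto_setIntegral_abs_sub hv hlim hK hKQ
  have hτ : 0 < ε * δ / (16 * (R + 1)) := by positivity
  obtain ⟨N, hN⟩ := (htend.eventually_lt_const hτ).exists_forall_of_atTop
  refine ⟨N, fun j hj k hk => ?_⟩
  have iE : ∀ i, IntegrableOn (fun z => ‖D i z‖ * γ ‖D i z‖) K := fun i =>
    (hv i).energy.integrableOn_compact_subset hKQ hK
  have iD : ∀ i, IntegrableOn (D i) K := fun i =>
    (hv i).weakGrad.locInt_grad.integrableOn_compact_subset hKQ hK
  have iv : ∀ i, IntegrableOn (v i) K := fun i =>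
    (hv i).weakGrad.locInt.integrableOn_compact_subset hKQ hK
  have iu := integrableOn_limit hv hlim hK.measure_lt_top.ne hKQ
  have iI : IntegrableOn (fun z => truncDeriv δ (v j z - v k z)
      * inner ℝ (A (D j z) - A (D k z)) (D j z - D k z)) K :=
    ((hv j).locallyIntegrableOn_truncDeriv_mul_inner (hv k) hQ hγ hA hC
      hδ0).integrableOn_compact_subset hKQ hK
  have iw : IntegrableOn (fun z => |v j z - v k z|) K := ((iv j).sub (iv k)).norm
  have i1 : IntegrableOn (fun _ : SpaceTime n => (1 : ℝ)) K :=
    integrableOn_const hK.measure_lt_top.ne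
  have iS : IntegrableOn (fun z => 1 + ‖D j z‖ * γ ‖D j z‖ + ‖D k z‖ * γ ‖D k z‖) K :=
    (i1.add (iE j)).add (iE k)
  have i1j : IntegrableOn (fun z => 1 + ‖D j z‖ * γ ‖D j z‖) K := i1.add (iE j)
  have iT : IntegrableOn (fun z => η * (1 + ‖D j z‖ * γ ‖D j z‖ + ‖D k z‖ * γ ‖D k z‖)
      + 8 * Cη * (truncDeriv δ (v j z - v k z)
        * inner ℝ (A (D j z) - A (D k z)) (D j z - D k z))) K :=
    (iS.const_mul _).add (iI.const_mul _)
  -- Where `|v j - v k| ≤ δ`, quantitative monotonicity applies and `8 * truncDeriv` is at least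
  -- `1`. Elsewhere the norms are bounded by energy plus `R`, and `|v j - v k| / δ ≥ 1` is a
  -- pointwise Chebyshev factor.
  have hpt : ∀ z, ‖D j z - D k z‖ ≤ η * (1 + ‖D j z‖ * γ ‖D j z‖ + ‖D k z‖ * γ ‖D k z‖)
      + 8 * Cη * (truncDeriv δ (v j z - v k z)
        * inner ℝ (A (D j z) - A (D k z)) (D j z - D k z)) + 2 * R / δ * |v j z - v k z| := by
    intro z
    have hin := hA.inner_nonneg (D j z) (D k z)
    have ht0 := truncDeriv_nonneg hδ0 (v j z - v k z)
    rcases le_or_gt |v j z - v k z| δ with h | h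
    · have h1 := hCη (D j z) (D k z)
      have h2 := one_le_truncDeriv hδ0 h
      have h3 := mul_le_mul_of_nonneg_right h2 (mul_nonneg hCη0 hin)
      have h4 : 0 ≤ 2 * R / δ * |v j z - v k z| := by positivity
      linarith
    · have h1 := hR ‖D j z‖ (norm_nonneg _)
      have h2 := hR ‖D k z‖ (norm_nonneg _)
      have h3 := norm_sub_le (D j z) (D k z)
      have h4 : 2 * R ≤ 2 * R / δ * |v j z - v k z| := by
        rw [div_mul_eq_mul_div, le_div_iff₀ hδ0]
        gcongr
      have h5 : 0 ≤ 8 * Cη * (truncDeriv δ (v j z - v k z)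
        * inner ℝ (A (D j z) - A (D k z)) (D j z - D k z)) := by positivity
      linarith
  have hle := setIntegral_mono ((iD j).sub (iD k)).norm (iT.add (iw.const_mul (2 * R / δ))) hpt
  have hle' : ∫ z in K, ‖D j z - D k z‖
      ≤ η * (V + (∫ z in K, ‖D j z‖ * γ ‖D j z‖) + ∫ z in K, ‖D k z‖ * γ ‖D k z‖)
        + 8 * Cη * (∫ z in K, truncDeriv δ (v j z - v k z)
          * inner ℝ (A (D j z) - A (D k z)) (D j z - D k z))
        + 2 * R / δ * ∫ z in K, |v j z - v k z| := by
    refine hle.trans (le_of_eq ?_)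
    simp only [Pi.add_apply]
    rw [integral_add iT (iw.const_mul _), integral_add (iS.const_mul _) (iI.const_mul _),
      integral_const_mul, integral_const_mul, integral_const_mul, integral_add i1j (iE k),
      integral_add i1 (iE j), setIntegral_const]
    simp [hV]
  have e1 := hB₁ _ _ (hv j)
  have e2 := hB₁ _ _ (hv k)
  have e3 := hB₂ _ _ _ _ δ (hv j) (hv k) hδ0 hδ1
  have e4 : ∫ z in K, |v j z - v k z| ≤ ε * δ / (8 * (R + 1)) := by
    have iju : IntegrableOn (fun z => |v j z - u z|) K := ((iv j).sub iu).norm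
    have iku : IntegrableOn (fun z => |v k z - u z|) K := ((iv k).sub iu).norm
    have h1 : ∫ z in K, |v j z - v k z| ≤ ∫ z in K, (|v j z - u z| + |v k z - u z|) :=
      setIntegral_mono iw (iju.add iku) fun z => by
        have := abs_sub_le (v j z) (u z) (v k z)
        rwa [abs_sub_comm (u z)] at this
    rw [integral_add iju iku] at h1
    have h2 := hN j hj
    have h3 := hN k hk
    have h4 : ε * δ / (8 * (R + 1)) = ε * δ / (16 * (R + 1)) + ε * δ / (16 * (R + 1)) := by
      field_simp; norm_num
    linarith
  have s1 : η * (V + (∫ z in K, ‖D j z‖ * γ ‖D j z‖) + ∫ z in K, ‖D k z‖ * γ ‖D k z‖) ≤ ε / 4 :=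
    le_trans (mul_le_mul_of_nonneg_left (by linarith) hη0.le) hηle
  have s2 : 8 * Cη * (∫ z in K, truncDeriv δ (v j z - v k z)
          * inner ℝ (A (D j z) - A (D k z)) (D j z - D k z)) ≤ ε / 4 := by
    refine le_trans ?_ hδle
    rw [mul_assoc (8 * Cη)]
    gcongr
  have s3 : 2 * R / δ * ∫ z in K, |v j z - v k z| ≤ ε / 4 := by
    calc 2 * R / δ * ∫ z in K, |v j z - v k z| ≤ 2 * R / δ * (ε * δ / (8 * (R + 1))) := by gcongr
      _ = ε / 4 * (R / (R + 1)) := by field_simp; ring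
      _ ≤ ε / 4 * 1 := by
          gcongr
          rw [div_le_one (by positivity)]
          linarith
      _ = _ := mul_one _
  linarith

/-- The gradients converge in `L¹` of every compact subset to a single vector field. -/
theorem exists_limit_grad (hγ : IsGrowthFunction γ P) (hP : 1 ≤ P)
    (hA : IsMonotoneField A γ C c) (hC : 0 ≤ C) (hc : 0 < c) (hM : 0 ≤ M) (hQ : IsOpen Q)
    (hv : ∀ i, IsBoundedSupersolution A γ Q M (v i) (D i))
    (hlim : ∀ᵐ z ∂volume.restrict Q, Tendsto (fun i => v i z) atTop (𝓝 (u z))) :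
    ∃ Du : SpaceTime n → Space n, ∀ K : Set (SpaceTime n), IsCompact K → K ⊆ Q →
      IntegrableOn Du K ∧ Tendsto (fun j => ∫ z in K, ‖D j z - Du z‖) atTop (𝓝 0) := by
  have iD : ∀ {K : Set (SpaceTime n)}, IsCompact K → K ⊆ Q → ∀ i, IntegrableOn (D i) K :=
    fun hK hKQ i => (hv i).weakGrad.locInt_grad.integrableOn_compact_subset hKQ hK
  have : LocallyCompactSpace Q := hQ.locallyCompactSpace
  obtain ⟨X⟩ : Nonempty (CompactExhaustion Q) := inferInstance
  set Km : ℕ → Set (SpaceTime n) := fun m => Subtype.val '' (X m) with hKm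
  have hKmc : ∀ m, IsCompact (Km m) := fun m => (X.isCompact m).image continuous_subtype_val
  have hKmQ : ∀ m, Km m ⊆ Q := fun m => by
    rintro _ ⟨z, -, rfl⟩; exact z.2
  have hKmono : ∀ {m m'}, m ≤ m' → Km m ⊆ Km m' := fun h => image_mono (X.subset h)
  have hex : ∀ m, ∃ f, IntegrableOn f (Km m) ∧
      Tendsto (fun j => ∫ z in Km m, ‖D j z - f z‖) atTop (𝓝 0) := fun m =>
    exists_tendsto_integral_norm_sub (iD (hKmc m) (hKmQ m))
      (exists_forall_setIntegral_norm_grad_sub_lt hγ hP hA hC hc hM hQ hv hlim (hKmc m) (hKmQ m))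
  choose f hfi hft using hex
  have hsub : ∀ {K K' : Set (SpaceTime n)} {g : SpaceTime n → Space n}, K ⊆ K' →
      IsCompact K' → K' ⊆ Q → IntegrableOn g K' →
      Tendsto (fun j => ∫ z in K', ‖D j z - g z‖) atTop (𝓝 0) →
      Tendsto (fun j => ∫ z in K, ‖D j z - g z‖) atTop (𝓝 0) := by
    intro K K' g hKK' hK' hKQ' hg ht
    refine squeeze_zero (fun j => integral_nonneg fun z => norm_nonneg _) (fun j => ?_) ht
    exact setIntegral_mono_set ((iD hK' hKQ' j).sub hg).norm
      (Eventually.of_forall fun z => norm_nonneg _) (Eventually.of_forall hKK')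
  have hae : ∀ m m', m ≤ m' → ∀ᵐ z, z ∈ Km m → f m z = f m' z := by
    intro m m' hmm
    rw [← ae_restrict_iff' (hKmc m).measurableSet]
    have hfi' : IntegrableOn (f m') (Km m) := (hfi m').mono_set (hKmono hmm)
    have ht' := hsub (hKmono hmm) (hKmc m') (hKmQ m') (hfi m') (hft m')
    have hint : Integrable (fun z => ‖f m z - f m' z‖) (volume.restrict (Km m)) :=
      ((hfi m).sub hfi').norm
    have hzero : ∫ z in Km m, ‖f m z - f m' z‖ ≤ 0 := by
      have hs := (hft m).add ht'
      rw [add_zero] at hs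
      refine ge_of_tendsto' hs fun j => ?_
      have k₁ := ((iD (hKmc m) (hKmQ m) j).sub (hfi m)).norm
      have k₂ := ((iD (hKmc m) (hKmQ m) j).sub hfi').norm
      refine le_trans (integral_mono hint (k₁.add k₂) fun z => ?_) (integral_add k₁ k₂).le
      have := norm_sub_le (D j z - f m' z) (D j z - f m z)
      rw [sub_sub_sub_cancel_left] at this
      simp only [Pi.add_apply, Pi.sub_apply]
      linarith
    have h0 := (integral_eq_zero_iff_of_nonneg (fun z => norm_nonneg _) hint).1
      (le_antisymm hzero (integral_nonneg fun z => norm_nonneg _))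
    filter_upwards [h0] with z hz
    exact sub_eq_zero.1 (norm_eq_zero.1 hz)
  have hae' : ∀ᵐ z, ∀ m m', m ≤ m' → z ∈ Km m → f m z = f m' z := by
    rw [ae_all_iff]; intro m
    rw [ae_all_iff]; intro m'
    by_cases h : m ≤ m'
    · filter_upwards [hae m m' h] with z hz _ using hz
    · exact Eventually.of_forall fun z h' => absurd h' h
  classical
  -- The limits on the members of the exhaustion agree almost everywhere on overlaps; they are glued
  -- by taking, at each point, the first member that contains it.
  set Du : SpaceTime n → Space n := fun z => if h : z ∈ Q then f (X.find ⟨z, h⟩) z else 0 with hDu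
  have hDum : ∀ m, ∀ᵐ z, z ∈ Km m → f m z = Du z := by
    intro m
    filter_upwards [hae'] with z hz hzm
    have hzQ := hKmQ m hzm
    obtain ⟨y, hy, rfl⟩ := hzm
    have hle : X.find y ≤ m := X.mem_iff_find_le.1 hy
    simp only [hDu, hzQ, dif_pos]
    exact (hz _ m hle ⟨y, X.mem_find y, rfl⟩).symm
  refine ⟨Du, fun K hK hKQ => ?_⟩
  obtain ⟨m, hm⟩ := X.exists_superset_of_isCompact
    (show IsCompact (Subtype.val ⁻¹' K : Set Q) by
      rwa [Subtype.isCompact_iff, Subtype.image_preimage_coe, inter_eq_right.2 hKQ])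
  have hKm' : K ⊆ Km m := fun z hz => ⟨⟨z, hKQ hz⟩, hm hz, rfl⟩
  have hcongr : f m =ᵐ[volume.restrict K] Du := by
    rw [Filter.EventuallyEq, ae_restrict_iff' hK.measurableSet]
    filter_upwards [hDum m] with z hz hzK using hz (hKm' hzK)
  refine ⟨((hfi m).mono_set hKm').congr hcongr, ?_⟩
  refine (hsub hKm' (hKmc m) (hKmQ m) (hfi m) (hft m)).congr fun j => ?_
  apply integral_congr_ae
  filter_upwards [hcongr] with z hz
  rw [hz]

end CauchyLimit

/-! ### Passage to the limit in energy, flux and weak inequality. -/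

section LimitPassage

/-- Fatou's lemma along a sequence that converges in `L¹`. -/
theorem lintegral_comp_le_of_tendsto_integral_norm_sub {α F : Type*} [MeasurableSpace α]
    {μ : Measure α} [NormedAddCommGroup F] {f : ℕ → α → F} {f₀ : α → F}
    (hf : ∀ i, Integrable (f i) μ) (hf₀ : Integrable f₀ μ)
    (h : Tendsto (fun i => ∫ x, ‖f i x - f₀ x‖ ∂μ) atTop (𝓝 0)) {e : F → ENNReal}
    (he : Continuous e) {b : ENNReal} (hb : ∀ i, ∫⁻ x, e (f i x) ∂μ ≤ b) :
    ∫⁻ x, e (f₀ x) ∂μ ≤ b := by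
  have h1 : Tendsto (fun i => eLpNorm (f i - f₀) 1 μ) atTop (𝓝 0) := by
    have := (ENNReal.continuous_ofReal.tendsto 0).comp h
    rw [ENNReal.ofReal_zero] at this
    refine this.congr fun i => ?_
    rw [eLpNorm_one_eq_lintegral_enorm, Function.comp_apply]
    exact ofReal_integral_norm_eq_lintegral_enorm ((hf i).sub hf₀)
  -- Convergence in measure provides an almost everywhere convergent subsequence, which is enough
  -- because `b` bounds every member.
  have h2 : TendstoInMeasure μ f atTop f₀ :=
    tendstoInMeasure_of_tendsto_eLpNorm one_ne_zero (fun i => (hf i).aestronglyMeasurable)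
      hf₀.aestronglyMeasurable h1
  obtain ⟨ns, -, hns⟩ := h2.exists_seq_tendsto_ae
  calc ∫⁻ x, e (f₀ x) ∂μ = ∫⁻ x, liminf (fun k => e (f (ns k) x)) atTop ∂μ := by
        refine lintegral_congr_ae ?_
        filter_upwards [hns] with x hx
        exact ((he.tendsto _).comp hx).liminf_eq.symm
    _ ≤ liminf (fun k => ∫⁻ x, e (f (ns k) x) ∂μ) atTop :=
        lintegral_liminf_le' fun k =>
          (he.comp_aestronglyMeasurable (hf (ns k)).aestronglyMeasurable).aemeasurable
    _ ≤ b := liminf_le_of_le (by isBoundedDefault) fun a ha =>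
        let ⟨k, hk⟩ := ha.exists; hk.trans (hb _)

variable {n : ℕ} {γ : ℝ → ℝ} {P : ℕ} {A : Space n → Space n} {C c : ℝ}
  {Q : Set (SpaceTime n)} {M : ℝ} {v : ℕ → SpaceTime n → ℝ} {u : SpaceTime n → ℝ}
  {D : ℕ → SpaceTime n → Space n} {Du : SpaceTime n → Space n}

/-- Convergence in `L¹(K)` suffices to pass to the limit in a pairing with a continuous function
that vanishes outside `K`. -/
theorem tendsto_setIntegral_bilinear {E F H : Type*} [NormedAddCommGroup E] [NormedSpace ℝ E]
    [NormedAddCommGroup F] [NormedSpace ℝ F] [NormedAddCommGroup H] [NormedSpace ℝ H]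
    [SecondCountableTopologyEither (SpaceTime n) E]
    (B : F →L[ℝ] E →L[ℝ] H) {K : Set (SpaceTime n)} (hK : IsCompact K) (hQ : MeasurableSet Q)
    (hKQ : K ⊆ Q) {f : ℕ → SpaceTime n → F} {f₀ : SpaceTime n → F}
    (hf : ∀ i, IntegrableOn (f i) K) (hf₀ : IntegrableOn f₀ K)
    (h : Tendsto (fun i => ∫ z in K, ‖f i z - f₀ z‖) atTop (𝓝 0)) {ψ : SpaceTime n → E}
    (hψ : Continuous ψ) (hψK : ∀ z ∉ K, ψ z = 0) :
    Tendsto (fun i => ∫ z in Q, B (f i z) (ψ z)) atTop (𝓝 (∫ z in Q, B (f₀ z) (ψ z))) := by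
  obtain ⟨κ, hκ⟩ := hψ.bounded_above_of_compact_support (HasCompactSupport.intro hK hψK)
  have hκ0 : 0 ≤ κ := (norm_nonneg _).trans (hκ 0)
  have hle : ∀ (w : F) (z : SpaceTime n), ‖B w (ψ z)‖ ≤ ‖B‖ * κ * ‖w‖ := fun w z =>
    calc ‖B w (ψ z)‖ ≤ ‖B‖ * ‖w‖ * ‖ψ z‖ := B.le_opNorm₂ w (ψ z)
      _ ≤ ‖B‖ * ‖w‖ * κ := by gcongr; exact hκ z
      _ = _ := by ring
  have hint : ∀ {w : SpaceTime n → F}, IntegrableOn w K →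
      IntegrableOn (fun z => B (w z) (ψ z)) K := fun hw =>
    Integrable.mono' (hw.norm.const_mul (‖B‖ * κ))
      (B.aestronglyMeasurable_comp₂ hw.aestronglyMeasurable hψ.aestronglyMeasurable)
      (Eventually.of_forall fun z => hle _ z)
  have hres : ∀ w : SpaceTime n → F, ∫ z in Q, B (w z) (ψ z) = ∫ z in K, B (w z) (ψ z) := fun w =>
    setIntegral_eq_of_subset_of_forall_sdiff_eq_zero hQ hKQ fun z hz => by
      rw [hψK z hz.2, map_zero]
  simp only [hres]
  rw [tendsto_iff_norm_sub_tendsto_zero]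
  have h0 : Tendsto (fun i => ‖B‖ * κ * ∫ z in K, ‖f i z - f₀ z‖) atTop (𝓝 0) := by
    simpa using h.const_mul (‖B‖ * κ)
  refine squeeze_zero (fun i => norm_nonneg _) (fun i => ?_) h0
  rw [← integral_sub (hint (hf i)) (hint hf₀), ← integral_const_mul]
  refine norm_integral_le_of_norm_le (((hf i).sub hf₀).norm.const_mul _)
    (Eventually.of_forall fun z => ?_)
  rw [← sub_apply, ← map_sub]
  exact hle _ z

/-- Energy bounds survive the convergence of gradients in `L¹`. -/
theorem integrableOn_energy_limit (hγ : IsGrowthFunction γ P) {K : Set (SpaceTime n)}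
    (hD : ∀ i, IntegrableOn (D i) K) (hDu : IntegrableOn Du K)
    (h : Tendsto (fun i => ∫ z in K, ‖D i z - Du z‖) atTop (𝓝 0))
    (hE : ∀ i, IntegrableOn (fun z => ‖D i z‖ * γ ‖D i z‖) K) {B : ℝ}
    (hB : ∀ i, ∫ z in K, ‖D i z‖ * γ ‖D i z‖ ≤ B) :
    IntegrableOn (fun z => ‖Du z‖ * γ ‖Du z‖) K := by
  have he : Continuous fun ξ : Space n => ‖ξ‖ * γ ‖ξ‖ := hγ.continuous_mul.comp continuous_norm
  have h0 : ∀ ξ : Space n, 0 ≤ ‖ξ‖ * γ ‖ξ‖ := fun ξ => mul_nonneg (norm_nonneg _) (hγ.nonneg _)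
  have key := lintegral_comp_le_of_tendsto_integral_norm_sub hD hDu h
    (e := fun ξ => ENNReal.ofReal (‖ξ‖ * γ ‖ξ‖)) (ENNReal.continuous_ofReal.comp he)
    (b := ENNReal.ofReal B) fun i => by
      rw [← ofReal_integral_eq_lintegral_ofReal (hE i) (Eventually.of_forall fun z => h0 _)]
      exact ENNReal.ofReal_le_ofReal (hB i)
  refine ⟨he.comp_aestronglyMeasurable hDu.aestronglyMeasurable, ?_⟩
  rw [hasFiniteIntegral_iff_ofReal (Eventually.of_forall fun z => h0 _)]
  exact key.trans_lt ENNReal.ofReal_lt_top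

/-- The fluxes converge in `L¹` when the gradients do and have bounded energies. -/
theorem tendsto_setIntegral_norm_flux_sub (hγ : IsGrowthFunction γ P)
    (hA : IsMonotoneField A γ C c) (hC : 0 ≤ C) {K : Set (SpaceTime n)} (hK : IsCompact K)
    (hD : ∀ i, IntegrableOn (D i) K) (hDu : IntegrableOn Du K)
    (h : Tendsto (fun i => ∫ z in K, ‖D i z - Du z‖) atTop (𝓝 0))
    (hE : ∀ i, IntegrableOn (fun z => ‖D i z‖ * γ ‖D i z‖) K) {B : ℝ}
    (hB : ∀ i, ∫ z in K, ‖D i z‖ * γ ‖D i z‖ ≤ B) :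
    Tendsto (fun i => ∫ z in K, ‖A (D i z) - A (Du z)‖) atTop (𝓝 0) := by
  have hEu := integrableOn_energy_limit hγ hD hDu h hE hB
  set S : ℝ := volume.real K + B + ∫ z in K, ‖Du z‖ * γ ‖Du z‖ with hS
  have h0 : ∀ ξ : Space n, 0 ≤ ‖ξ‖ * γ ‖ξ‖ := fun ξ => mul_nonneg (norm_nonneg _) (hγ.nonneg _)
  have hS0 : 0 ≤ S := by
    have h1 : 0 ≤ B := (integral_nonneg fun z => h0 _).trans (hB 0)
    have h2 : 0 ≤ ∫ z in K, ‖Du z‖ * γ ‖Du z‖ := integral_nonneg fun z => h0 _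
    positivity
  rw [Metric.tendsto_atTop]
  intro ε hε
  -- This pointwise bound takes the place of Vitali's theorem: the part with the energies is at most
  -- `ε / 2` uniformly in `i`, the rest is a multiple of the gradient difference.
  obtain ⟨R, hR0, hR⟩ := hA.exists_norm_sub_map_le hC hγ (η := ε / (2 * (S + 1))) (by positivity)
  obtain ⟨N, hN⟩ := Metric.tendsto_atTop.1 h (ε / (2 * (R + 1))) (by positivity)
  refine ⟨N, fun i hi => ?_⟩
  have hNi := hN i hi
  rw [Real.dist_eq, sub_zero, abs_of_nonneg (integral_nonneg fun z => norm_nonneg _)] at hNi ⊢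
  have i1 : IntegrableOn (fun _ : SpaceTime n => (1 : ℝ)) K :=
    integrableOn_const hK.measure_lt_top.ne
  have i2 : IntegrableOn (fun z => 1 + ‖D i z‖ * γ ‖D i z‖) K := i1.add (hE i)
  have i3 : IntegrableOn (fun z => 1 + ‖D i z‖ * γ ‖D i z‖ + ‖Du z‖ * γ ‖Du z‖) K := i2.add hEu
  have i4 : IntegrableOn (fun z => ‖D i z - Du z‖) K := ((hD i).sub hDu).norm
  have hle : ∫ z in K, ‖A (D i z) - A (Du z)‖ ≤ ∫ z in K, (ε / (2 * (S + 1)) *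
      (1 + ‖D i z‖ * γ ‖D i z‖ + ‖Du z‖ * γ ‖Du z‖) + R * ‖D i z - Du z‖) :=
    integral_mono_of_nonneg (Eventually.of_forall fun z => norm_nonneg _)
      ((i3.const_mul _).add (i4.const_mul _)) (Eventually.of_forall fun z => hR _ _)
  rw [integral_add (i3.const_mul _) (i4.const_mul _), integral_const_mul, integral_const_mul,
    integral_add i2 hEu, integral_add i1 (hE i)] at hle
  have h1 : ∫ _ in K, (1 : ℝ) = volume.real K := by simp
  rw [h1] at hle
  have s1 : ε / (2 * (S + 1)) * (volume.real K + (∫ z in K, ‖D i z‖ * γ ‖D i z‖)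
      + ∫ z in K, ‖Du z‖ * γ ‖Du z‖) ≤ ε / 2 := by
    calc _ ≤ ε / (2 * (S + 1)) * (S + 1) :=
          mul_le_mul_of_nonneg_left (by linarith [hB i]) (by positivity)
      _ = ε / 2 := by field_simp
  have s2 : R * ∫ z in K, ‖D i z - Du z‖ < ε / 2 := by
    calc R * ∫ z in K, ‖D i z - Du z‖ ≤ (R + 1) * ∫ z in K, ‖D i z - Du z‖ :=
          mul_le_mul_of_nonneg_right (by linarith) (integral_nonneg fun z => norm_nonneg _)
      _ < (R + 1) * (ε / (2 * (R + 1))) := mul_lt_mul_of_pos_left hNi (by positivity)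
      _ = ε / 2 := by field_simp
  linarith

/-- A pointwise limit of uniformly bounded supersolutions is a bounded supersolution. -/
theorem exists_isBoundedSupersolution_of_tendsto (hγ : IsGrowthFunction γ P) (hP : 1 ≤ P)
    (hA : IsMonotoneField A γ C c) (hC : 0 ≤ C) (hc : 0 < c) (hM : 0 ≤ M) (hQ : IsOpen Q)
    (hv : ∀ i, IsBoundedSupersolution A γ Q M (v i) (D i))
    (hlim : ∀ᵐ z ∂volume.restrict Q, Tendsto (fun i => v i z) atTop (𝓝 (u z))) :
    ∃ Du, IsBoundedSupersolution A γ Q M u Du := by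
  obtain ⟨Du, hDu⟩ := exists_limit_grad hγ hP hA hC hc hM hQ hv hlim
  have iv : ∀ {K : Set (SpaceTime n)}, IsCompact K → K ⊆ Q → ∀ i, IntegrableOn (v i) K :=
    fun hK hKQ i => (hv i).weakGrad.locInt.integrableOn_compact_subset hKQ hK
  have iu : ∀ {K : Set (SpaceTime n)}, IsCompact K → K ⊆ Q → IntegrableOn u K :=
    fun hK hKQ => integrableOn_limit hv hlim hK.measure_lt_top.ne hKQ
  have iD : ∀ {K : Set (SpaceTime n)}, IsCompact K → K ⊆ Q → ∀ i, IntegrableOn (D i) K :=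
    fun hK hKQ i => (hv i).weakGrad.locInt_grad.integrableOn_compact_subset hKQ hK
  have iE : ∀ {K : Set (SpaceTime n)}, IsCompact K → K ⊆ Q → ∀ i,
      IntegrableOn (fun z => ‖D i z‖ * γ ‖D i z‖) K :=
    fun hK hKQ i => (hv i).energy.integrableOn_compact_subset hKQ hK
  have hE : LocallyIntegrableOn (fun z => ‖Du z‖ * γ ‖Du z‖) Q := by
    rw [locallyIntegrableOn_iff hQ.isLocallyClosed]
    intro K hKQ hK
    obtain ⟨B, hB⟩ := exists_setIntegral_energy_le hγ hP hA hC hc hM hK hQ hKQ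
    exact integrableOn_energy_limit hγ (iD hK hKQ) (hDu K hK hKQ).1 (hDu K hK hKQ).2 (iE hK hKQ)
      fun i => hB _ _ (hv i)
  refine ⟨Du, ⟨?_, ?_, ?_⟩, hE, ?_, ae_abs_le_of_tendsto hv hlim⟩
  · rw [locallyIntegrableOn_iff hQ.isLocallyClosed]
    exact fun K hKQ hK => iu hK hKQ
  · rw [locallyIntegrableOn_iff hQ.isLocallyClosed]
    exact fun K hKQ hK => (hDu K hK hKQ).1
  · intro φ hφ
    have hK := hφ.compact
    have hKQ := hφ.support
    have h1 := tendsto_setIntegral_bilinear (ContinuousLinearMap.lsmul ℝ ℝ) hK hQ.measurableSet hKQ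
      (iv hK hKQ) (iu hK hKQ) (tendsto_setIntegral_abs_sub hv hlim hK hKQ)
      hφ.continuous_spaceGrad fun z hz => hφ.spaceGrad_eq_zero hz
    have h2 := tendsto_setIntegral_bilinear (ContinuousLinearMap.lsmul ℝ ℝ).flip hK
      hQ.measurableSet hKQ (iD hK hKQ) (hDu _ hK hKQ).1 (hDu _ hK hKQ).2
      hφ.smooth.continuous fun z hz => image_eq_zero_of_notMem_tsupport hz
    simp only [ContinuousLinearMap.flip_apply, ContinuousLinearMap.lsmul_apply] at h1 h2
    exact tendsto_nhds_unique h1 (h2.neg.congr fun i => ((hv i).weakGrad.byParts φ hφ).symm)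
  · intro η hη hη0
    have hK := hη.compact
    have hKQ := hη.support
    obtain ⟨B, hB⟩ := exists_setIntegral_energy_le hγ hP hA hC hc hM hK hQ hKQ
    have hflux := tendsto_setIntegral_norm_flux_sub hγ hA hC hK (iD hK hKQ) (hDu _ hK hKQ).1
      (hDu _ hK hKQ).2 (iE hK hKQ) fun i => hB _ _ (hv i)
    -- The limit is not yet known to be a bounded supersolution, so the integrability of its flux is
    -- derived from its energy alone.
    have iAu : IntegrableOn (fun z => A (Du z)) (tsupport η) := by
      have h1 : IntegrableOn (fun z => (‖A 0‖ + C * γ 1⁻¹) + C * (‖Du z‖ * γ ‖Du z‖))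
          (tsupport η) := (integrableOn_const hK.measure_lt_top.ne).add
        ((hE.integrableOn_compact_subset hKQ hK).const_mul C)
      refine h1.mono' (hA.continuous.comp_aestronglyMeasurable
        (hDu _ hK hKQ).1.aestronglyMeasurable) (Eventually.of_forall fun z => ?_)
      have h2 := hγ.le_mul_add (norm_nonneg (Du z)) one_pos
      have h3 := mul_le_mul_of_nonneg_left h2 hC
      have h4 := hA.norm_le (Du z)
      linarith
    have h1 := tendsto_setIntegral_bilinear (ContinuousLinearMap.lsmul ℝ ℝ) hK hQ.measurableSet hKQ
      (iv hK hKQ) (iu hK hKQ) (tendsto_setIntegral_abs_sub hv hlim hK hKQ)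
      hη.continuous_timeDeriv fun z hz => hη.timeDeriv_eq_zero hz
    have h2 := tendsto_setIntegral_bilinear (innerSL ℝ) hK hQ.measurableSet hKQ
      (fun i => ((hv i).locallyIntegrableOn_flux hQ hγ hA hC).integrableOn_compact_subset hKQ hK)
      iAu hflux hη.continuous_spaceGrad fun z hz => hη.spaceGrad_eq_zero hz
    simp only [ContinuousLinearMap.lsmul_apply, smul_eq_mul] at h1
    exact ge_of_tendsto' (h1.neg.add h2) fun i => (hv i).super η hη hη0

end LimitPassage

/-! ### Cylinders that reach the final time, and the class `V^{2,G}_loc`. -/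

section Cylinders

variable {n : ℕ} {γ : ℝ → ℝ} {P : ℕ} {A : Space n → Space n} {C c : ℝ}
  {Q : Set (SpaceTime n)} {M : ℝ} {u : SpaceTime n → ℝ} {Du : SpaceTime n → Space n}
  {D : Set (Space n)} {s t : ℝ}

theorem exists_deriv_smoothTransition_le :
    ∃ B, ∀ x, ‖deriv Real.smoothTransition x‖ ≤ B := by
  have hc : ContDiff ℝ 1 Real.smoothTransition := Real.smoothTransition.contDiff
  refine (hc.continuous_deriv le_rfl).bounded_above_of_compact_support
    (HasCompactSupport.intro (isCompact_Icc (a := (0 : ℝ)) (b := 1)) fun x hx => ?_)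
  rcases lt_or_ge x 0 with h | h
  · have : Real.smoothTransition =ᶠ[𝓝 x] fun _ => 0 := by
      filter_upwards [Iio_mem_nhds h] with y hy
      exact Real.smoothTransition.zero_of_nonpos (le_of_lt hy)
    simpa using this.deriv_eq
  · have h1 : 1 < x := not_le.1 fun h' => hx ⟨h, h'⟩
    have : Real.smoothTransition =ᶠ[𝓝 x] fun _ => 1 := by
      filter_upwards [Ioi_mem_nhds h1] with y hy
      exact Real.smoothTransition.one_of_one_le (le_of_lt hy)
    simpa using this.deriv_eq

/-- Cutoff functions in time that rise from `0` to `1` at a fixed rate and then fall to `0` at an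
arbitrary rate: their derivatives are bounded above independently of the latter. -/
theorem exists_timeCutoff {s' : ℝ} (hs : s' < s) : ∃ κ : ℝ, 0 ≤ κ ∧ ∀ τ t', s < τ → τ < t' →
    ∃ ψ : ℝ → ℝ, ContDiff ℝ ∞ ψ ∧ (∀ r, 0 ≤ ψ r) ∧ (∀ r, ψ r ≤ 1) ∧ (∀ r, deriv ψ r ≤ κ) ∧
      (∀ r ∈ Ioo s τ, ψ r = 1) ∧ ∀ r ∉ Icc s' t', ψ r = 0 := by
  obtain ⟨B, hB⟩ := exists_deriv_smoothTransition_le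
  have hB0 : 0 ≤ B := (norm_nonneg _).trans (hB 0)
  have hd : 0 < s - s' := by linarith
  refine ⟨B / (s - s'), by positivity, fun τ t' hsτ hτ => ?_⟩
  have he : 0 < t' - τ := by linarith
  set S := Real.smoothTransition with hS
  have hSd : ContDiff ℝ ∞ S := Real.smoothTransition.contDiff
  have hdS : ∀ x, HasDerivAt S (deriv S x) x := fun x =>
    ((hSd.differentiable (by simp)) x).hasDerivAt
  have hS0 : ∀ x, 0 ≤ S x := Real.smoothTransition.nonneg
  have hS1 : ∀ x, S x ≤ 1 := Real.smoothTransition.le_one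
  have hS' : ∀ x, 0 ≤ deriv S x := fun x => Real.smoothTransition.monotone.deriv_nonneg
  refine ⟨fun r => S ((r - s') / (s - s')) * S ((t' - r) / (t' - τ)), ?_, ?_, ?_, ?_, ?_, ?_⟩
  · exact (hSd.comp (by fun_prop)).mul (hSd.comp (by fun_prop))
  · exact fun r => mul_nonneg (hS0 _) (hS0 _)
  · exact fun r => mul_le_one₀ (hS1 _) (hS0 _) (hS1 _)
  · intro r
    have h1 : HasDerivAt (fun r => (r - s') / (s - s')) (1 / (s - s')) r :=
      ((hasDerivAt_id r).sub_const s').div_const _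
    have h2 : HasDerivAt (fun r => (t' - r) / (t' - τ)) (-1 / (t' - τ)) r :=
      ((hasDerivAt_id r).const_sub t').div_const _
    have h3 := ((hdS _).comp r h1).mul ((hdS _).comp r h2)
    have h4 := h3.deriv
    simp only [Function.comp_def, Pi.mul_def] at h4
    rw [h4]
    have k1 : deriv S ((r - s') / (s - s')) * (1 / (s - s')) * S ((t' - r) / (t' - τ))
        ≤ B / (s - s') := by
      rw [mul_one_div]
      have h5 := (le_abs_self _).trans (hB ((r - s') / (s - s')))
      calc _ ≤ deriv S ((r - s') / (s - s')) / (s - s') * 1 :=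
            mul_le_mul_of_nonneg_left (hS1 _) (div_nonneg (hS' _) hd.le)
        _ ≤ _ := by rw [mul_one]; gcongr
    -- The falling factor contributes a nonpositive term, however steep the fall; dropping it keeps
    -- `κ` independent of `τ` and `t'`.
    have k2 : 0 ≤ S ((r - s') / (s - s')) * (deriv S ((t' - r) / (t' - τ)) * (1 / (t' - τ))) :=
      mul_nonneg (hS0 _) (mul_nonneg (hS' _) (by positivity))
    have k3 : S ((r - s') / (s - s')) * (deriv S ((t' - r) / (t' - τ)) * (-1 / (t' - τ)))
        = -(S ((r - s') / (s - s')) * (deriv S ((t' - r) / (t' - τ)) * (1 / (t' - τ)))) := by ring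
    linarith
  · intro r hr
    have h1 : S ((r - s') / (s - s')) = 1 := Real.smoothTransition.one_of_one_le
      ((one_le_div hd).2 (by linarith [hr.1]))
    have h2 : S ((t' - r) / (t' - τ)) = 1 := Real.smoothTransition.one_of_one_le
      ((one_le_div he).2 (by linarith [hr.2]))
    simp only [h1, h2, mul_one]
  · intro r hr
    rw [mem_Icc, not_and_or, not_le, not_le] at hr
    rcases hr with h | h
    · have h1 : S ((r - s') / (s - s')) = 0 := Real.smoothTransition.zero_of_nonpos
        (div_nonpos_of_nonpos_of_nonneg (by linarith) hd.le)
      simp only [h1, zero_mul]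
    · have h1 : S ((t' - r) / (t' - τ)) = 0 := Real.smoothTransition.zero_of_nonpos
        (div_nonpos_of_nonpos_of_nonneg (by linarith) he.le)
      simp only [h1, mul_zero]

/-- Cutoff functions for subcylinders that exhaust a cylinder up to its final time, with uniform
bounds. -/
theorem ParabolicallyInside.exists_cutoff (h : ParabolicallyInside D s t Q) :
    ∃ κ m : ℝ, 0 ≤ κ ∧ ∀ τ ∈ Ioo s t, ∃ φ : SpaceTime n → ℝ, IsTestFunction Q φ ∧
      (∀ z, 0 ≤ φ z) ∧ (∀ z, φ z ≤ 1) ∧ (∀ z, ‖spaceGrad φ z‖ ≤ κ) ∧ (∀ z, timeDeriv φ z ≤ κ) ∧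
      volume.real (tsupport φ) ≤ m ∧ ∀ z ∈ timeCylinder D s τ, φ z = 1 := by
  obtain ⟨-, hDc, -, D', s', hD', hDD', hs', hsub⟩ := h
  obtain ⟨χ, hχ, hχc, hχs, hχ0, hχ1, hχD⟩ := exists_contDiff_cutoff hDc hD' hDD'
  -- The rise starts at the midpoint of `(s', s)`, and below the fall ends at the midpoint of `(τ,
  -- t)`, so that the closed support lies in the open cylinder contained in `Q`.
  obtain ⟨κ₁, hκ₁0, hκ₁⟩ := exists_timeCutoff (show (s' + s) / 2 < s by linarith)
  obtain ⟨κ₂, hκ₂⟩ := (hχ.continuous_fderiv (by simp)).bounded_above_of_compact_support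
    (hχc.fderiv (𝕜 := ℝ))
  have hbig : IsCompact (tsupport χ ×ˢ Icc ((s' + s) / 2) t) := hχc.prod isCompact_Icc
  refine ⟨max κ₁ κ₂, volume.real (tsupport χ ×ˢ Icc ((s' + s) / 2) t), le_max_of_le_left hκ₁0,
    fun τ hτ => ?_⟩
  obtain ⟨ψ, hψ, hψ0, hψ1, hψd, hψτ, hψs⟩ := hκ₁ τ ((τ + t) / 2) hτ.1 (by linarith [hτ.2])
  have hcpt : IsCompact (tsupport χ ×ˢ Icc ((s' + s) / 2) ((τ + t) / 2)) := hχc.prod isCompact_Icc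
  have hts : tsupport (fun z : SpaceTime n => χ z.1 * ψ z.2)
      ⊆ tsupport χ ×ˢ Icc ((s' + s) / 2) ((τ + t) / 2) := by
    refine closure_minimal (fun z hz => ⟨?_, ?_⟩) hcpt.isClosed
    · exact subset_tsupport _ fun h0 => hz (by simp only [h0, zero_mul])
    · by_contra hc
      exact hz (by simp only [hψs _ hc, mul_zero])
  refine ⟨fun z => χ z.1 * ψ z.2, ⟨?_, hcpt.of_isClosed_subset (isClosed_tsupport _) hts, ?_⟩,
    fun z => mul_nonneg (hχ0 _) (hψ0 _), fun z => mul_le_one₀ (hχ1 _) (hψ0 _) (hψ1 _), ?_, ?_, ?_,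
    ?_⟩
  · exact (hχ.comp contDiff_fst).mul (hψ.comp contDiff_snd)
  · refine hts.trans (Subset.trans ?_ hsub)
    refine prod_mono hχs (Icc_subset_Ioo ?_ ?_)
    · linarith
    · linarith [hτ.2]
  · intro z
    have h1 : HasFDerivAt (fun x => χ x * ψ z.2) (ψ z.2 • fderiv ℝ χ z.1) z.1 :=
      ((hχ.differentiable (by simp)) z.1).hasFDerivAt.mul_const (ψ z.2)
    rw [spaceGrad, gradient, LinearIsometryEquiv.norm_map, h1.fderiv, norm_smul,
      Real.norm_of_nonneg (hψ0 _)]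
    calc ψ z.2 * ‖fderiv ℝ χ z.1‖ ≤ 1 * ‖fderiv ℝ χ z.1‖ :=
          mul_le_mul_of_nonneg_right (hψ1 _) (norm_nonneg _)
      _ ≤ max κ₁ κ₂ := by rw [one_mul]; exact (hκ₂ _).trans (le_max_right _ _)
  · intro z
    have h1 : HasDerivAt (fun r => χ z.1 * ψ r) (χ z.1 * deriv ψ z.2) z.2 :=
      ((hψ.differentiable (by simp)) z.2).hasDerivAt.const_mul _
    rw [timeDeriv, h1.deriv]
    calc χ z.1 * deriv ψ z.2 ≤ χ z.1 * κ₁ := mul_le_mul_of_nonneg_left (hψd _) (hχ0 _)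
      _ ≤ 1 * κ₁ := mul_le_mul_of_nonneg_right (hχ1 _) hκ₁0
      _ ≤ max κ₁ κ₂ := by rw [one_mul]; exact le_max_left _ _
  · refine measureReal_mono (hts.trans (prod_mono_right (Icc_subset_Icc_right ?_)))
      hbig.measure_lt_top.ne
    linarith [hτ.2]
  · intro z hz
    simp only [hχD _ (subset_closure hz.1), hψτ _ hz.2, mul_one]

theorem ParabolicallyInside.subset (h : ParabolicallyInside D s t Q) : timeCylinder D s t ⊆ Q := by
  obtain ⟨-, -, -, D', s', -, hDD', hs', hsub⟩ := h
  exact Subset.trans (prod_mono (subset_closure.trans hDD') (Ioo_subset_Ioo_left hs'.le)) hsub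

theorem ParabolicallyInside.volume_ne_top (h : ParabolicallyInside D s t Q) :
    volume (timeCylinder D s t) ≠ ⊤ :=
  ne_top_of_le_ne_top (h.2.1.prod (isCompact_Icc (a := s) (b := t))).measure_lt_top.ne
    (measure_mono (prod_mono subset_closure Ioo_subset_Icc_self))

theorem IsWeakSpaceGrad.mono {Q' : Set (SpaceTime n)} (h : IsWeakSpaceGrad Q u Du)
    (hQ : MeasurableSet Q) (hQ' : Q' ⊆ Q) : IsWeakSpaceGrad Q' u Du := by
  refine ⟨h.locInt.mono_set hQ', h.locInt_grad.mono_set hQ', fun φ hφ => ?_⟩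
  have key := h.byParts φ (hφ.mono hQ')
  rwa [setIntegral_eq_of_subset_of_forall_sdiff_eq_zero hQ hQ',
    setIntegral_eq_of_subset_of_forall_sdiff_eq_zero hQ hQ'] at key
  · intro z hz
    rw [image_eq_zero_of_notMem_tsupport fun hc => hz.2 (hφ.support hc), zero_smul]
  · intro z hz
    rw [hφ.spaceGrad_eq_zero fun hc => hz.2 (hφ.support hc), smul_zero]

/-- A bounded supersolution has finite energy up to the final time of a cylinder. -/
theorem IsBoundedSupersolution.lintegral_energy_lt_top (hγ : IsGrowthFunction γ P) (hP : 1 ≤ P)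
    (hA : IsMonotoneField A γ C c) (hC : 0 ≤ C) (hc : 0 < c) (hM : 0 ≤ M) (hQ : IsOpen Q)
    (hu : IsBoundedSupersolution A γ Q M u Du) (h : ParabolicallyInside D s t Q) :
    ∫⁻ z in timeCylinder D s t, ENNReal.ofReal (‖Du z‖ * γ ‖Du z‖) < ⊤ := by
  obtain ⟨κ, m, hκ, hcut⟩ := h.exists_cutoff
  obtain ⟨B, hB⟩ := integral_energy_le hγ hP hA hC hc hM hκ m
  have hst : s < t := h.2.2.1
  have hle : ∀ τ ∈ Ioo s t, ∫⁻ z in timeCylinder D s τ, ENNReal.ofReal (‖Du z‖ * γ ‖Du z‖)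
      ≤ ENNReal.ofReal B := by
    intro τ hτ
    obtain ⟨φ, hφ, hφ0, hφ1, hφg, hφt, hφm, hφD⟩ := hcut τ hτ
    obtain ⟨h1, h2⟩ := hB Q u Du φ hQ hu hφ hφ0 hφ1 hφg hφt hφm
    have h0 : ∀ z, 0 ≤ φ z ^ (P + 1) * (‖Du z‖ * γ ‖Du z‖) := fun z =>
      mul_nonneg (pow_nonneg (hφ0 z) _) (mul_nonneg (norm_nonneg _) (hγ.nonneg _))
    calc ∫⁻ z in timeCylinder D s τ, ENNReal.ofReal (‖Du z‖ * γ ‖Du z‖)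
        = ∫⁻ z in timeCylinder D s τ, ENNReal.ofReal (φ z ^ (P + 1) * (‖Du z‖ * γ ‖Du z‖)) :=
          setLIntegral_congr_fun (h.1.measurableSet.prod measurableSet_Ioo) fun z hz => by
            simp only [hφD z hz, one_pow, one_mul]
      _ ≤ ∫⁻ z, ENNReal.ofReal (φ z ^ (P + 1) * (‖Du z‖ * γ ‖Du z‖)) :=
          setLIntegral_le_lintegral _ _
      _ = ENNReal.ofReal (∫ z, φ z ^ (P + 1) * (‖Du z‖ * γ ‖Du z‖)) :=
          (ofReal_integral_eq_lintegral_ofReal h1 (Eventually.of_forall h0)).symm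
      _ ≤ ENNReal.ofReal B := ENNReal.ofReal_le_ofReal h2
  -- The energy bound does not depend on `τ`, so it survives exhaustion of the cylinder. The shift
  -- by `2` keeps the final time strictly above `s` already for `k = 0`.
  have hmono : Monotone fun k : ℕ => timeCylinder D s (t - (t - s) / (k + 2)) := by
    intro k l hkl
    refine prod_mono_right (Ioo_subset_Ioo_right ?_)
    have : (k : ℝ) ≤ l := by exact_mod_cast hkl
    have : (t - s) / (l + 2) ≤ (t - s) / (k + 2) := by gcongr
    linarith
  have hunion : timeCylinder D s t = ⋃ k : ℕ, timeCylinder D s (t - (t - s) / (k + 2)) := by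
    ext z
    simp only [timeCylinder, mem_iUnion, mem_prod, mem_Ioo]
    constructor
    · rintro ⟨h1, h2, h3⟩
      have h4 : 0 < t - z.2 := by linarith
      obtain ⟨k, hk⟩ := exists_nat_gt ((t - s) / (t - z.2))
      refine ⟨k, h1, h2, ?_⟩
      rw [div_lt_iff₀ h4] at hk
      have : (t - s) / (k + 2) < t - z.2 := by
        rw [div_lt_iff₀ (by positivity)]
        nlinarith
      linarith
    · rintro ⟨k, h1, h2, h3⟩
      have : 0 < (t - s) / ((k : ℝ) + 2) := div_pos (by linarith) (by positivity)
      exact ⟨h1, h2, by linarith⟩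
  rw [hunion, setLIntegral_iUnion_of_directed _ hmono.directed_le]
  refine (iSup_le fun k => hle _ ⟨?_, ?_⟩).trans_lt ENNReal.ofReal_lt_top
  · have : (t - s) / ((k : ℝ) + 2) < t - s := by
      rw [div_lt_iff₀ (by positivity)]
      have : (0 : ℝ) ≤ k := k.cast_nonneg
      nlinarith
    linarith
  · have : 0 < (t - s) / ((k : ℝ) + 2) := div_pos (by linarith) (by positivity)
    linarith

theorem ae_setLIntegral_sq_le (hDv : volume D ≠ ⊤)
    (hu : ∀ᵐ z ∂volume.restrict (timeCylinder D s t), |u z| ≤ M) :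
    ∃ R : ℝ≥0, ∀ᵐ τ ∂volume.restrict (Ioo s t), ∫⁻ x in D, ‖u (x, τ)‖ₑ ^ 2 ≤ R := by
  have h1 : ENNReal.ofReal M ^ 2 * volume D ≠ ⊤ :=
    ENNReal.mul_ne_top (ENNReal.pow_ne_top ENNReal.ofReal_ne_top) hDv
  refine ⟨(ENNReal.ofReal M ^ 2 * volume D).toNNReal, ?_⟩
  rw [timeCylinder, Measure.volume_eq_prod, ← Measure.prod_restrict] at hu
  -- The factors are swapped so that Fubini yields a statement for almost every time, each slice
  -- being bounded by `M² |D|`.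
  have h2 := Measure.ae_ae_of_ae_prod (Measure.measurePreserving_swap
    (μ := volume.restrict (Ioo s t)) (ν := volume.restrict D) |>.quasiMeasurePreserving.ae hu)
  filter_upwards [h2] with τ hτ
  rw [ENNReal.coe_toNNReal h1, ← setLIntegral_const]
  refine lintegral_mono_ae ?_
  filter_upwards [hτ] with x hx
  gcongr
  rw [Real.enorm_eq_ofReal_abs]
  exact ENNReal.ofReal_le_ofReal hx

/-- The bound `|u| ≤ M` on a cylinder of finite measure settles all conditions on `u`; those on `Du`
follow from the energy up to the final time, which dominates both `G(|Du|)` and, up to a constant,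
`|Du|`. -/
theorem IsBoundedSupersolution.memV2G (hγ : IsGrowthFunction γ P) (hP : 1 ≤ P)
    (hA : IsMonotoneField A γ C c) (hC : 0 ≤ C) (hc : 0 < c) (hM : 0 ≤ M) (hQ : IsOpen Q)
    {G : ℝ → ℝ} (hG : ∀ s, 0 ≤ s → G s ≤ s * γ s) (hu : IsBoundedSupersolution A γ Q M u Du)
    (h : ParabolicallyInside D s t Q) : MemV2G G D s t u Du := by
  have hres : volume.restrict (timeCylinder D s t) ≤ volume.restrict Q :=
    Measure.restrict_mono h.subset le_rfl
  have hb := ae_mono hres hu.bounded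
  have hmu := hu.aestronglyMeasurable.mono_measure hres
  have hmD := hu.aestronglyMeasurable_grad.mono_measure hres
  have hfin := hu.lintegral_energy_lt_top hγ hP hA hC hc hM hQ h
  have he : IntegrableOn (fun z => ‖Du z‖ * γ ‖Du z‖) (timeCylinder D s t) := by
    refine ⟨(hγ.continuous_mul.comp continuous_norm).comp_aestronglyMeasurable hmD, ?_⟩
    rwa [hasFiniteIntegral_iff_ofReal
      (Eventually.of_forall fun z => mul_nonneg (norm_nonneg _) (hγ.nonneg _))]
  refine ⟨hu.weakGrad.mono hQ.measurableSet h.subset, ⟨hmu, ?_⟩, ⟨hmD, ?_⟩, ?_, ?_, ?_⟩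
  · refine lt_of_le_of_lt (lintegral_mono_ae (g := fun _ => ENNReal.ofReal (M * γ M)) ?_) ?_
    · filter_upwards [hb] with z hz
      refine ENNReal.ofReal_le_ofReal ((hG _ (norm_nonneg _)).trans ?_)
      exact mul_le_mul hz (hγ.monotone hz) (hγ.nonneg _) hM
    · rw [setLIntegral_const]
      exact ENNReal.mul_lt_top ENNReal.ofReal_lt_top h.volume_ne_top.lt_top
  · exact (lintegral_mono fun z => ENNReal.ofReal_le_ofReal (hG _ (norm_nonneg _))).trans_lt hfin
  · exact Integrable.mono' (g := fun _ => M) (integrableOn_const h.volume_ne_top) hmu hb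
  · obtain ⟨R, -, hR⟩ := hγ.exists_le_mul_add one_pos
    exact Integrable.mono' (he.const_mul 1 |>.add (integrableOn_const h.volume_ne_top (C := R))) hmD
      (Eventually.of_forall fun z => hR _ (norm_nonneg _))
  · exact ae_setLIntegral_sq_le
      (ne_top_of_le_ne_top h.2.1.measure_lt_top.ne (measure_mono subset_closure)) hb

theorem IsBoundedSupersolution.isWeakSupersolution (hγ : IsGrowthFunction γ P) (hP : 1 ≤ P)
    (hA : IsMonotoneField A γ C c) (hC : 0 ≤ C) (hc : 0 < c) (hM : 0 ≤ M) (hQ : IsOpen Q)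
    {g : ℝ → ℝ} (hG : ∀ s, 0 ≤ s → youngPrimitive g s ≤ s * γ s)
    (hu : IsBoundedSupersolution A γ Q M u Du) : IsWeakSupersolution A g Q u :=
  ⟨Du, ⟨hu.weakGrad, fun _ _ _ h => hu.memV2G hγ hP hA hC hc hM hQ hG h⟩, hu.super⟩

/-- Every point of an open set has a neighbourhood that is a cylinder inside the set. -/
theorem exists_parabolicallyInside_mem_nhds (hQ : IsOpen Q) {z : SpaceTime n} (hz : z ∈ Q) :
    ∃ D s t, ParabolicallyInside D s t Q ∧ timeCylinder D s t ∈ 𝓝 z := by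
  obtain ⟨ε, hε, hball⟩ := Metric.isOpen_iff.1 hQ z hz
  refine ⟨Metric.ball z.1 (ε / 2), z.2 - ε / 2, z.2 + ε / 2, ⟨Metric.isOpen_ball, ?_, by linarith,
    Metric.ball z.1 ε, z.2 - ε, Metric.isOpen_ball, ?_, by linarith, ?_⟩, ?_⟩
  · exact (isCompact_closedBall z.1 (ε / 2)).of_isClosed_subset isClosed_closure
      Metric.closure_ball_subset_closedBall
  · exact Metric.closure_ball_subset_closedBall.trans (Metric.closedBall_subset_ball (by linarith))
  · refine Subset.trans (fun w hw => ?_) hball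
    rw [Metric.mem_ball, Prod.dist_eq, max_lt_iff, Real.dist_eq, abs_lt]
    exact ⟨hw.1, by linarith [hw.2.1], by linarith [hw.2.2]⟩
  · exact prod_mem_nhds (Metric.ball_mem_nhds _ (by linarith))
      (Ioo_mem_nhds (by linarith) (by linarith))

/-- Local integrability of the energy is read off from `G(|Du|)` on a small cylinder around each
point, using that `s γ(s)` is at most a multiple of `G(s)`. -/
theorem IsWeakSupersolution.exists_isBoundedSupersolution (hγ : IsGrowthFunction γ P)
    (hQ : IsOpen Q) {g : ℝ → ℝ} {R : ℝ} (hR : 0 ≤ R)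
    (hG : ∀ s, 0 ≤ s → s * γ s ≤ R * youngPrimitive g s) (hu : IsWeakSupersolution A g Q u)
    (hb : ∀ᵐ z ∂volume.restrict Q, |u z| ≤ M) : ∃ Du, IsBoundedSupersolution A γ Q M u Du := by
  obtain ⟨Du, ⟨hgrad, hV⟩, hsup⟩ := hu
  refine ⟨Du, hgrad, fun z hz => ?_, hsup, hb⟩
  obtain ⟨D, s, t, h, hnhds⟩ := exists_parabolicallyInside_mem_nhds hQ hz
  obtain ⟨hm, hfin⟩ := (hV D s t h).memOrlicz_grad
  refine ⟨timeCylinder D s t, mem_nhdsWithin_of_mem_nhds hnhds,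
    (hγ.continuous_mul.comp continuous_norm).comp_aestronglyMeasurable hm, ?_⟩
  rw [hasFiniteIntegral_iff_ofReal
    (Eventually.of_forall fun z => mul_nonneg (norm_nonneg _) (hγ.nonneg _))]
  calc ∫⁻ z in timeCylinder D s t, ENNReal.ofReal (‖Du z‖ * γ ‖Du z‖)
      ≤ ∫⁻ z in timeCylinder D s t, ENNReal.ofReal R * ENNReal.ofReal (youngPrimitive g ‖Du z‖) :=
        lintegral_mono fun z => by
          rw [← ENNReal.ofReal_mul hR]
          exact ENNReal.ofReal_le_ofReal (hG _ (norm_nonneg _))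
    _ = ENNReal.ofReal R * ∫⁻ z in timeCylinder D s t, ENNReal.ofReal (youngPrimitive g ‖Du z‖) :=
        lintegral_const_mul' _ _ ENNReal.ofReal_ne_top
    _ < ⊤ := ENNReal.mul_lt_top ENNReal.ofReal_lt_top hfin

end Cylinders

/-! ### Assembly of the theorem. -/

theorem mainTheorem3 (n : ℕ) (hn : 2 ≤ n)
    (g : ℝ → ℝ) (g₀ g₁ : ℝ) (hg₀ : 2 * (n : ℝ) / ((n : ℝ) + 2) < g₀) (hg₁ : g₀ ≤ g₁)
    (hg : HasOrliczGrowth g g₀ g₁)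
    (A : Space n → Space n) (ν L : ℝ) (hν : 0 < ν) (hν₁ : ν ≤ 1) (hL : 1 ≤ L)
    (hA : HasOrliczStructure A g ν L)
    (Ω : Set (Space n)) (hΩ : IsOpen Ω) (hΩc : IsConnected Ω) (hΩb : Bornology.IsBounded Ω)
    (T : ℝ) (hT : 0 < T)
    (Q : Set (SpaceTime n)) (hQ : IsOpen Q) (hQΩ : Q ⊆ timeCylinder Ω 0 T)
    (M : ℝ) (hM : 1 ≤ M)
    (v : ℕ → SpaceTime n → ℝ) (u : SpaceTime n → ℝ)
    (hv : ∀ i, IsWeakSupersolution A g Q (v i))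
    (hvM : ∀ i, ∀ᵐ z ∂(volume.restrict Q), |v i z| ≤ M)
    (hlim : ∀ᵐ z ∂(volume.restrict Q), Tendsto (fun i => v i z) atTop (𝓝 (u z))) :
    IsWeakSupersolution A g Q u := by
  have hn' : (2 : ℝ) ≤ n := by exact_mod_cast hn
  -- For `n ≥ 2` the critical exponent `2n/(n + 2)` is at least `1`.
  have h₀ : 1 < g₀ := by
    refine lt_of_le_of_lt ?_ hg₀
    rw [one_le_div (by positivity)]
    linarith
  -- Any integer `P ≥ 1` with `g₁ - 1 ≤ P` would serve as the doubling exponent.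
  set P : ℕ := ⌈g₁⌉₊
  have hP' : g₁ ≤ P := Nat.le_ceil g₁
  have hP : 1 ≤ P := by
    have : (1 : ℝ) < P := by linarith
    exact_mod_cast this.le
  have hγ : IsGrowthFunction (extendZero g) P := hg.isGrowthFunction h₀ (by linarith)
  have hA' : IsMonotoneField A (extendZero g) (L / (g₀ - 1)) (ν / 2 ^ (P + 1)) :=
    hA.isMonotoneField hg h₀ hν (by linarith) (by linarith)
  have hC : 0 ≤ L / (g₀ - 1) := div_nonneg (by linarith) (by linarith)
  have hc : 0 < ν / 2 ^ (P + 1) := by positivity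
  have hM' : 0 ≤ M := by linarith
  have hex : ∀ i, ∃ Dv, IsBoundedSupersolution A (extendZero g) Q M (v i) Dv := fun i =>
    (hv i).exists_isBoundedSupersolution hγ hQ (R := 2 ^ (P + 1)) (by positivity)
      (fun s hs => by
        rw [HasOrliczGrowth.youngPrimitive_eq g hs]
        exact hγ.le_primitive hs) (hvM i)
  choose D hD using hex
  obtain ⟨Du, hu⟩ := exists_isBoundedSupersolution_of_tendsto hγ hP hA' hC hc hM' hQ hD hlim
  exact hu.isWeakSupersolution hγ hP hA' hC hc hM' hQ fun s hs => by
    rw [HasOrliczGrowth.youngPrimitive_eq g hs]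
    exact hγ.primitive_le hs
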